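/- Let $\triangle=[v_1,v_2,v_3]\subset\mathbb{R}^2$ be a nondegenerate (closed) triangle and let its Powell--Sabin 12-split be the triangulation with twelve faces obtained by drawing all segments between the corners and the edge midpoints $v_4=\frac{v_1+v_2}{2}$, $v_5=\frac{v_2+v_3}{2}$, $v_6=\frac{v_1+v_3}{2}$. Its remaining vertices are $v_7=\frac{v_4+v_6}{2}$, $v_8=\frac{v_4+v_5}{2}$, $v_9=\frac{v_5+v_6}{2}$ and the centroid $v_{10}$. Every point of $\triangle$ is assigned to exactly one of the closed faces containing it; this defines half-open faces. For a multiset $K=\{v_1^{m_1}\cdots v_{10}^{m_{10}}\}$ let $|K|=m_1+\dots+m_{10}$, let $[K]$ be its convex hull, and let $[K)$ be the half-open convex hull: the union of the half-open faces whose closed faces lie in $[K]$, if $[K]$ is a union of closed faces; in general, the set of $x\in\triangle$ such that $[K]$ contains the points $x+\varepsilon(c-x)$ for all sufficiently small $\varepsilon>0$, where $c$ is a fixed interior point, on no line through two of the $v_i$, of the face to which $x$ is assigned. The simplex spline $Q[K]:\mathbb{R}^2\to\mathbb{R}$ is defined recursively by $Q[K]=0$ if $\operatorname{area}[K]=0$;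 $Q[K]=\frac{\operatorname{area}\triangle}{\operatorname{area}[K]}\mathbf 1_{[K)}$ if $\operatorname{area}[K]\neq0$ and $|K|=3$; and $Q[K](x)=\sum_{j=1}^{10}\beta_j\,Q[K\setminus v_j](x)$ if $\operatorname{area}[K]\ne0$ and $|K|>3$, where $x=\sum_j\beta_jv_j$, $\sum_j\beta_j=1$, and $\beta_j=0$ whenever $m_j=0$ (any choice of such $\beta_j$). Call $Q[K]$ a *$C^3$ quintic simplex spline on the 12-split* if $|K|=8$, $\operatorname{area}[K]\neq0$, $Q[K]$ is of class $C^3$ on $\triangle$, and $Q[K]$ is a polynomial of total degree at most $5$ on each face of the 12-split. Let $B_1,\dots,B_8$ be the consecutive quintic B-splines (normalized to sum to $1$) on $[0,1]$ with knot sequence $0^6\,0.5^2\,1^6$. Say that $Q[K]$ *reduces to a B-spline on the boundary* if for all $1\le i<k\le3$ the function $t\mapsto Q[K]((1-t)v_i+tv_k)$, $t\in[0,1]$, is either identically zero or equal to $\frac{\operatorname{area}\triangle}{\operatorname{area}[K]}B_r$ for some $r\in\{1,\dots,8\}$. The group $S_3$ acts on $\{v_1,\dots,v_{10}\}$ through the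 affine bijections of $\mathbb{R}^2$ permuting $v_1,v_2,v_3$, and hence on multisets $K$ of vertices. Write $m_1m_2m_3m_4m_5m_6$ for the multiset $\{v_1^{m_1}\cdots v_6^{m_6}\}$, and let $Q^a,\dots,Q^t$ be the simplex splines $Q[K_a],\dots,Q[K_t]$ of the twenty multisets $$\begin{array}{lllll} K_a=600101,&K_b=500201,&K_c=501200,&K_d=410102,&K_e=410201,\\ K_f=320201,&K_g=220211,&K_h=422000,&K_i=332000,&K_j=412100,\\ K_k=322100,&K_l=141110,&K_m=132110,&K_n=222110,&K_o=221111,\\ K_p=411200,&K_q=321200,&K_r=131210,&K_s=221210,&K_t=121211. \end{array}$$ **Theorem.** For every multiset $K$ of vertices of the 12-split, $Q[K]$ is a $C^3$ quintic simplex spline on the 12-split that reduces to a B-spline on the boundary if and only if $K=\sigma(K_\star)$ for some $\sigma\in S_3$ and some $\star\in\{a,\dots,t\}$. Moreover, the twenty simplex splines represent distinct $S_3$ equivalence classes: if $Q[\sigma(K_\star)]=Q[K_\bullet]$ for some $\sigma\in S_3$ and $\star,\bullet\in\{a,\dots,t\}$, then $\star=\bullet$. -/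

import Mathlib

open MeasureTheory Filter Topology

noncomputable section

namespace PS12

/-- The Euclidean plane. -/
abbrev Plane : Type := EuclideanSpace ℝ (Fin 2)

/-- Barycentric coordinates, with respect to the corners `v₁, v₂, v₃`, of the ten vertices
`v₁, …, v₁₀` of the Powell-Sabin 12-split (here indexed by `0, …, 9`): the corners, the midpoints
`v₄, v₅, v₆` of `[v₁,v₂]`, `[v₂,v₃]`, `[v₁,v₃]`, the midpoints `v₇, v₈, v₉` of `[v₄,v₆]`,
`[v₄,v₅]`, `[v₅,v₆]` (lying on the medians through `v₁, v₂, v₃`), and the centroid `v₁₀`. -/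
def bary : Fin 10 → Fin 3 → ℚ :=
  ![![1, 0, 0], ![0, 1, 0], ![0, 0, 1],
    ![1/2, 1/2, 0], ![0, 1/2, 1/2], ![1/2, 0, 1/2],
    ![1/2, 1/4, 1/4], ![1/4, 1/2, 1/4], ![1/4, 1/4, 1/2],
    ![1/3, 1/3, 1/3]]

/-- The vertices of the 12-split of the triangle with corners `T 0, T 1, T 2`. -/
def vertex (T : Fin 3 → Plane) (i : Fin 10) : Plane :=
  ∑ k, ((bary i k : ℚ) : ℝ) • T k

/-- The (closed) triangle with corners `T 0, T 1, T 2`. -/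
def triangle (T : Fin 3 → Plane) : Set Plane := convexHull ℝ (Set.range T)

/-- The vertices of the twelve faces of the 12-split. The faces are listed in the order of priority
that is used to assign the points on the interior edges to faces. -/
def faceVertex : Fin 12 → Fin 3 → Fin 10 :=
  ![![1, 4, 7], ![4, 7, 9], ![2, 4, 8], ![4, 8, 9], ![1, 3, 7], ![3, 7, 9],
    ![3, 6, 9], ![0, 3, 6], ![2, 5, 8], ![5, 8, 9], ![5, 6, 9], ![0, 5, 6]]

/-- The closed faces of the 12-split. -/
def closedFace (T : Fin 3 → Plane) (f : Fin 12) : Set Plane :=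
  convexHull ℝ (Set.range fun j => vertex T (faceVertex f j))

/-- The half-open faces of the 12-split: they partition the triangle, and each of them lies between
the interior of the face and the closed face. -/
def halfOpenFace (T : Fin 3 → Plane) (f : Fin 12) : Set Plane :=
  closedFace T f \ ⋃ g : Fin 12, ⋃ _ : g < f, closedFace T g

/-- A point in the interior of a face that is on none of the lines joining two vertices
of the 12-split. -/
def facePoint (T : Fin 3 → Plane) (f : Fin 12) : Plane :=
  (1/2 : ℝ) • vertex T (faceVertex f 0) + (1/4 : ℝ) • vertex T (faceVertex f 1)
    + (1/4 : ℝ) • vertex T (faceVertex f 2)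

/-- A finite multiset of vertices of the 12-split, `K i` being the multiplicity of the
vertex `i`. -/
abbrev Knots : Type := Fin 10 → ℕ

/-- The convex hull `[K]` of a knot multiset. -/
def hull (T : Fin 3 → Plane) (K : Knots) : Set Plane :=
  convexHull ℝ (vertex T '' {i | K i ≠ 0})

/-- Lebesgue area. -/
def area (s : Set Plane) : ℝ := volume.real s

/-- The half-open convex hull `[K)`. A point `x` of the half-open face `f` belongs to it if `[K]`
contains the points of `f` near `x` in the direction of `facePoint T f`. When `[K]` is a union of
closed faces, this says that `f` is one of these, so that `[K)` is the union of the corresponding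
half-open faces. -/
def halfOpenHull (T : Fin 3 → Plane) (K : Knots) : Set Plane :=
  {x | ∃ f, x ∈ halfOpenFace T f ∧
    ∀ᶠ ε : ℝ in 𝓝[>] 0, AffineMap.lineMap x (facePoint T f) ε ∈ hull T K}

/-- The numbers `β` represent `x` as an affine combination of the knots in `K`. -/
def IsAffineRep (T : Fin 3 → Plane) (K : Knots) (x : Plane) (β : Fin 10 → ℝ) : Prop :=
  x = ∑ j, β j • vertex T j ∧ ∑ j, β j = 1 ∧ ∀ j, K j = 0 → β j = 0

/-- Some numbers `β` as above (these exist as soon as `[K]` has nonzero area). -/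
def affineRep (T : Fin 3 → Plane) (K : Knots) (x : Plane) : Fin 10 → ℝ :=
  Classical.epsilon (IsAffineRep T K x)

/-- The multiset `K` with one copy of the vertex `j` removed. -/
def remove (K : Knots) (j : Fin 10) : Knots := Function.update K j (K j - 1)

open Classical in
/-- The recursion for the simplex spline on a multiset `K` of `n + 3` knots. -/
def simplexSplineRec (T : Fin 3 → Plane) : ℕ → Knots → Plane → ℝ
  | 0, K, x =>
      if area (hull T K) = 0 then 0
      else (halfOpenHull T K).indicator 1 x * (area (triangle T) / area (hull T K))
  | n + 1, K, x =>
      if area (hull T K) = 0 then 0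
      else ∑ j, affineRep T K x j * simplexSplineRec T n (remove K j) x

/-- The area normalized simplex spline `Q[K]` (multisets of fewer than three knots have zero area
and hence give `0`). -/
def simplexSpline (T : Fin 3 → Plane) (K : Knots) : Plane → ℝ :=
  simplexSplineRec T ((∑ i, K i) - 3) K

/-- The space of `C^r` splines of degree `d` on the 12-split: functions that are of class `C^r` on
the triangle and that agree on each face with a polynomial of total degree at most `d`. (The values
outside of the triangle play no role.) -/
def splineSpace (T : Fin 3 → Plane) (r d : ℕ) : Set (Plane → ℝ) :=
  {s | ContDiffOn ℝ r s (triangle T) ∧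
    ∀ f, ∃ p : MvPolynomial (Fin 2) ℝ, p.totalDegree ≤ d ∧
      ∀ x ∈ closedFace T f, s x = MvPolynomial.eval (fun i => x i) p}

/-- `Q[K]` is a `C^3` quintic simplex spline on the 12-split: it has `5 + 3` knots, it is
nondegenerate, and it belongs to the space of `C^3` quintics on the 12-split. -/
def IsC3QuinticSimplexSpline (T : Fin 3 → Plane) (K : Knots) : Prop :=
  ∑ i, K i = 8 ∧ area (hull T K) ≠ 0 ∧ simplexSpline T K ∈ splineSpace T 3 5

/-- The open knot sequence `0⁶ 0.5² 1⁶`. -/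
def knot (i : ℕ) : ℝ := if i < 6 then 0 else if i < 8 then 1/2 else 1

open Classical in
/-- The `i`-th univariate B-spline of degree `d` on the knot sequence `knot`, by the Cox-de Boor
recursion (a quotient with denominator zero counts as zero), with the usual convention that the last
nonempty knot interval is closed. -/
def bSpline : ℕ → ℕ → ℝ → ℝ
  | 0, i, t =>
      if (knot i ≤ t ∧ t < knot (i + 1)) ∨ (t = 1 ∧ knot i < 1 ∧ knot (i + 1) = 1) then 1 else 0
  | d + 1, i, t =>
      (t - knot i) / (knot (i + d + 1) - knot i) * bSpline d i t
        + (knot (i + d + 2) - t) / (knot (i + d + 2) - knot (i + 1)) * bSpline d (i + 1) t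

/-- `Q[K]` reduces to a B-spline on the boundary: on each edge of the triangle it is either zero or
`area(triangle) / area([K])` times one of the eight consecutive quintic B-splines on
`0⁶ 0.5² 1⁶`. -/
def ReducesToBSpline (T : Fin 3 → Plane) (K : Knots) : Prop :=
  ∀ i k : Fin 3, i < k →
    (∀ t ∈ Set.Icc (0 : ℝ) 1, simplexSpline T K (AffineMap.lineMap (T i) (T k) t) = 0) ∨
    ∃ r : Fin 8, ∀ t ∈ Set.Icc (0 : ℝ) 1,
      simplexSpline T K (AffineMap.lineMap (T i) (T k) t)
        = area (triangle T) / area (hull T K) * bSpline 5 r t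

/-- The permutations of the ten vertices induced by the symmetries in `S₃`: the affine bijection that
sends `v_k` to `v_(τ k)` for the three corners sends the vertex `i` to the vertex `π i`. -/
def IsSymmetry (π : Equiv.Perm (Fin 10)) : Prop :=
  ∃ τ : Equiv.Perm (Fin 3), ∀ i k, bary (π i) (τ k) = bary i k

/-- The image of a knot multiset under a permutation of the vertices: the vertex `π i` has in it the
multiplicity that `i` has in `K`. -/
def permute (π : Equiv.Perm (Fin 10)) (K : Knots) : Knots := fun i => K (π.symm i)

/-- The knot multisets of the simplex splines `Q^a, …, Q^t`. -/
def table : Fin 20 → Knots :=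
  ![![6, 0, 0, 1, 0, 1, 0, 0, 0, 0],
    ![5, 0, 0, 2, 0, 1, 0, 0, 0, 0],
    ![5, 0, 1, 2, 0, 0, 0, 0, 0, 0],
    ![4, 1, 0, 1, 0, 2, 0, 0, 0, 0],
    ![4, 1, 0, 2, 0, 1, 0, 0, 0, 0],
    ![3, 2, 0, 2, 0, 1, 0, 0, 0, 0],
    ![2, 2, 0, 2, 1, 1, 0, 0, 0, 0],
    ![4, 2, 2, 0, 0, 0, 0, 0, 0, 0],
    ![3, 3, 2, 0, 0, 0, 0, 0, 0, 0],
    ![4, 1, 2, 1, 0, 0, 0, 0, 0, 0],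
    ![3, 2, 2, 1, 0, 0, 0, 0, 0, 0],
    ![1, 4, 1, 1, 1, 0, 0, 0, 0, 0],
    ![1, 3, 2, 1, 1, 0, 0, 0, 0, 0],
    ![2, 2, 2, 1, 1, 0, 0, 0, 0, 0],
    ![2, 2, 1, 1, 1, 1, 0, 0, 0, 0],
    ![4, 1, 1, 2, 0, 0, 0, 0, 0, 0],
    ![3, 2, 1, 2, 0, 0, 0, 0, 0, 0],
    ![1, 3, 1, 2, 1, 0, 0, 0, 0, 0],
    ![2, 2, 1, 2, 1, 0, 0, 0, 0, 0],
    ![1, 2, 1, 2, 1, 1, 0, 0, 0, 0]]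

end PS12

end

noncomputable section

namespace PS12

/-! In homogeneous barycentric coordinates the vertices are vectors `V j` in ℝ³, and Cramer's rule
supplies the coefficients of the recursion. Locally, away from the lines through two knots, the
recursion starts from constant values `b` on three-knot multisets; this is `spl b`. It is
independent of the chosen representations as soon as `b` satisfies one linear relation for each
four-knot multiset (`spl_rel`). For the values indicator/area at a generic point that relation is
the additivity of signed triangles (`wind_cocycle`, `isBase_of_wind`).

The central result is `exists_spl_eq_pow_mul`. Across a line ℓ = 0 the base values jump only on
triples with two knots on the line. The jump of Q[K] is therefore ℓ^(m-1) H, where m is the number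
of knots off the line, and H does not vanish at a point of the line that separates two knots on it.
Hence C³ smoothness forces m ≥ 5, that is, at most three of the eight knots on each interior line
that carries two distinct knots. Across a segment that is not an edge of the 12-split no jump is
allowed at all. Together these conditions exclude the vertices v₇, …, v₁₀
(`lowSupp_of_mem_splineSpace`). Conversely, if all knots are corners or midpoints, every line
through two of them is a boundary or an interior line of the split, and the bound m ≥ 5 glues the
polynomial pieces to a C³ function (`simplexSpline_mem_splineSpace`).

On a boundary edge Q[K] vanishes if at least two knots are off the edge. If exactly one is, it is a
multiple of the univariate simplex spline of the seven knots on the edge (`IsApex.spl_mul_height`),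
and its values at two parameters decide whether the multiplicities are those of a consecutive
B-spline (`reducesToBSpline_iff`). What remains is a finite system for six multiplicities with sum
eight, settled by evaluation (`exists_eq_of_adm_aux`).

Jumps are also invariants of the function Q[K]: their order reveals the number of knots on each line
across which a jump occurs. These numbers separate the twenty classes (`jump_eq`, `eq_of_jump_eq`).
-/

/-! ### Determinants and representations by knots -/

/-- Homogeneous barycentric coordinates. -/
abbrev Vec : Type := Fin 3 → ℝ

/-- The barycentric coordinates of a vertex of the 12-split, as real numbers. -/
def V (j : Fin 10) : Vec := fun k => ((bary j k : ℚ) : ℝ)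

/-- The determinant of three vectors. -/
def det (X Y Z : Vec) : ℝ :=
  X 0 * (Y 1 * Z 2 - Y 2 * Z 1) - X 1 * (Y 0 * Z 2 - Y 2 * Z 0) + X 2 * (Y 0 * Z 1 - Y 1 * Z 0)

theorem det_cramer (A B C X : Vec) :
    det A B C • X = det X B C • A + det A X C • B + det A B X • C := by
  ext k; fin_cases k <;> simp [det] <;> ring

theorem det_add_left (X X' Y Z : Vec) : det (X + X') Y Z = det X Y Z + det X' Y Z := by
  simp [det]; ring

theorem det_smul_left (c : ℝ) (X Y Z : Vec) : det (c • X) Y Z = c * det X Y Z := by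
  simp [det]; ring

theorem det_rot (X Y Z : Vec) : det X Y Z = det Y Z X := by
  simp [det]; ring

theorem det_swap (X Y Z : Vec) : det X Y Z = - det X Z Y := by
  simp [det]; ring

theorem det_self_left (X Y : Vec) : det X X Y = 0 := by simp [det]; ring
theorem det_self_right (X Y : Vec) : det X Y Y = 0 := by simp [det]; ring
theorem det_self_outer (X Y : Vec) : det X Y X = 0 := by simp [det]; ring

/-- Because of this normalization a linear representation of a vector of coordinate sum one is
automatically affine, so `IsRep` needs no condition on the sum of the coefficients; the
representations of 0 are the affine dependences. -/
theorem V_sum (j : Fin 10) : V j 0 + V j 1 + V j 2 = 1 := by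
  have h : ∀ j : Fin 10, bary j 0 + bary j 1 + bary j 2 = 1 := by decide +kernel
  have := h j
  simp only [V]
  exact_mod_cast this

/-- The numbers `β` represent `X` as a linear combination of the knots in `K`. -/
def IsRep (K : Knots) (X : Vec) (β : Fin 10 → ℝ) : Prop :=
  X = ∑ j, β j • V j ∧ ∀ j, K j = 0 → β j = 0

/-- The knots in `K` do not lie on a line. -/
def Spans (K : Knots) : Prop :=
  ∃ i j k, K i ≠ 0 ∧ K j ≠ 0 ∧ K k ≠ 0 ∧ det (V i) (V j) (V k) ≠ 0

/-- The coefficients of `X` with respect to the vertices `i, j, k`. -/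
def cramer (i j k : Fin 10) (X : Vec) : Fin 10 → ℝ :=
  Pi.single i (det X (V j) (V k) / det (V i) (V j) (V k))
    + Pi.single j (det (V i) X (V k) / det (V i) (V j) (V k))
    + Pi.single k (det (V i) (V j) X / det (V i) (V j) (V k))

theorem sum_single_mul (i : Fin 10) (a : ℝ) (f : Fin 10 → ℝ) :
    ∑ l, (Pi.single i a : Fin 10 → ℝ) l * f l = a * f i := by
  simp [Pi.single_apply]

theorem sum_single_smul (i : Fin 10) (a : ℝ) (f : Fin 10 → Vec) :
    ∑ l, (Pi.single i a : Fin 10 → ℝ) l • f l = a • f i := by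
  simp [Pi.single_apply]

theorem sum_cramer_mul (i j k : Fin 10) (X : Vec) (f : Fin 10 → ℝ) :
    ∑ l, cramer i j k X l * f l =
      det X (V j) (V k) / det (V i) (V j) (V k) * f i
        + det (V i) X (V k) / det (V i) (V j) (V k) * f j
        + det (V i) (V j) X / det (V i) (V j) (V k) * f k := by
  simp only [cramer, Pi.add_apply, add_mul, Finset.sum_add_distrib, sum_single_mul]

theorem isRep_cramer {K : Knots} {i j k : Fin 10} (hi : K i ≠ 0) (hj : K j ≠ 0) (hk : K k ≠ 0)
    (hd : det (V i) (V j) (V k) ≠ 0) (X : Vec) : IsRep K X (cramer i j k X) := by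
  constructor
  · simp only [cramer, Pi.add_apply, add_smul, Finset.sum_add_distrib, sum_single_smul]
    have := det_cramer (V i) (V j) (V k) X
    rw [← smul_right_inj hd, this]
    simp only [smul_add, smul_smul, mul_div_cancel₀ _ hd]
  · intro l hl
    have h1 : l ≠ i := by rintro rfl; exact hi hl
    have h2 : l ≠ j := by rintro rfl; exact hj hl
    have h3 : l ≠ k := by rintro rfl; exact hk hl
    simp [cramer, h1, h2, h3]

theorem Spans.exists_isRep {K : Knots} (h : Spans K) (X : Vec) : ∃ β, IsRep K X β := by
  obtain ⟨i, j, k, hi, hj, hk, hd⟩ := h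
  exact ⟨_, isRep_cramer hi hj hk hd X⟩

/-- Some representation of `X`. -/
def rep (K : Knots) (X : Vec) : Fin 10 → ℝ := Classical.epsilon (IsRep K X)

theorem Spans.isRep_rep {K : Knots} (h : Spans K) (X : Vec) : IsRep K X (rep K X) :=
  Classical.epsilon_spec (h.exists_isRep X)

theorem IsRep.sub {K : Knots} {X Y : Vec} {β γ : Fin 10 → ℝ} (h : IsRep K X β)
    (h' : IsRep K Y γ) : IsRep K (X - Y) (β - γ) := by
  refine ⟨?_, fun j hj => by simp [h.2 j hj, h'.2 j hj]⟩
  rw [h.1, h'.1]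
  simp [sub_smul, Finset.sum_sub_distrib]

theorem IsRep.smul {K : Knots} {X : Vec} {β : Fin 10 → ℝ} (h : IsRep K X β) (c : ℝ) :
    IsRep K (c • X) (c • β) := by
  refine ⟨?_, fun j hj => by simp [h.2 j hj]⟩
  rw [h.1]
  simp [Finset.smul_sum, smul_smul]

theorem remove_apply_of_ne {K : Knots} {i j : Fin 10} (h : i ≠ j) : remove K j i = K i := by
  simp [remove, h]

theorem remove_apply_self (K : Knots) (j : Fin 10) : remove K j j = K j - 1 := by
  simp [remove]

theorem remove_le (K : Knots) (j : Fin 10) : remove K j ≤ K := by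
  intro i
  by_cases h : i = j
  · subst h; simp [remove]
  · simp [remove, h]

theorem remove_comm (K : Knots) (i j : Fin 10) : remove (remove K i) j = remove (remove K j) i := by
  by_cases h : i = j
  · subst h; rfl
  · ext l
    simp only [remove, Function.update_apply]
    split_ifs <;> simp_all

theorem sum_remove {K : Knots} {j : Fin 10} (h : K j ≠ 0) : ∑ i, remove K j i + 1 = ∑ i, K i := by
  rw [← Finset.add_sum_erase _ _ (Finset.mem_univ j), ← Finset.add_sum_erase _ K (Finset.mem_univ j),
    remove_apply_self, Finset.sum_congr rfl fun i hi => remove_apply_of_ne (Finset.ne_of_mem_erase hi)]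
  omega

theorem Spans.mono {K K' : Knots} (h : Spans K) (hK : ∀ j, K j ≠ 0 → K' j ≠ 0) : Spans K' := by
  obtain ⟨i, j, k, hi, hj, hk, hd⟩ := h
  exact ⟨i, j, k, hK _ hi, hK _ hj, hK _ hk, hd⟩

theorem not_spans_of_le {K K' : Knots} (h : ¬ Spans K) (hK : K' ≤ K) : ¬ Spans K' :=
  fun h' => h (h'.mono fun j hj hj' => hj (Nat.le_zero.mp (hj' ▸ hK j)))

/-! ### The recursion with abstract values on three knots -/

open Classical in
/-- The recursion for simplex splines with prescribed values `b` on the multisets of three knots. -/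
def spl (b : Knots → ℝ) : ℕ → Knots → Vec → ℝ
  | 0, K, _ => b K
  | n + 1, K, X => if Spans K then ∑ j, rep K X j * spl b n (remove K j) X else 0

/-- The conditions under which the recursion does not depend on the representations. -/
structure IsBase (b : Knots → ℝ) : Prop where
  degenerate : ∀ K, ¬ Spans K → b K = 0
  relation : ∀ K : Knots, ∑ j, K j = 4 → ∀ γ, IsRep K 0 γ → ∑ j, γ j * b (remove K j) = 0

theorem spl_of_not_spans {b : Knots → ℝ} (hb : IsBase b) {n : ℕ} {K : Knots} (h : ¬ Spans K)
    (X : Vec) : spl b n K X = 0 := by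
  cases n with
  | zero => exact hb.degenerate K h
  | succ n => simp [spl, h]

theorem sum_mul_remove_of_not_spans {b : Knots → ℝ} (hb : IsBase b) {n : ℕ} {K : Knots}
    (h : ¬ Spans K) (X : Vec) (β : Fin 10 → ℝ) : ∑ j, β j * spl b n (remove K j) X = 0 :=
  Finset.sum_eq_zero fun j _ => by
    rw [spl_of_not_spans hb (not_spans_of_le h (remove_le K j)), mul_zero]

theorem spl_eq_of_rel {b : Knots → ℝ} (hb : IsBase b) {n : ℕ} {K : Knots} {X : Vec}
    (hrel : ∀ γ, IsRep K 0 γ → ∑ j, γ j * spl b n (remove K j) X = 0) {β : Fin 10 → ℝ}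
    (hβ : IsRep K X β) : spl b (n + 1) K X = ∑ j, β j * spl b n (remove K j) X := by
  by_cases h : Spans K
  · rw [spl, if_pos h, ← sub_eq_zero, ← Finset.sum_sub_distrib]
    simp_rw [← sub_mul]
    exact hrel (rep K X - β) (by simpa using (h.isRep_rep X).sub hβ)
  · rw [spl_of_not_spans hb h, sum_mul_remove_of_not_spans hb h]

theorem isRep_remove {K : Knots} {j : Fin 10} {X : Vec} {β : Fin 10 → ℝ} (h : IsRep K X β)
    (hj : β j = 0) : IsRep (remove K j) X β := by
  refine ⟨h.1, fun i hi => ?_⟩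
  by_cases hij : i = j
  · rw [hij, hj]
  · exact h.2 i (by rwa [remove_apply_of_ne hij] at hi)

/-- Any two representations of a point differ by an affine dependence γ, so this relation is exactly
independence of the choice. One more step of the recursion turns the sum into a double sum whose
coefficients are antisymmetric in the two removed knots, while the multiset left over is symmetric
in them. -/
theorem spl_rel {b : Knots → ℝ} (hb : IsBase b) (n : ℕ) : ∀ (K : Knots), ∑ j, K j = n + 4 →
    ∀ (X : Vec) (γ : Fin 10 → ℝ), IsRep K 0 γ → ∑ j, γ j * spl b n (remove K j) X = 0 := by
  induction n with
  | zero => intro K hK X γ hγ; exact hb.relation K (by simpa using hK) γ hγ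
  | succ n ih =>
    intro K hK X γ hγ
    by_cases hS : Spans K
    swap
    · exact sum_mul_remove_of_not_spans hb hS X γ
    obtain ⟨β, hβ⟩ := hS.exists_isRep X
    have hcard : ∀ j, K j ≠ 0 → ∑ i, remove K j i = n + 4 := fun j hj => by
      have := sum_remove hj; omega
    have key : ∀ j, γ j * spl b (n + 1) (remove K j) X =
        ∑ k, (γ j * β k - β j * γ k) * spl b n (remove (remove K j) k) X := by
      intro j
      by_cases hj : γ j = 0
      · by_cases hKj : K j = 0
        · simp [hj, hβ.2 j hKj]
        · have := ih _ (hcard j hKj) X γ (isRep_remove hγ hj)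
          simp only [hj, zero_mul, zero_sub, neg_mul, Finset.sum_neg_distrib, mul_assoc,
            ← Finset.mul_sum, this, mul_zero, neg_zero]
      · have hKj : K j ≠ 0 := fun h => hj (hγ.2 j h)
        -- Subtracting this multiple of the dependence cancels the coefficient of `j`, so the point
        -- is represented without one copy of that knot.
        have hr : IsRep (remove K j) X (β - (β j / γ j) • γ) := by
          apply isRep_remove
          · simpa using hβ.sub (hγ.smul (β j / γ j))
          · simp [div_mul_cancel₀ _ hj]
        rw [spl_eq_of_rel hb (ih _ (hcard j hKj) X) hr, Finset.mul_sum]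
        refine Finset.sum_congr rfl fun k _ => ?_
        rw [← mul_assoc]
        congr 1
        simp only [Pi.sub_apply, Pi.smul_apply, smul_eq_mul]
        field_simp
    simp_rw [key]
    have hanti : ∑ j, ∑ k, (γ j * β k - β j * γ k) * spl b n (remove (remove K j) k) X =
        - ∑ j, ∑ k, (γ j * β k - β j * γ k) * spl b n (remove (remove K j) k) X := by
      conv_lhs => rw [Finset.sum_comm]
      simp_rw [← Finset.sum_neg_distrib]
      refine Finset.sum_congr rfl fun j _ => Finset.sum_congr rfl fun k _ => ?_
      rw [remove_comm K k j]
      ring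
    linarith

theorem spl_eq {b : Knots → ℝ} (hb : IsBase b) {n : ℕ} {K : Knots} (hK : ∑ j, K j = n + 4)
    {X : Vec} {β : Fin 10 → ℝ} (hβ : IsRep K X β) :
    spl b (n + 1) K X = ∑ j, β j * spl b n (remove K j) X :=
  spl_eq_of_rel hb (spl_rel hb n K hK X) hβ

theorem spl_cramer {b : Knots → ℝ} (hb : IsBase b) {n : ℕ} {K : Knots} (hK : ∑ j, K j = n + 4)
    {i j k : Fin 10} (hi : K i ≠ 0) (hj : K j ≠ 0) (hk : K k ≠ 0)
    (hd : det (V i) (V j) (V k) ≠ 0) (X : Vec) :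
    spl b (n + 1) K X =
      det X (V j) (V k) / det (V i) (V j) (V k) * spl b n (remove K i) X
        + det (V i) X (V k) / det (V i) (V j) (V k) * spl b n (remove K j) X
        + det (V i) (V j) X / det (V i) (V j) (V k) * spl b n (remove K k) X := by
  rw [spl_eq hb hK (isRep_cramer hi hj hk hd X),
    sum_cramer_mul i j k X fun l => spl b n (remove K l) X]

/-- The chosen representations `rep K X` do not involve `b`, so the recursion is linear in `b`. The
difference of two polynomial pieces is thus itself a spline, with the jump of the base values as its
base. -/
theorem spl_sub (b b' : Knots → ℝ) (n : ℕ) : ∀ (K : Knots) (X : Vec),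
    spl (b - b') n K X = spl b n K X - spl b' n K X := by
  induction n with
  | zero => intro K X; rfl
  | succ n ih =>
    intro K X
    simp only [spl]
    split_ifs
    · simp_rw [ih, mul_sub, Finset.sum_sub_distrib]
    · simp

theorem IsBase.sub {b b' : Knots → ℝ} (hb : IsBase b) (hb' : IsBase b') : IsBase (b - b') where
  degenerate K h := by simp [hb.degenerate K h, hb'.degenerate K h]
  relation K hK γ hγ := by
    simp only [Pi.sub_apply, mul_sub, Finset.sum_sub_distrib, hb.relation K hK γ hγ,
      hb'.relation K hK γ hγ, sub_zero]

/-- Only the values of `b` on the submultisets of three knots matter. -/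
theorem spl_congr {b b' : Knots → ℝ} (n : ℕ) : ∀ {K : Knots}, ∑ j, K j = n + 3 →
    (∀ K' ≤ K, ∑ j, K' j = 3 → b K' = b' K') → ∀ X, spl b n K X = spl b' n K X := by
  induction n with
  | zero => intro K hK h X; exact h K le_rfl (by simpa using hK)
  | succ n ih =>
    intro K hK h X
    simp only [spl]
    split_ifs with hS
    · refine Finset.sum_congr rfl fun j _ => ?_
      by_cases hj : K j = 0
      · rw [(hS.isRep_rep X).2 j hj, zero_mul, zero_mul]
      · rw [ih (by have := sum_remove hj; omega) fun K' hK' => h K' (hK'.trans (remove_le K j))]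
    · rfl

/-! ### Signed incidence with triangles and the four-knot relation -/

/-- The multiset of the knots `i, j, k`. -/
def knots3 (i j k : Fin 10) : Knots := Pi.single i 1 + Pi.single j 1 + Pi.single k 1

theorem exists_ne_zero_of_sum {K : Knots} {n : ℕ} (h : ∑ j, K j = n + 1) : ∃ i, K i ≠ 0 := by
  by_contra! h'
  simp [h'] at h

theorem remove_add_single {K : Knots} {i : Fin 10} (h : K i ≠ 0) :
    remove K i + Pi.single i 1 = K := by
  ext l
  by_cases hl : l = i
  · subst hl; simp [remove]; omega
  · simp [remove, hl]

theorem add_single_remove (K : Knots) (i : Fin 10) : remove (K + Pi.single i 1) i = K := by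
  ext l
  by_cases hl : l = i
  · subst hl; simp [remove]
  · simp [remove, hl]

theorem eq_zero_of_sum {K : Knots} (h : ∑ j, K j = 0) : K = 0 := by
  ext j; simpa using (Finset.sum_eq_zero_iff.mp h) j (Finset.mem_univ j)

theorem eq_single_of_sum {K : Knots} (h : ∑ j, K j = 1) : ∃ i, K = Pi.single i 1 := by
  obtain ⟨i, hi⟩ := exists_ne_zero_of_sum (n := 0) h
  refine ⟨i, ?_⟩
  rw [← remove_add_single hi, eq_zero_of_sum (K := remove K i) (by have := sum_remove hi; omega),
    zero_add]

theorem ne_of_det_ne_zero {i j k : Fin 10} (hd : det (V i) (V j) (V k) ≠ 0) :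
    i ≠ j ∧ i ≠ k ∧ j ≠ k := by
  refine ⟨?_, ?_, ?_⟩ <;> rintro rfl
  · exact hd (det_self_left _ _)
  · exact hd (det_self_outer _ _)
  · exact hd (det_self_right _ _)

theorem eq_of_sum_four {K : Knots} (h : ∑ j, K j = 4) {i j k : Fin 10} (hi : K i ≠ 0)
    (hj : K j ≠ 0) (hk : K k ≠ 0) (hij : i ≠ j) (hik : i ≠ k) (hjk : j ≠ k) :
    ∃ l, K = knots3 i j k + Pi.single l 1 := by
  have h1 : remove K k j ≠ 0 := by rwa [remove_apply_of_ne hjk]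
  have h2 : remove (remove K k) j i ≠ 0 := by
    rwa [remove_apply_of_ne hij, remove_apply_of_ne hik]
  obtain ⟨l, hl⟩ := eq_single_of_sum (K := remove (remove (remove K k) j) i)
    (by have := sum_remove hk; have := sum_remove h1; have := sum_remove h2; omega)
  refine ⟨l, ?_⟩
  rw [← remove_add_single hk, ← remove_add_single h1, ← remove_add_single h2, hl, knots3]
  abel

theorem knots3_ne_zero {i j k l : Fin 10} : knots3 i j k l ≠ 0 ↔ l = i ∨ l = j ∨ l = k := by
  simp only [knots3, Pi.add_apply, Pi.single_apply]
  split_ifs <;> simp_all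

theorem knots3_eq_zero {i j k l : Fin 10} (hi : l ≠ i) (hj : l ≠ j) (hk : l ≠ k) :
    knots3 i j k l = 0 := by
  simp [knots3, hi, hj, hk]

theorem sum_eq_three {i j k : Fin 10} (hij : i ≠ j) (hik : i ≠ k) (hjk : j ≠ k) {f : Fin 10 → ℝ}
    (hf : ∀ l, l ≠ i → l ≠ j → l ≠ k → f l = 0) : ∑ l, f l = f i + f j + f k := by
  rw [← Finset.sum_subset (Finset.subset_univ {i, j, k}) (by
    intro l _ hl
    simp only [Finset.mem_insert, Finset.mem_singleton, not_or] at hl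
    exact hf l hl.1 hl.2.1 hl.2.2)]
  rw [Finset.sum_insert (by simp [hij, hik]), Finset.sum_insert (by simp [hjk]),
    Finset.sum_singleton, add_assoc]

theorem det_sum_left (β : Fin 10 → ℝ) (Y Z : Vec) :
    det (∑ j, β j • V j) Y Z = ∑ j, β j * det (V j) Y Z := by
  let f : Vec →ₗ[ℝ] ℝ :=
    { toFun := fun X => det X Y Z
      map_add' := fun X X' => det_add_left X X' Y Z
      map_smul' := fun c X => det_smul_left c X Y Z }
  have : f (∑ j, β j • V j) = ∑ j, β j * f (V j) := by simp
  exact this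

theorem det_sum_rot {K : Knots} {X : Vec} {β : Fin 10 → ℝ} (h : IsRep K X β) (Y Z : Vec) :
    det X Y Z = ∑ j, β j * det (V j) Y Z := by
  conv_lhs => rw [h.1]
  exact det_sum_left β Y Z

/-- The coefficients in a representation by three independent knots are given by Cramer's rule. -/
theorem isRep_knots3 {K : Knots} {i j k : Fin 10} (hK : ∀ l, K l ≠ 0 → l = i ∨ l = j ∨ l = k)
    (hd : det (V i) (V j) (V k) ≠ 0) {X : Vec} {β : Fin 10 → ℝ} (h : IsRep K X β) :
    β i * det (V i) (V j) (V k) = det X (V j) (V k) ∧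
    β j * det (V i) (V j) (V k) = det X (V k) (V i) ∧
    β k * det (V i) (V j) (V k) = det X (V i) (V j) := by
  obtain ⟨hij, hik, hjk⟩ := ne_of_det_ne_zero hd
  have h0 : ∀ l, l ≠ i → l ≠ j → l ≠ k → β l = 0 := fun l h1 h2 h3 => h.2 l (by
    by_contra h4
    rcases hK l h4 with h | h | h
    exacts [h1 h, h2 h, h3 h])
  have key : ∀ Y Z, det X Y Z =
      β i * det (V i) Y Z + β j * det (V j) Y Z + β k * det (V k) Y Z := fun Y Z => by
    rw [det_sum_rot h, sum_eq_three hij hik hjk]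
    intro l h1 h2 h3
    rw [h0 l h1 h2 h3, zero_mul]
  refine ⟨?_, ?_, ?_⟩ <;> rw [key] <;> simp only [det] <;> ring

/-- The sign with which a triangle contains a point, in terms of the position of the point
with respect to the lines through the oriented sides. -/
def wind (x y z : ℝ) : ℝ :=
  if 0 < x ∧ 0 < y ∧ 0 < z then 1 else if x < 0 ∧ y < 0 ∧ z < 0 then -1 else 0

/-- As chains, the triangle ijk is the sum of ljk, ilk and ijl. Only the signs of the six
determinants matter: each of the 64 sign patterns either satisfies the identity or contradicts the
Plücker relation `hp`. -/
theorem wind_cocycle {ij ik il jk jl kl : ℝ} (h1 : ij ≠ 0) (h2 : ik ≠ 0) (h3 : il ≠ 0)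
    (h4 : jk ≠ 0) (h5 : jl ≠ 0) (h6 : kl ≠ 0) (hp : ij * kl - ik * jl + il * jk = 0) :
    wind ij jk (-ik) = wind (-jl) jk kl + wind il (-kl) (-ik) + wind ij jl (-il) := by
  rcases h1.lt_or_gt with h1 | h1 <;> rcases h2.lt_or_gt with h2 | h2 <;>
  rcases h3.lt_or_gt with h3 | h3 <;> rcases h4.lt_or_gt with h4 | h4 <;>
  rcases h5.lt_or_gt with h5 | h5 <;> rcases h6.lt_or_gt with h6 | h6 <;>
  first
  | (simp only [wind, h1, h2, h3, h4, h5, h6, h1.not_gt, h2.not_gt, h3.not_gt, h4.not_gt,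
      h5.not_gt, h6.not_gt, Left.neg_pos_iff, Left.neg_neg_iff, and_self, and_true, true_and,
      and_false, false_and, if_true, if_false]; norm_num; done)
  | nlinarith

theorem wind_eq_zero {x y z : ℝ} (h : x + y + z = 0) : wind x y z = 0 := by
  unfold wind
  rw [if_neg (by rintro ⟨h1, h2, h3⟩; linarith), if_neg (by rintro ⟨h1, h2, h3⟩; linarith)]

/-- A point on no line through two vertices. -/
def Generic (y : Vec) : Prop := ∀ i j, i ≠ j → det y (V i) (V j) ≠ 0

/-- Additivity of signed area when a triangle is coned from `y`. For collinear vertices the three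
terms sum to zero, so their `wind` vanishes. -/
theorem det_add_det_add_det {y X Y Z : Vec} (hy : y 0 + y 1 + y 2 = 1) (hX : X 0 + X 1 + X 2 = 1)
    (hY : Y 0 + Y 1 + Y 2 = 1) (hZ : Z 0 + Z 1 + Z 2 = 1) :
    det y X Y + det y Y Z + det y Z X = det X Y Z := by
  have h1 : y 2 = 1 - y 0 - y 1 := by linarith
  have h2 : X 2 = 1 - X 0 - X 1 := by linarith
  have h3 : Y 2 = 1 - Y 0 - Y 1 := by linarith
  have h4 : Z 2 = 1 - Z 0 - Z 1 := by linarith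
  simp only [det, h1, h2, h3, h4]; ring

/-- Values that are given by the signed incidence of a generic point with the triangles satisfy the
four-knot relation. -/
theorem isBase_of_wind {b : Knots → ℝ} {y : Vec} (hy1 : y 0 + y 1 + y 2 = 1) (hy : Generic y)
    (hdeg : ∀ K, ¬ Spans K → b K = 0)
    (hb : ∀ i j k, det (V i) (V j) (V k) ≠ 0 → det (V i) (V j) (V k) * b (knots3 i j k) =
      wind (det y (V i) (V j)) (det y (V j) (V k)) (det y (V k) (V i))) : IsBase b := by
  refine ⟨hdeg, fun K hK γ hγ => ?_⟩
  by_cases hS : Spans K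
  swap
  · exact Finset.sum_eq_zero fun j _ => by
      rw [hdeg _ (not_spans_of_le hS (remove_le K j)), mul_zero]
  obtain ⟨i, j, k, hi, hj, hk, hd⟩ := hS
  obtain ⟨hij, hik, hjk⟩ := ne_of_det_ne_zero hd
  obtain ⟨l, rfl⟩ := eq_of_sum_four hK hi hj hk hij hik hjk
  have hb' : ∀ i j k, det (V i) (V j) (V k) * b (knots3 i j k) =
      wind (det y (V i) (V j)) (det y (V j) (V k)) (det y (V k) (V i)) := by
    intro i j k
    by_cases h : det (V i) (V j) (V k) = 0
    · rw [h, zero_mul, wind_eq_zero]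
      rw [det_add_det_add_det hy1 (V_sum _) (V_sum _) (V_sum _), h]
    · exact hb i j k h
  have z : ∀ Y Z, det 0 Y Z = 0 := fun Y Z => by simp [det]
  have hγ0 : ∀ x, x ≠ i → x ≠ j → x ≠ k → x ≠ l → γ x = 0 := fun x h1 h2 h3 h4 =>
    hγ.2 x (by rw [Pi.add_apply, knots3_eq_zero h1 h2 h3, Pi.single_eq_of_ne h4, add_zero])
  -- If the fourth knot repeats one of three independent ones, the only dependence is the trivial
  -- one.
  by_cases hl : l = i ∨ l = j ∨ l = k
  · have hγ1 : ∀ x, x ≠ i → x ≠ j → x ≠ k → γ x = 0 := fun x h1 h2 h3 =>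
      hγ0 x h1 h2 h3 (by rintro rfl; rcases hl with h | h | h <;> contradiction)
    have h3 := isRep_knots3 (K := knots3 i j k) (fun x hx => knots3_ne_zero.mp hx) hd
      ⟨hγ.1, fun x hx => by
        have := (not_iff_not.mpr (knots3_ne_zero (i := i) (j := j) (k := k) (l := x))).mp
          (not_not.mpr hx)
        push Not at this
        exact hγ1 x this.1 this.2.1 this.2.2⟩
    simp only [z, mul_eq_zero, hd, or_false] at h3
    rw [sum_eq_three hij hik hjk fun x h1 h2 h4 => by rw [hγ1 x h1 h2 h4, zero_mul]]
    simp [h3]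
  push Not at hl
  obtain ⟨hli, hlj, hlk⟩ := hl
  have hsum : ∀ f : Fin 10 → ℝ, ∑ x, γ x * f x = γ i * f i + γ j * f j + γ k * f k + γ l * f l := by
    intro f
    have := sum_eq_three (f := fun x => if x = l then 0 else γ x * f x) hij hik hjk (by
      intro x h1 h2 h3
      by_cases hx : x = l
      · simp [hx]
      · simp only [hx, if_false]
        rw [hγ0 x h1 h2 h3 hx, zero_mul])
    simp only [hli.symm, hlj.symm, hlk.symm, if_false] at this
    rw [← this, ← Finset.sum_erase_add _ _ (Finset.mem_univ l), ← Finset.sum_erase_add Finset.univ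
      (fun x => if x = l then 0 else γ x * f x) (Finset.mem_univ l)]
    simp only [if_true, add_zero]
    congr 1
    exact Finset.sum_congr rfl fun x hx => by rw [if_neg (Finset.ne_of_mem_erase hx)]
  have key : ∀ Y Z, γ i * det (V i) Y Z + γ j * det (V j) Y Z + γ k * det (V k) Y Z
      + γ l * det (V l) Y Z = 0 := fun Y Z => by
    rw [← hsum fun x => det (V x) Y Z, ← det_sum_rot hγ, z]
  have e1 := key (V j) (V k)
  have e2 := key (V k) (V i)
  have e3 := key (V i) (V j)
  simp only [det_self_left, det_self_outer, mul_zero, zero_add, add_zero] at e1 e2 e3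
  rw [← det_rot (V i), ← det_rot (V i)] at e2
  rw [det_rot (V k), det_rot (V l)] at e3
  rw [hsum]
  have r1 : remove (knots3 i j k + Pi.single l 1) i = knots3 l j k := by
    rw [← add_single_remove (knots3 l j k) i]; congr 1; simp only [knots3]; abel
  have r2 : remove (knots3 i j k + Pi.single l 1) j = knots3 i l k := by
    rw [← add_single_remove (knots3 i l k) j]; congr 1; simp only [knots3]; abel
  have r3 : remove (knots3 i j k + Pi.single l 1) k = knots3 i j l := by
    rw [← add_single_remove (knots3 i j l) k]; congr 1; simp only [knots3]; abel
  rw [r1, r2, r3, add_single_remove]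
  have w0 := hb' i j k
  have w1 := hb' l j k
  have w2 := hb' i l k
  have w3 := hb' i j l
  have hc := wind_cocycle (hy i j hij) (hy i k hik) (hy i l hli.symm) (hy j k hjk)
    (hy j l hlj.symm) (hy k l hlk.symm) (by simp only [det]; ring)
  have n1 : ∀ X Y, det y X Y = - det y Y X := fun X Y => det_swap y X Y
  rw [n1 (V k) (V i)] at w0
  rw [n1 (V l) (V j)] at w1
  rw [n1 (V l) (V k), n1 (V k) (V i)] at w2
  rw [n1 (V l) (V i)] at w3
  apply mul_left_cancel₀ hd
  -- The equations `e1`, `e2`, `e3` express the other coefficients through `γ l`; what is left is `γ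
  -- l` times the cocycle identity.
  linear_combination b (knots3 l j k) * e1 + b (knots3 i l k) * e2 + b (knots3 i j l) * e3
    - γ l * (w1 + w2 + w3 - w0) + γ l * hc

/-! ### Barycentric coordinates in the plane, hulls and areas -/

variable {T : Fin 3 → Plane}

/-- The barycentric coordinates of a point. -/
def co (hT : AffineIndependent ℝ T) (x : Plane) : Vec := fun k =>
  (⟨T, hT, hT.affineSpan_eq_top_iff_card_eq_finrank_add_one.mpr (by simp)⟩ :
    AffineBasis (Fin 3) ℝ Plane).coord k x

theorem co_sum (hT : AffineIndependent ℝ T) (x : Plane) :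
    co hT x 0 + co hT x 1 + co hT x 2 = 1 := by
  rw [← Fin.sum_univ_three]
  exact AffineBasis.sum_coord_apply_eq_one _ x

theorem sum_co_smul (hT : AffineIndependent ℝ T) (x : Plane) : ∑ k, co hT x k • T k = x :=
  AffineBasis.linear_combination_coord_eq_self
    (⟨T, hT, hT.affineSpan_eq_top_iff_card_eq_finrank_add_one.mpr (by simp)⟩ :
      AffineBasis (Fin 3) ℝ Plane) x

theorem co_sum_smul (hT : AffineIndependent ℝ T) {X : Vec} (hX : X 0 + X 1 + X 2 = 1) :
    co hT (∑ k, X k • T k) = X := by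
  ext k
  have hX' : ∑ k, X k = 1 := by rw [Fin.sum_univ_three, hX]
  rw [← Finset.univ.affineCombination_eq_linear_combination T X hX']
  exact AffineBasis.coord_apply_combination_of_mem
    (⟨T, hT, hT.affineSpan_eq_top_iff_card_eq_finrank_add_one.mpr (by simp)⟩ :
      AffineBasis (Fin 3) ℝ Plane) (Finset.mem_univ k) hX'

theorem co_vertex (hT : AffineIndependent ℝ T) (i : Fin 10) : co hT (vertex T i) = V i :=
  co_sum_smul hT (V_sum i)

theorem co_lineMap (hT : AffineIndependent ℝ T) (x y : Plane) (t : ℝ) :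
    co hT (AffineMap.lineMap x y t) = (1 - t) • co hT x + t • co hT y := by
  ext k
  simp only [co, AffineMap.apply_lineMap]
  simp only [AffineMap.lineMap_apply_module, Pi.add_apply, Pi.smul_apply]
  rfl

theorem isAffineRep_iff (hT : AffineIndependent ℝ T) {K : Knots} {x : Plane} {β : Fin 10 → ℝ} :
    IsAffineRep T K x β ↔ IsRep K (co hT x) β := by
  have hpt : ∑ j, β j • vertex T j = ∑ k, (∑ j, β j • V j) k • T k := by
    simp only [vertex, Finset.smul_sum, smul_smul, Finset.sum_apply, Pi.smul_apply, smul_eq_mul,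
      Finset.sum_smul]
    exact Finset.sum_comm
  have hs : (∑ j, β j • V j) 0 + (∑ j, β j • V j) 1 + (∑ j, β j • V j) 2 = ∑ j, β j := by
    simp only [Finset.sum_apply, Pi.smul_apply, smul_eq_mul, ← Finset.sum_add_distrib, ← mul_add,
      V_sum, mul_one]
  constructor
  · rintro ⟨h1, h2, h3⟩
    refine ⟨?_, h3⟩
    rw [h1, hpt, co_sum_smul hT (by rw [hs, h2])]
  · rintro ⟨h1, h3⟩
    refine ⟨?_, ?_, h3⟩
    · rw [hpt, ← h1, sum_co_smul]
    · rw [← hs, ← h1, co_sum]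

/-- Both sides are `Classical.epsilon` of the same predicate, so even the arbitrary choices
coincide. -/
theorem affineRep_eq (hT : AffineIndependent ℝ T) (K : Knots) (x : Plane) :
    affineRep T K x = rep K (co hT x) := by
  unfold affineRep rep
  congr 1
  ext β
  exact isAffineRep_iff hT

theorem mem_hull_iff (hT : AffineIndependent ℝ T) {K : Knots} {x : Plane} :
    x ∈ hull T K ↔ ∃ β : Fin 10 → ℝ, (∀ j, 0 ≤ β j) ∧ IsRep K (co hT x) β := by
  constructor
  · intro hx
    have hsub : hull T K ⊆ {x | ∃ β : Fin 10 → ℝ, (∀ j, 0 ≤ β j) ∧ IsAffineRep T K x β} := by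
      apply convexHull_min
      · rintro _ ⟨i, hi, rfl⟩
        refine ⟨Pi.single i 1, fun j => ?_, ?_, by simp, fun j hj => ?_⟩
        · by_cases h : j = i
          · subst h; simp
          · simp [h]
        · simp [Pi.single_apply]
        · have : j ≠ i := by rintro rfl; exact hi hj
          simp [this]
      · rintro x ⟨β, h1, h2, h3, h4⟩ y ⟨γ, k1, k2, k3, k4⟩ a c ha hc hac
        refine ⟨fun j => a * β j + c * γ j, fun j => ?_, ?_, ?_, fun j hj => ?_⟩
        · exact add_nonneg (mul_nonneg ha (h1 j)) (mul_nonneg hc (k1 j))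
        · simp only [h2, k2, Finset.smul_sum, smul_smul, add_smul, Finset.sum_add_distrib]
        · simp only [Finset.sum_add_distrib, ← Finset.mul_sum, h3, k3, mul_one, hac]
        · simp [h4 j hj, k4 j hj]
    obtain ⟨β, h1, h2⟩ := hsub hx
    exact ⟨β, h1, (isAffineRep_iff hT).mp h2⟩
  · rintro ⟨β, h1, h2⟩
    obtain ⟨h3, h4, h5⟩ := (isAffineRep_iff hT).mpr h2
    classical
    have hz : ∀ j, j ∉ Finset.univ.filter (fun j => K j ≠ 0) → β j = 0 := fun j hj =>
      h5 j (by simpa using hj)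
    rw [h3, ← Finset.sum_subset (Finset.subset_univ (Finset.univ.filter (fun j => K j ≠ 0)))
      (fun j _ hj => by rw [hz j hj, zero_smul])]
    refine (convex_convexHull ℝ _).sum_mem (fun j _ => h1 j) ?_ fun j hj => ?_
    · rw [← h4]
      exact Finset.sum_subset (Finset.subset_univ _) fun j _ hj => hz j hj
    · exact subset_convexHull ℝ _ ⟨j, by simpa using hj, rfl⟩

theorem mem_hull_knots3 (hT : AffineIndependent ℝ T) {i j k : Fin 10}
    (hd : det (V i) (V j) (V k) ≠ 0) {x : Plane} : x ∈ hull T (knots3 i j k) ↔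
      0 ≤ det (co hT x) (V j) (V k) / det (V i) (V j) (V k) ∧
      0 ≤ det (co hT x) (V k) (V i) / det (V i) (V j) (V k) ∧
      0 ≤ det (co hT x) (V i) (V j) / det (V i) (V j) (V k) := by
  rw [mem_hull_iff hT]
  constructor
  · rintro ⟨β, h1, h2⟩
    obtain ⟨h3, h4, h5⟩ := isRep_knots3 (fun l hl => knots3_ne_zero.mp hl) hd h2
    rw [← h3, ← h4, ← h5]
    simp only [mul_div_cancel_right₀ _ hd]
    exact ⟨h1 i, h1 j, h1 k⟩
  · rintro ⟨h1, h2, h3⟩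
    refine ⟨_, fun l => ?_, isRep_cramer (knots3_ne_zero.mpr (.inl rfl))
      (knots3_ne_zero.mpr (.inr (.inl rfl))) (knots3_ne_zero.mpr (.inr (.inr rfl))) hd _⟩
    rw [← det_rot] at h2
    rw [det_rot (co hT x), det_rot (V i) (V j) (co hT x), ← det_rot] at h3
    have aux : ∀ (i : Fin 10) (a : ℝ), 0 ≤ a → 0 ≤ (Pi.single i a : Fin 10 → ℝ) l := by
      intro i a ha
      rw [Pi.single_apply]; split_ifs
      exacts [ha, le_rfl]
    exact add_nonneg (add_nonneg (aux _ _ h1) (aux _ _ h2)) (aux _ _ h3)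

/-- The determinant of three rational vectors. -/
def detQ (X Y Z : Fin 3 → ℚ) : ℚ :=
  X 0 * (Y 1 * Z 2 - Y 2 * Z 1) - X 1 * (Y 0 * Z 2 - Y 2 * Z 0) + X 2 * (Y 0 * Z 1 - Y 1 * Z 0)

theorem det_cast (X Y Z : Fin 3 → ℚ) :
    det (fun k => (X k : ℝ)) (fun k => (Y k : ℝ)) (fun k => (Z k : ℝ)) = (detQ X Y Z : ℝ) := by
  simp [det, detQ]

theorem det_V (i j k : Fin 10) : det (V i) (V j) (V k) = (detQ (bary i) (bary j) (bary k) : ℝ) :=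
  det_cast _ _ _

theorem exists_det_ne_zero {i j : Fin 10} (hij : i ≠ j) : ∃ k, det (V k) (V i) (V j) ≠ 0 := by
  have h : ∀ i j : Fin 10, i ≠ j → ∃ k, detQ (bary k) (bary i) (bary j) ≠ 0 := by decide +kernel
  obtain ⟨k, hk⟩ := h i j hij
  exact ⟨k, by rw [det_V]; exact_mod_cast hk⟩

theorem triangle_eq_hull (T : Fin 3 → Plane) : triangle T = hull T (knots3 0 1 2) := by
  have hv : ∀ k : Fin 3, vertex T (Fin.castLE (by omega) k) = T k := by
    intro k
    fin_cases k <;> simp [vertex, bary, Fin.sum_univ_three]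
  unfold triangle hull
  congr 1
  ext x
  constructor
  · rintro ⟨k, rfl⟩
    refine ⟨Fin.castLE (by omega) k, ?_, hv k⟩
    rw [Set.mem_ofPred_eq, knots3_ne_zero]
    fin_cases k <;> simp
  · rintro ⟨i, hi, rfl⟩
    rw [Set.mem_ofPred_eq, knots3_ne_zero] at hi
    rcases hi with rfl | rfl | rfl
    exacts [⟨0, (hv 0).symm⟩, ⟨1, (hv 1).symm⟩, ⟨2, (hv 2).symm⟩]

/-- The oriented area of the parallelogram spanned by three points. -/
def cross (P Q R : Plane) : ℝ := (Q 0 - P 0) * (R 1 - P 1) - (Q 1 - P 1) * (R 0 - P 0)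

/-- The standard triangle. -/
def stdTri : Set Plane := {x | 0 ≤ x 0 ∧ 0 ≤ x 1 ∧ x 0 + x 1 ≤ 1}

theorem hull_knots3 (T : Fin 3 → Plane) (i j k : Fin 10) :
    hull T (knots3 i j k) = convexHull ℝ {vertex T i, vertex T j, vertex T k} := by
  unfold hull
  congr 1
  ext x
  simp only [Set.mem_image, Set.mem_ofPred_eq, knots3_ne_zero, Set.mem_insert_iff,
    Set.mem_singleton_iff]
  constructor
  · rintro ⟨l, rfl | rfl | rfl, rfl⟩ <;> simp
  · rintro (rfl | rfl | rfl)
    exacts [⟨i, by simp⟩, ⟨j, by simp⟩, ⟨k, by simp⟩]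

/-- The triangle is an affine image of `stdTri`, so its area scales by the determinant. The area of
`stdTri` itself is never computed, because only ratios of areas occur. -/
theorem area_convexHull (P Q R : Plane) :
    area (convexHull ℝ {P, Q, R}) = |cross P Q R| * area stdTri := by
  let e := (EuclideanSpace.basisFun (Fin 2) ℝ).toBasis
  let f : Plane →ₗ[ℝ] Plane := Matrix.toLin e e !![Q 0 - P 0, R 0 - P 0; Q 1 - P 1, R 1 - P 1]
  have hf : ∀ x : Plane, f x = x 0 • (Q - P) + x 1 • (R - P) := by
    intro x
    have : x = x 0 • e 0 + x 1 • e 1 := by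
      ext l; fin_cases l <;> simp [e]
    conv_lhs => rw [this]
    rw [map_add, map_smul, map_smul, Matrix.toLin_self, Matrix.toLin_self]
    ext l; fin_cases l <;> simp [e, Fin.sum_univ_two]
  have hdet : LinearMap.det f = cross P Q R := by
    rw [LinearMap.det_toLin, Matrix.det_fin_two]
    simp [cross]; ring
  have himg : convexHull ℝ {P, Q, R} = (fun x => P + x) '' (f '' stdTri) := by
    ext x
    rw [Set.image_image]
    constructor
    · intro hx
      have hc : Convex ℝ ((fun x => P + f x) '' stdTri) := by
        rintro _ ⟨u, ⟨h1, h2, h3⟩, rfl⟩ _ ⟨v, ⟨k1, k2, k3⟩, rfl⟩ a c ha hc hac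
        refine ⟨a • u + c • v, ⟨?_, ?_, ?_⟩, ?_⟩
        · simp; positivity
        · simp; positivity
        · simp; nlinarith
        · simp only [map_add, map_smul, smul_add]
          have : P = a • P + c • P := by rw [← add_smul, hac, one_smul]
          conv_lhs => rw [this]
          abel
      refine convexHull_min ?_ hc hx
      rintro y (rfl | rfl | rfl)
      · exact ⟨0, by simp [stdTri], by simp⟩
      · exact ⟨e 0, by simp [stdTri, e], by simp [hf, e]⟩
      · exact ⟨e 1, by simp [stdTri, e], by simp [hf, e]⟩
    · rintro ⟨u, ⟨h1, h2, h3⟩, rfl⟩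
      have hc := convex_convexHull ℝ ({P, Q, R} : Set Plane)
      have := hc.sum_mem (t := Finset.univ) (w := ![1 - u 0 - u 1, u 0, u 1]) (z := ![P, Q, R])
        (by intro l _; fin_cases l <;> simp <;> linarith)
        (by simp [Fin.sum_univ_three]; ring)
        (by intro l _; apply subset_convexHull; fin_cases l <;> simp)
      rw [Fin.sum_univ_three] at this
      convert this using 1
      simp only [hf]
      simp [sub_smul, smul_sub]
      abel
  unfold area Measure.real
  rw [himg, Set.image_add_left, measure_preimage_add, Measure.addHaar_image_linearMap, hdet,
    ENNReal.toReal_mul, ENNReal.toReal_ofReal (abs_nonneg _)]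

theorem cross_vertex (T : Fin 3 → Plane) (i j k : Fin 10) :
    cross (vertex T i) (vertex T j) (vertex T k)
      = det (V i) (V j) (V k) * cross (T 0) (T 1) (T 2) := by
  have h : ∀ i l, (vertex T i) l = V i 0 * T 0 l + V i 1 * T 1 l + V i 2 * T 2 l := by
    intro i l
    simp [vertex, Fin.sum_univ_three, V]
  have e1 : V i 2 = 1 - V i 0 - V i 1 := by linarith [V_sum i]
  have e2 : V j 2 = 1 - V j 0 - V j 1 := by linarith [V_sum j]
  have e3 : V k 2 = 1 - V k 0 - V k 1 := by linarith [V_sum k]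
  simp only [cross, h, det, e1, e2, e3]
  ring

theorem area_hull_knots3 (T : Fin 3 → Plane) (i j k : Fin 10) :
    area (hull T (knots3 i j k)) = |det (V i) (V j) (V k)| * area (triangle T) := by
  have h1 : det (V 0) (V 1) (V 2) = 1 := by simp [det, V, bary]
  rw [triangle_eq_hull, hull_knots3, hull_knots3, area_convexHull, area_convexHull, cross_vertex,
    cross_vertex, abs_mul, h1, one_mul, mul_assoc]

theorem hull_subset_triangle (hT : AffineIndependent ℝ T) (K : Knots) :
    hull T K ⊆ triangle T := by
  rw [triangle_eq_hull]
  have h1 : det (V 0) (V 1) (V 2) = 1 := by simp [det, V, bary]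
  refine convexHull_min (𝕜 := ℝ) ?_ (convex_convexHull ℝ _)
  rintro _ ⟨i, -, rfl⟩
  refine (mem_hull_knots3 hT (by rw [h1]; exact one_ne_zero)).mpr ?_
  have h : ∀ i k, 0 ≤ bary i k := by decide +kernel
  have h' : ∀ i k, 0 ≤ V i k := fun i k => by simpa [V] using h i k
  rw [co_vertex, h1]
  have a : V 0 = ![1, 0, 0] := by ext k; fin_cases k <;> simp [V, bary]
  have b : V 1 = ![0, 1, 0] := by ext k; fin_cases k <;> simp [V, bary]
  have c : V 2 = ![0, 0, 1] := by ext k; fin_cases k <;> simp [V, bary]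
  rw [a, b, c]
  simpa [det] using ⟨h' i 0, h' i 1, h' i 2⟩

theorem hull_mono (T : Fin 3 → Plane) {K K' : Knots} (h : ∀ j, K j ≠ 0 → K' j ≠ 0) :
    hull T K ⊆ hull T K' :=
  convexHull_mono (Set.image_mono fun j hj => h j hj)

theorem isCompact_hull (T : Fin 3 → Plane) (K : Knots) : IsCompact (hull T K) :=
  ((Set.toFinite {i | K i ≠ 0}).image _).isCompact_convexHull (𝕜 := ℝ)

theorem area_triangle_pos (hT : AffineIndependent ℝ T) : 0 < area (triangle T) := by
  have hc : IsCompact (triangle T) := (Set.finite_range T).isCompact_convexHull (𝕜 := ℝ)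
  refine ENNReal.toReal_pos (Measure.measure_pos_of_nonempty_interior _ ?_).ne'
    hc.measure_lt_top.ne
  rw [triangle, interior_convexHull_nonempty_iff_affineSpan_eq_top]
  exact hT.affineSpan_eq_top_iff_card_eq_finrank_add_one.mpr (by simp)

/-- Three independent knots give a triangle of positive area inside the hull; otherwise the hull
lies on a proper affine subspace, which is a null set. -/
theorem area_hull_eq_zero_iff (hT : AffineIndependent ℝ T) (K : Knots) :
    area (hull T K) = 0 ↔ ¬ Spans K := by
  constructor
  · rintro h ⟨i, j, k, hi, hj, hk, hd⟩
    have hsub : hull T (knots3 i j k) ⊆ hull T K := hull_mono T fun l hl => by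
      rcases knots3_ne_zero.mp hl with rfl | rfl | rfl <;> assumption
    have : area (hull T (knots3 i j k)) ≤ area (hull T K) :=
      measureReal_mono hsub (isCompact_hull T K).measure_lt_top.ne
    rw [h, area_hull_knots3] at this
    exact absurd this (not_le.mpr (mul_pos (abs_pos.mpr hd) (area_triangle_pos hT)))
  · intro h
    have key : ∃ i j : Fin 10, i ≠ j ∧ ∀ l, K l ≠ 0 → det (V l) (V i) (V j) = 0 := by
      by_cases h1 : ∃ i j, i ≠ j ∧ K i ≠ 0 ∧ K j ≠ 0
      · obtain ⟨i, j, hij, hi, hj⟩ := h1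
        refine ⟨i, j, hij, fun l hl => ?_⟩
        by_contra hd
        exact h ⟨l, i, j, hl, hi, hj, hd⟩
      · push Not at h1
        by_cases h2 : ∃ i, K i ≠ 0
        · obtain ⟨i, hi⟩ := h2
          -- With only one distinct knot any line through it will do.
          refine ⟨i, i + 1, by simp, fun l hl => ?_⟩
          have : l = i := by
            by_contra hli
            exact hi (h1 l i hli hl)
          rw [this, det_self_left]
        · exact ⟨0, 1, by simp, fun l hl => absurd ⟨l, hl⟩ h2⟩
    obtain ⟨i, j, hij, hl⟩ := key
    obtain ⟨k, hk⟩ := exists_det_ne_zero hij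
    have hS : ∃ S : AffineSubspace ℝ Plane, ∀ x, x ∈ S ↔ det (co hT x) (V i) (V j) = 0 := by
      let B : AffineBasis (Fin 3) ℝ Plane :=
        ⟨T, hT, hT.affineSpan_eq_top_iff_card_eq_finrank_add_one.mpr (by simp)⟩
      let f : Plane →ᵃ[ℝ] ℝ := (V i 1 * V j 2 - V i 2 * V j 1) • B.coord 0
        - (V i 0 * V j 2 - V i 2 * V j 0) • B.coord 1
        + (V i 0 * V j 1 - V i 1 * V j 0) • B.coord 2
      refine ⟨AffineSubspace.comap f (AffineSubspace.mk' 0 ⊥), fun x => ?_⟩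
      rw [AffineSubspace.mem_comap, AffineSubspace.mem_mk']
      have : f x = det (co hT x) (V i) (V j) := by
        simp [f, det, co, B]; ring
      simp [this]
    obtain ⟨S, hS⟩ := hS
    have hsub : hull T K ⊆ S := by
      refine convexHull_min (𝕜 := ℝ) ?_ S.convex
      rintro _ ⟨l, h1, rfl⟩
      rw [SetLike.mem_coe, hS, co_vertex]
      exact hl l h1
    have hne : S ≠ ⊤ := by
      rintro rfl
      have := (hS (vertex T k)).mp trivial
      rw [co_vertex] at this
      exact hk this
    unfold area Measure.real
    rw [measure_mono_null hsub (Measure.addHaar_affineSubspace _ _ hne), ENNReal.toReal_zero]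

/-! ### Values on three knots and the faces of the 12-split -/

/-- The values of the recursion on three knots, for a point that is not on the boundary of a
hull. -/
def baseAt (T : Fin 3 → Plane) (y : Plane) (K : Knots) : ℝ :=
  (hull T K).indicator 1 y * (area (triangle T) / area (hull T K))

/-- The point `x` enters the recursion through its coordinates and, at the last level, through
half-open hulls. The auxiliary point `y` takes over the second role only, so it can be moved to a
generic position. -/
theorem simplexSplineRec_eq_spl (hT : AffineIndependent ℝ T) {x y : Plane}
    (h : ∀ K, x ∈ halfOpenHull T K ↔ y ∈ hull T K) (n : ℕ) (K : Knots) :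
    simplexSplineRec T n K x = spl (baseAt T y) n K (co hT x) := by
  induction n generalizing K with
  | zero =>
    have hi : (halfOpenHull T K).indicator 1 x = ((hull T K).indicator 1 y : ℝ) := by
      by_cases hx : x ∈ halfOpenHull T K
      · rw [Set.indicator_of_mem hx, Set.indicator_of_mem ((h K).mp hx)]; rfl
      · rw [Set.indicator_of_notMem hx, Set.indicator_of_notMem (fun hy => hx ((h K).mpr hy))]
    simp only [simplexSplineRec, spl, baseAt, hi]
    split_ifs with h1 <;> simp [h1]
  | succ n ih =>
    simp only [simplexSplineRec, spl, affineRep_eq hT, ih]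
    by_cases hS : Spans K
    · rw [if_neg (fun h => (area_hull_eq_zero_iff hT K).mp h hS), if_pos hS]
    · rw [if_pos ((area_hull_eq_zero_iff hT K).mpr hS), if_neg hS]

theorem exists_knots3_of_spans {K : Knots} (hS : Spans K) (h : ∑ j, K j = 3) :
    ∃ i j k, det (V i) (V j) (V k) ≠ 0 ∧ K = knots3 i j k := by
  obtain ⟨i, j, k, hi, hj, hk, hd⟩ := hS
  obtain ⟨hij, hik, hjk⟩ := ne_of_det_ne_zero hd
  refine ⟨i, j, k, hd, ?_⟩
  have h1 : remove K k j ≠ 0 := by rwa [remove_apply_of_ne hjk]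
  have h2 : remove (remove K k) j i ≠ 0 := by
    rwa [remove_apply_of_ne hij, remove_apply_of_ne hik]
  have h3 := eq_zero_of_sum (K := remove (remove (remove K k) j) i)
    (by have := sum_remove hk; have := sum_remove h1; have := sum_remove h2; omega)
  rw [← remove_add_single hk, ← remove_add_single h1, ← remove_add_single h2, h3, knots3]
  abel

/-- Division by the zero area gives zero, which is the prescribed degenerate value. -/
theorem baseAt_of_not_spans (hT : AffineIndependent ℝ T) (y : Plane) {K : Knots}
    (h : ¬ Spans K) : baseAt T y K = 0 := by
  rw [baseAt, (area_hull_eq_zero_iff hT K).mpr h, div_zero, mul_zero]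

/-- The ratio of areas is the inverse of the absolute determinant, so multiplying by the determinant
leaves the orientation sign times the indicator. Off the three side lines the weak inequalities of
the closed hull are strict. -/
theorem det_mul_baseAt (hT : AffineIndependent ℝ T) {y : Plane} {i j k : Fin 10}
    (hd : det (V i) (V j) (V k) ≠ 0) (hij : det (co hT y) (V i) (V j) ≠ 0)
    (hjk : det (co hT y) (V j) (V k) ≠ 0) (hki : det (co hT y) (V k) (V i) ≠ 0) :
    det (V i) (V j) (V k) * baseAt T y (knots3 i j k) =
      wind (det (co hT y) (V i) (V j)) (det (co hT y) (V j) (V k))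
        (det (co hT y) (V k) (V i)) := by
  have hs := det_add_det_add_det (co_sum hT y) (V_sum i) (V_sum j) (V_sum k)
  have hA := (area_triangle_pos hT).ne'
  classical
  rw [baseAt, area_hull_knots3, Set.indicator_apply, mem_hull_knots3 hT hd, wind]
  rcases hd.lt_or_gt with h | h
  · rw [abs_of_neg h]
    have e : ∀ a : ℝ, 0 ≤ a / det (V i) (V j) (V k) ↔ a ≤ 0 := fun a => by
      rw [le_div_iff_of_neg h, zero_mul]
    simp only [e]
    rw [if_neg (c := 0 < _ ∧ _) (by rintro ⟨h1, h2, h3⟩; linarith)]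
    by_cases hc : det (co hT y) (V i) (V j) < 0 ∧ det (co hT y) (V j) (V k) < 0 ∧
        det (co hT y) (V k) (V i) < 0
    · rw [if_pos ⟨hc.2.1.le, hc.2.2.le, hc.1.le⟩, if_pos hc]
      field_simp
      simp
    · rw [if_neg (by
        rintro ⟨h1, h2, h3⟩
        exact hc ⟨h3.lt_of_ne hij, h1.lt_of_ne hjk, h2.lt_of_ne hki⟩), if_neg hc]
      simp
  · rw [abs_of_pos h]
    have e : ∀ a : ℝ, 0 ≤ a / det (V i) (V j) (V k) ↔ 0 ≤ a := fun a => by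
      rw [le_div_iff₀ h, zero_mul]
    simp only [e]
    rw [if_neg (c := _ < 0 ∧ _) (by rintro ⟨h1, h2, h3⟩; linarith)]
    by_cases hc : 0 < det (co hT y) (V i) (V j) ∧ 0 < det (co hT y) (V j) (V k) ∧
        0 < det (co hT y) (V k) (V i)
    · rw [if_pos ⟨hc.2.1.le, hc.2.2.le, hc.1.le⟩, if_pos hc]
      field_simp
      simp
    · rw [if_neg (by
        rintro ⟨h1, h2, h3⟩
        exact hc ⟨h3.lt_of_ne hij.symm, h1.lt_of_ne hjk.symm, h2.lt_of_ne hki.symm⟩), if_neg hc]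
      simp

theorem isBase_baseAt (hT : AffineIndependent ℝ T) {y : Plane} (hy : Generic (co hT y)) :
    IsBase (baseAt T y) :=
  isBase_of_wind (co_sum hT y) hy (fun _ h => baseAt_of_not_spans hT y h) fun i j k hd => by
    obtain ⟨hij, hik, hjk⟩ := ne_of_det_ne_zero hd
    exact det_mul_baseAt hT hd (hy _ _ hij) (hy _ _ hjk) (hy _ _ hik.symm)

theorem wind_congr {x y z x' y' z' : ℝ} (hx : 0 < x * x') (hy : 0 < y * y') (hz : 0 < z * z') :
    wind x y z = wind x' y' z' := by
  have e : ∀ {a b : ℝ}, 0 < a * b → ((0 < a ↔ 0 < b) ∧ (a < 0 ↔ b < 0)) := fun {a b} h => by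
    rcases pos_and_pos_or_neg_and_neg_of_mul_pos h with ⟨h1, h2⟩ | ⟨h1, h2⟩
    · exact ⟨iff_of_true h1 h2, iff_of_false h1.not_gt h2.not_gt⟩
    · exact ⟨iff_of_false h1.not_gt h2.not_gt, iff_of_true h1 h2⟩
  simp only [wind, (e hx).1, (e hy).1, (e hz).1, (e hx).2, (e hy).2, (e hz).2]

/-- Base values are locally constant: they can change only where a line through two of the knots is
crossed. -/
theorem baseAt_congr (hT : AffineIndependent ℝ T) {y y' : Plane} {K : Knots} (hK : ∑ j, K j = 3)
    (h : ∀ i j, K i ≠ 0 → K j ≠ 0 → i ≠ j →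
      0 < det (co hT y) (V i) (V j) * det (co hT y') (V i) (V j)) :
    baseAt T y K = baseAt T y' K := by
  by_cases hS : Spans K
  · obtain ⟨i, j, k, hd, rfl⟩ := exists_knots3_of_spans hS hK
    obtain ⟨hij, hik, hjk⟩ := ne_of_det_ne_zero hd
    have hi : knots3 i j k i ≠ 0 := knots3_ne_zero.mpr (.inl rfl)
    have hj : knots3 i j k j ≠ 0 := knots3_ne_zero.mpr (.inr (.inl rfl))
    have hk : knots3 i j k k ≠ 0 := knots3_ne_zero.mpr (.inr (.inr rfl))
    have a1 := h i j hi hj hij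
    have a2 := h j k hj hk hjk
    have a3 := h k i hk hi hik.symm
    apply mul_left_cancel₀ hd
    rw [det_mul_baseAt hT hd (left_ne_zero_of_mul a1.ne') (left_ne_zero_of_mul a2.ne')
      (left_ne_zero_of_mul a3.ne'), det_mul_baseAt hT hd (right_ne_zero_of_mul a1.ne')
      (right_ne_zero_of_mul a2.ne') (right_ne_zero_of_mul a3.ne'), wind_congr a1 a2 a3]
  · rw [baseAt_of_not_spans hT _ hS, baseAt_of_not_spans hT _ hS]

theorem closedFace_eq_hull (T : Fin 3 → Plane) (f : Fin 12) :
    closedFace T f = hull T (knots3 (faceVertex f 0) (faceVertex f 1) (faceVertex f 2)) := by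
  rw [closedFace, hull_knots3]
  congr 1
  ext x
  simp [Fin.exists_fin_succ, eq_comm]

theorem closedFace_subset_triangle (hT : AffineIndependent ℝ T) (f : Fin 12) :
    closedFace T f ⊆ triangle T := by
  rw [closedFace_eq_hull]; exact hull_subset_triangle hT _

theorem halfOpenFace_unique {x : Plane} {f g : Fin 12} (hf : x ∈ halfOpenFace T f)
    (hg : x ∈ halfOpenFace T g) : f = g := by
  rcases lt_trichotomy f g with h | h | h
  · exact absurd (Set.mem_iUnion₂.mpr ⟨f, h, hf.1⟩) hg.2
  · exact h
  · exact absurd (Set.mem_iUnion₂.mpr ⟨g, h, hg.1⟩) hf.2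

theorem exists_halfOpenFace {x : Plane} (h : ∃ f, x ∈ closedFace T f) :
    ∃ f, x ∈ halfOpenFace T f := by
  classical
  obtain ⟨f, hf⟩ := h
  induction f using WellFoundedLT.induction with
  | _ f ih =>
    by_cases h : ∃ g, g < f ∧ x ∈ closedFace T g
    · obtain ⟨g, hg, hx⟩ := h
      exact ih g hg hx
    · refine ⟨f, hf, fun hx => h ?_⟩
      simpa using hx

/-- Whether the segments from `x` to a face point start in a hull is decided by each of their
points that are near to `x`. -/
theorem eventually_mem_halfOpenHull_iff {x : Plane} {f : Fin 12} (hf : x ∈ halfOpenFace T f) :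
    ∀ᶠ ε : ℝ in 𝓝[>] 0, ∀ K, x ∈ halfOpenHull T K ↔
      AffineMap.lineMap x (facePoint T f) ε ∈ hull T K := by
  have hS : ∀ S : Set (Fin 10), ∀ᶠ ε : ℝ in 𝓝[>] 0,
      ((∀ᶠ δ : ℝ in 𝓝[>] 0, AffineMap.lineMap x (facePoint T f) δ ∈
        convexHull ℝ (vertex T '' S)) ↔
      AffineMap.lineMap x (facePoint T f) ε ∈ convexHull ℝ (vertex T '' S)) := by
    intro S
    by_cases h : ∀ᶠ δ : ℝ in 𝓝[>] 0, AffineMap.lineMap x (facePoint T f) δ ∈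
        convexHull ℝ (vertex T '' S)
    · filter_upwards [h] with ε hε
      exact iff_of_true h hε
    · suffices hev : ∀ᶠ δ : ℝ in 𝓝[>] 0, AffineMap.lineMap x (facePoint T f) δ ∉
          convexHull ℝ (vertex T '' S) by
        filter_upwards [hev] with ε hε
        exact iff_of_false h hε
      by_contra hfr
      apply h
      rw [not_eventually] at hfr
      simp only [not_not] at hfr
      obtain ⟨a, ha, ha'⟩ := (hfr.and_eventually self_mem_nhdsWithin).exists
      filter_upwards [Ioo_mem_nhdsGT ha'] with ε hε
      obtain ⟨c, hc, hc'⟩ := (hfr.and_eventually (Ioo_mem_nhdsGT hε.1)).exists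
      -- The parameters in the hull form an interval, so if they accumulate at 0 from the right they
      -- fill a whole right neighbourhood.
      have hcv : Convex ℝ ((AffineMap.lineMap x (facePoint T f) : ℝ →ᵃ[ℝ] Plane) ⁻¹'
        convexHull ℝ (vertex T '' S)) := (convex_convexHull ℝ _).affine_preimage _
      exact hcv.ordConnected.out hc ha ⟨hc'.2.le, hε.2.le⟩
  filter_upwards [eventually_all.mpr hS] with ε hε K
  rw [← show _ ↔ AffineMap.lineMap x (facePoint T f) ε ∈ hull T K from hε {i | K i ≠ 0}]
  constructor
  · rintro ⟨g, hg, h⟩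
    rwa [halfOpenFace_unique hf hg]
  · intro h
    exact ⟨f, hf, h⟩

theorem halfOpenHull_subset_triangle (hT : AffineIndependent ℝ T) (K : Knots) :
    halfOpenHull T K ⊆ triangle T := by
  rintro x ⟨f, hf, -⟩
  exact closedFace_subset_triangle hT f hf.1

/-- The coordinates of the face points. -/
def faceCo (f : Fin 12) : Fin 3 → ℚ := fun k =>
  (1/2) * bary (faceVertex f 0) k + (1/4) * bary (faceVertex f 1) k
    + (1/4) * bary (faceVertex f 2) k

theorem co_facePoint (hT : AffineIndependent ℝ T) (f : Fin 12) :
    co hT (facePoint T f) = fun k => (faceCo f k : ℝ) := by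
  have h : facePoint T f = ∑ k, ((faceCo f k : ℚ) : ℝ) • T k := by
    simp only [facePoint, vertex, Fin.sum_univ_three, faceCo]
    push_cast
    module
  rw [h]
  apply co_sum_smul hT (X := fun k => (faceCo f k : ℝ))
  have hs : ∀ f, faceCo f 0 + faceCo f 1 + faceCo f 2 = 1 := by decide +kernel
  exact_mod_cast hs f

theorem generic_facePoint (hT : AffineIndependent ℝ T) (f : Fin 12) :
    Generic (co hT (facePoint T f)) := by
  intro i j hij
  have h : ∀ f, ∀ i j : Fin 10, i ≠ j → detQ (faceCo f) (bary i) (bary j) ≠ 0 := by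
    decide +kernel
  rw [co_facePoint, show V i = fun k => (bary i k : ℝ) from rfl,
    show V j = fun k => (bary j k : ℝ) from rfl, det_cast]
  exact_mod_cast h f i j hij

theorem det_lineMap (hT : AffineIndependent ℝ T) (x y : Plane) (t : ℝ) (Y Z : Vec) :
    det (co hT (AffineMap.lineMap x y t)) Y Z
      = (1 - t) * det (co hT x) Y Z + t * det (co hT y) Y Z := by
  rw [co_lineMap, det_add_left, det_smul_left, det_smul_left]

theorem exists_closedFace (hT : AffineIndependent ℝ T) {x : Plane} (hx : x ∈ triangle T) :
    ∃ f, x ∈ closedFace T f := by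
  have h1 : det (V 0) (V 1) (V 2) = 1 := by simp [det, V, bary]
  rw [triangle_eq_hull, mem_hull_knots3 hT (by rw [h1]; exact one_ne_zero)] at hx
  have hs := co_sum hT x
  have hd : ∀ f, det (V (faceVertex f 0)) (V (faceVertex f 1)) (V (faceVertex f 2)) ≠ 0 := by
    intro f
    have h : ∀ f, detQ (bary (faceVertex f 0)) (bary (faceVertex f 1))
      (bary (faceVertex f 2)) ≠ 0 := by decide +kernel
    rw [det_V]; exact_mod_cast h f
  have hmem := fun f => (mem_hull_knots3 hT (x := x) (hd f))
  simp only [← closedFace_eq_hull] at hmem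
  simp only [h1, div_one] at hx
  generalize co hT x = X at hs hx hmem
  simp [det, V, bary] at hx
  obtain ⟨x0, x1, x2⟩ := hx
  -- A coordinate at least 1/2 means a corner triangle, halved by its median; otherwise the point is
  -- in the medial triangle, cut into six by the three medians.
  rcases le_total (1/2) (X 0) with h0 | h0
  · rcases le_total (X 1) (X 2) with h | h
    · exact ⟨11, (hmem 11).mpr (by
        simp [det, V, bary, faceVertex]
        refine ⟨?_, ?_, ?_⟩ <;> norm_num <;> linarith)⟩
    · exact ⟨7, (hmem 7).mpr (by
        simp [det, V, bary, faceVertex]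
        refine ⟨?_, ?_, ?_⟩ <;> norm_num <;> linarith)⟩
  rcases le_total (1/2) (X 1) with h1 | h1
  · rcases le_total (X 0) (X 2) with h | h
    · exact ⟨0, (hmem 0).mpr (by
        simp [det, V, bary, faceVertex]
        refine ⟨?_, ?_, ?_⟩ <;> norm_num <;> linarith)⟩
    · exact ⟨4, (hmem 4).mpr (by
        simp [det, V, bary, faceVertex]
        refine ⟨?_, ?_, ?_⟩ <;> norm_num <;> linarith)⟩
  rcases le_total (1/2) (X 2) with h2 | h2
  · rcases le_total (X 0) (X 1) with h | h
    · exact ⟨2, (hmem 2).mpr (by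
        simp [det, V, bary, faceVertex]
        refine ⟨?_, ?_, ?_⟩ <;> norm_num <;> linarith)⟩
    · exact ⟨8, (hmem 8).mpr (by
        simp [det, V, bary, faceVertex]
        refine ⟨?_, ?_, ?_⟩ <;> norm_num <;> linarith)⟩
  -- Two of the eight combinations are cyclic and leave only the centroid, for which face 3 is as
  -- good as any.
  rcases le_total (X 0) (X 1) with h3 | h3 <;> rcases le_total (X 0) (X 2) with h4 | h4 <;>
    rcases le_total (X 1) (X 2) with h5 | h5
  · exact ⟨3, (hmem 3).mpr (by
      simp [det, V, bary, faceVertex]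
      refine ⟨?_, ?_, ?_⟩ <;> norm_num <;> linarith)⟩
  · exact ⟨1, (hmem 1).mpr (by
      simp [det, V, bary, faceVertex]
      refine ⟨?_, ?_, ?_⟩ <;> norm_num <;> linarith)⟩
  · exact ⟨3, (hmem 3).mpr (by
      simp [det, V, bary, faceVertex]
      refine ⟨?_, ?_, ?_⟩ <;> norm_num <;> linarith)⟩
  · exact ⟨5, (hmem 5).mpr (by
      simp [det, V, bary, faceVertex]
      refine ⟨?_, ?_, ?_⟩ <;> norm_num <;> linarith)⟩
  · exact ⟨9, (hmem 9).mpr (by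
      simp [det, V, bary, faceVertex]
      refine ⟨?_, ?_, ?_⟩ <;> norm_num <;> linarith)⟩
  · exact ⟨3, (hmem 3).mpr (by
      simp [det, V, bary, faceVertex]
      refine ⟨?_, ?_, ?_⟩ <;> norm_num <;> linarith)⟩
  · exact ⟨10, (hmem 10).mpr (by
      simp [det, V, bary, faceVertex]
      refine ⟨?_, ?_, ?_⟩ <;> norm_num <;> linarith)⟩
  · exact ⟨6, (hmem 6).mpr (by
      simp [det, V, bary, faceVertex]
      refine ⟨?_, ?_, ?_⟩ <;> norm_num <;> linarith)⟩

theorem spl_zero (n : ℕ) (K : Knots) (X : Vec) : spl 0 n K X = 0 := by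
  induction n generalizing K with
  | zero => rfl
  | succ n ih => simp [spl, ih]

theorem spl_eq_zero {b : Knots → ℝ} {n : ℕ} {K : Knots} (hK : ∑ j, K j = n + 3)
    (h : ∀ K' ≤ K, ∑ j, K' j = 3 → b K' = 0) (X : Vec) : spl b n K X = 0 := by
  rw [spl_congr (b' := 0) n hK (by simpa using h), spl_zero]

/-! ### Order of vanishing of a jump across a line -/

/-- The linear form `X ↦ det X Y Z`. -/
def detPoly (Y Z : Vec) : MvPolynomial (Fin 3) ℝ :=
  MvPolynomial.C (Y 1 * Z 2 - Y 2 * Z 1) * MvPolynomial.X 0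
    - MvPolynomial.C (Y 0 * Z 2 - Y 2 * Z 0) * MvPolynomial.X 1
    + MvPolynomial.C (Y 0 * Z 1 - Y 1 * Z 0) * MvPolynomial.X 2

theorem eval_detPoly (X Y Z : Vec) : MvPolynomial.eval X (detPoly Y Z) = det X Y Z := by
  simp [detPoly, det]; ring

/-- The number of knots off a line. -/
def off (L : Finset (Fin 10)) (K : Knots) : ℕ := ∑ j ∈ Lᶜ, K j

theorem off_remove_of_mem {L : Finset (Fin 10)} {K : Knots} {a : Fin 10} (ha : a ∈ L) :
    off L (remove K a) = off L K :=
  Finset.sum_congr rfl fun j hj => remove_apply_of_ne (by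
    rintro rfl; exact Finset.mem_compl.mp hj ha)

theorem off_remove_of_notMem {L : Finset (Fin 10)} {K : Knots} {c : Fin 10} (hc : c ∉ L)
    (hK : K c ≠ 0) : off L (remove K c) + 1 = off L K := by
  have hc' : c ∈ Lᶜ := Finset.mem_compl.mpr hc
  rw [off, off, ← Finset.add_sum_erase _ _ hc', ← Finset.add_sum_erase _ K hc',
    remove_apply_self, Finset.sum_congr rfl fun i hi => remove_apply_of_ne (Finset.ne_of_mem_erase hi)]
  omega

/-- A line through vertices of the 12-split, given by a linear form and the vertices on the line. -/
structure IsLine (Y Z : Vec) (L : Finset (Fin 10)) : Prop where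
  mem_iff : ∀ j, j ∈ L ↔ det (V j) Y Z = 0
  det_ne : ∀ a b c, a ∈ L → b ∈ L → a ≠ b → c ∉ L → det (V a) (V b) (V c) ≠ 0

/-- A linear form that vanishes on three independent vectors vanishes identically. -/
theorem IsLine.not_spans {Y Z : Vec} {L : Finset (Fin 10)} (h : IsLine Y Z L) (hYZ : ∃ X, det X Y Z ≠ 0)
    {K : Knots} (hK : off L K = 0) : ¬ Spans K := by
  rintro ⟨i, j, k, hi, hj, hk, hd⟩
  have h0 : ∀ l, K l ≠ 0 → det (V l) Y Z = 0 := fun l hl => by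
    rw [← h.mem_iff]
    by_contra hL
    exact hl ((Finset.sum_eq_zero_iff.mp hK) l (Finset.mem_compl.mpr hL))
  obtain ⟨X, hX⟩ := hYZ
  have := congrArg (fun W => det W Y Z) (det_cramer (V i) (V j) (V k) X)
  simp only [det_add_left, det_smul_left, h0 i hi, h0 j hj, h0 k hk] at this
  simp only [mul_zero, add_zero, mul_eq_zero, hd, hX, or_self] at this

/-- The product of the values of the linear form at the knots off the line. -/
def offProd (Y Z : Vec) (L : Finset (Fin 10)) (K : Knots) : ℝ := ∏ j ∈ Lᶜ, det (V j) Y Z ^ K j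

theorem offProd_remove_of_mem {Y Z : Vec} {L : Finset (Fin 10)} {K : Knots} {a : Fin 10}
    (ha : a ∈ L) : offProd Y Z L (remove K a) = offProd Y Z L K :=
  Finset.prod_congr rfl fun j hj => by
    rw [remove_apply_of_ne (by rintro rfl; exact Finset.mem_compl.mp hj ha)]

theorem offProd_remove_of_notMem {Y Z : Vec} {L : Finset (Fin 10)} {K : Knots} {c : Fin 10}
    (hc : c ∉ L) (hK : K c ≠ 0) :
    offProd Y Z L (remove K c) * det (V c) Y Z = offProd Y Z L K := by
  have hc' : c ∈ Lᶜ := Finset.mem_compl.mpr hc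
  rw [offProd, offProd, ← Finset.mul_prod_erase _ _ hc',
    ← Finset.mul_prod_erase _ (fun j => det (V j) Y Z ^ K j) hc', remove_apply_self,
    Finset.prod_congr rfl fun i hi => by rw [remove_apply_of_ne (Finset.ne_of_mem_erase hi)],
    mul_right_comm, ← pow_succ, Nat.sub_add_cancel (Nat.one_le_iff_ne_zero.mpr hK)]

/-- The multiset contains a pair from `S`. -/
def HasPair (S : Fin 10 → Fin 10 → Prop) (K : Knots) : Prop :=
  ∃ a b, K a ≠ 0 ∧ K b ≠ 0 ∧ S a b

/-- The form X ↦ det A B X also vanishes at `A` and `B`, so it is proportional to X ↦ det X Y Z;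
evaluation at `C` gives the factor. -/
theorem det_mul_det_of_mem {Y Z A B : Vec} (hA : det A Y Z = 0) (hB : det B Y Z = 0) (C X : Vec) :
    det A B X * det C Y Z = det A B C * det X Y Z := by
  have := congrArg (fun W => det W Y Z) (det_cramer C A B X)
  simp only [det_add_left, det_smul_left, hA, hB, mul_zero, add_zero] at this
  rw [det_rot C A B] at this
  rw [this, ← det_rot X A B]

/-- The order of vanishing on a line of the jump of a simplex spline across the line. Here `b` is
the jump in the values on three knots, and `S` is the set of pairs of vertices on the line between
which the jump takes place. -/
theorem exists_spl_eq_pow_mul {Y Z : Vec} {L : Finset (Fin 10)} (hL : IsLine Y Z L)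
    (hYZ : ∃ X, det X Y Z ≠ 0) {S : Fin 10 → Fin 10 → Prop}
    (hS : ∀ a b, S a b → a ∈ L ∧ b ∈ L ∧ a ≠ b) {b : Knots → ℝ} (hb : IsBase b) {K₀ : Knots}
    (hb1 : ∀ K ≤ K₀, ∑ j, K j = 3 → b K ≠ 0 → off L K = 1 ∧ HasPair S K)
    {p : Vec} {pos : Prop}
    (hp : pos → ∀ a b, S a b → ∃ α β : ℝ, 0 < α ∧ 0 < β ∧ p = α • V a + β • V b)
    (hpS : pos → ∀ a b e, S a b → e ∈ L → S e b ∨ S a e)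
    (hpb : pos → ∀ K, ∑ j, K j = 3 → off L K = 1 → HasPair S K → 0 < b K * offProd Y Z L K)
    (n : ℕ) : ∀ K ≤ K₀, ∑ j, K j = n + 3 → ∃ H : MvPolynomial (Fin 3) ℝ,
      (∀ X, spl b n K X = det X Y Z ^ (off L K - 1) * MvPolynomial.eval X H) ∧
      (pos → off L K ≠ 0 → HasPair S K → 0 < MvPolynomial.eval p H * offProd Y Z L K) ∧
      (¬ HasPair S K → H = 0) := by
  have hzero : ∀ n, ∀ K ≤ K₀, ∑ j, K j = n + 3 → ¬ HasPair S K → ∀ X, spl b n K X = 0 := by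
    intro n K hKK hK hP X
    refine spl_eq_zero hK (fun K' hK' h3 => ?_) X
    by_contra hne
    obtain ⟨-, a, c, ha, hc, hac⟩ := hb1 K' (hK'.trans hKK) h3 hne
    exact hP ⟨a, c, fun h => ha (Nat.le_zero.mp (h ▸ hK' a)),
      fun h => hc (Nat.le_zero.mp (h ▸ hK' c)), hac⟩
  -- Divisibility and positivity are proved together. Taking `pos` to be `False` gives divisibility
  -- alone; `True` gives the exact order of vanishing at `p`.
  induction n with
  | zero =>
    intro K hKK hK
    by_cases hP : HasPair S K
    swap
    · exact ⟨0, fun X => by rw [hzero 0 K hKK hK hP X]; simp, fun _ _ h => absurd h hP,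
        fun _ => rfl⟩
    by_cases h1 : off L K = 1
    · refine ⟨MvPolynomial.C (b K), fun X => by simp [spl, h1], fun h _ _ => ?_,
        fun h => absurd hP h⟩
      simpa using hpb h K hK h1 hP
    · have hbK : b K = 0 := by
        by_contra hne
        exact h1 (hb1 K hKK hK hne).1
      refine ⟨0, fun X => by simp [spl, hbK], fun _ h0 _ => ?_, fun _ => rfl⟩
      exfalso
      obtain ⟨a, c, ha, hc, hac⟩ := hP
      obtain ⟨haL, hcL, hne⟩ := hS _ _ hac
      have hc' : remove K a c ≠ 0 := by rwa [remove_apply_of_ne hne.symm]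
      have e1 := off_remove_of_mem (K := K) haL
      have e2 := off_remove_of_mem (K := remove K a) hcL
      have e3 := sum_remove ha
      have e4 := sum_remove hc'
      have e5 : off L (remove (remove K a) c) ≤ ∑ j, remove (remove K a) c j :=
        Finset.sum_le_sum_of_subset (Finset.subset_univ _)
      omega
  | succ n ih =>
    intro K hKK hK
    by_cases hP : HasPair S K
    swap
    · exact ⟨0, fun X => by rw [hzero _ K hKK hK hP X]; simp, fun _ _ h => absurd h hP,
        fun _ => rfl⟩
    by_cases h0 : off L K = 0
    · exact ⟨0, fun X => by rw [spl_of_not_spans hb (hL.not_spans hYZ h0)]; simp,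
        fun _ h => absurd h0 h, fun _ => rfl⟩
    obtain ⟨a, e, ha, he, hae⟩ := id hP
    obtain ⟨haL, heL, hne⟩ := hS _ _ hae
    obtain ⟨c, hcL, hc⟩ : ∃ c, c ∉ L ∧ K c ≠ 0 := by
      by_contra! h
      exact h0 (Finset.sum_eq_zero fun j hj => h j (Finset.mem_compl.mp hj))
    have hd := hL.det_ne a e c haL heL hne hcL
    have hcℓ : det (V c) Y Z ≠ 0 := fun h => hcL ((hL.mem_iff c).mpr h)
    have haℓ := (hL.mem_iff a).mp haL
    have heℓ := (hL.mem_iff e).mp heL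
    have hcard : ∀ {j}, K j ≠ 0 → ∑ i, remove K j i = n + 3 := fun {j} hj => by
      have := sum_remove hj; omega
    obtain ⟨Ha, a1, a2, a3⟩ := ih _ ((remove_le K a).trans hKK) (hcard ha)
    obtain ⟨He, e1, e2, e3⟩ := ih _ ((remove_le K e).trans hKK) (hcard he)
    obtain ⟨Hc, c1, c2, c3⟩ := ih _ ((remove_le K c).trans hKK) (hcard hc)
    simp only [off_remove_of_mem haL, offProd_remove_of_mem haL] at a1 a2
    simp only [off_remove_of_mem heL, offProd_remove_of_mem heL] at e1 e2
    have hoc := off_remove_of_notMem hcL hc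
    have hprod := offProd_remove_of_notMem (Y := Y) (Z := Z) hcL hc
    -- Removing `c` costs one power of the form, and the coefficient of `c` restores it. If `c` is
    -- the only knot off the line, the truncated exponent restores nothing, but then the remaining
    -- knots are collinear and the term is zero.
    obtain ⟨Hc', hc'1, hc'2⟩ : ∃ Hc' : MvPolynomial (Fin 3) ℝ,
        (∀ X, det X Y Z * spl b n (remove K c) X
          = det X Y Z ^ (off L K - 1) * MvPolynomial.eval X Hc') ∧
        (pos → 0 ≤ MvPolynomial.eval p Hc' * offProd Y Z L (remove K c) ∧
          (off L K ≠ 1 → 0 < MvPolynomial.eval p Hc' * offProd Y Z L (remove K c))) := by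
      by_cases h1 : off L K = 1
      · refine ⟨0, fun X => ?_, fun _ => by simp [h1]⟩
        rw [spl_of_not_spans hb (hL.not_spans hYZ (by omega))]; simp
      · refine ⟨Hc, fun X => ?_, fun h => ?_⟩
        · rw [c1 X, ← mul_assoc, ← pow_succ']
          congr 2; omega
        · have hca : a ≠ c := by rintro rfl; exact hcL haL
          have hce : e ≠ c := by rintro rfl; exact hcL heL
          have := c2 h (by omega) ⟨a, e, by rwa [remove_apply_of_ne hca],
            by rwa [remove_apply_of_ne hce], hae⟩
          exact ⟨this.le, fun _ => this⟩
    refine ⟨MvPolynomial.C (det (V a) (V e) (V c))⁻¹ * (detPoly (V e) (V c) * Ha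
      - detPoly (V a) (V c) * He) + MvPolynomial.C (det (V c) Y Z)⁻¹ * Hc', fun X => ?_,
      fun h _ _ => ?_, fun h => absurd hP h⟩
    · rw [spl_cramer hb hK ha he hc hd, a1, e1]
      have := det_mul_det_of_mem haℓ heℓ (V c) X
      have h2 : det (V a) (V e) X / det (V a) (V e) (V c) = det X Y Z / det (V c) Y Z := by
        rw [div_eq_div_iff hd hcℓ, this, mul_comm]
      have h3 : det (V a) X (V c) = - det X (V a) (V c) := by simp only [det]; ring
      rw [h2, h3, div_mul_eq_mul_div (det X Y Z), hc'1]
      simp only [map_add, map_mul, map_sub, MvPolynomial.eval_C, eval_detPoly]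
      field_simp
      ring
    · obtain ⟨α, β, hα, hβ, hpe⟩ := hp h a e hae
      have k1 : det p (V e) (V c) = α * det (V a) (V e) (V c) := by
        rw [hpe, det_add_left, det_smul_left, det_smul_left, det_self_left]; ring
      have k2 : det p (V a) (V c) = - (β * det (V a) (V e) (V c)) := by
        rw [hpe, det_add_left, det_smul_left, det_smul_left, det_self_left]
        simp only [det]; ring
      simp only [map_add, map_mul, map_sub, MvPolynomial.eval_C, eval_detPoly, k1, k2]
      -- At `p` the coefficients of `a` and `e` are the positive numbers `α`, `β`, and `offProd`
      -- absorbs the value of the form at `c`. All three terms are nonnegative, so nothing cancels.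
      have e0 : ((det (V a) (V e) (V c))⁻¹ * (α * det (V a) (V e) (V c) * MvPolynomial.eval p Ha
          - -(β * det (V a) (V e) (V c)) * MvPolynomial.eval p He)
          + (det (V c) Y Z)⁻¹ * MvPolynomial.eval p Hc') * offProd Y Z L K
          = α * (MvPolynomial.eval p Ha * offProd Y Z L K)
            + β * (MvPolynomial.eval p He * offProd Y Z L K)
            + MvPolynomial.eval p Hc' * offProd Y Z L (remove K c) := by
        rw [← hprod]; field_simp; ring
      rw [e0]
      have pa : 0 ≤ MvPolynomial.eval p Ha * offProd Y Z L K := by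
        by_cases hPa : HasPair S (remove K a)
        · exact (a2 h h0 hPa).le
        · rw [a3 hPa]; simp
      have pe : 0 ≤ MvPolynomial.eval p He * offProd Y Z L K := by
        by_cases hPe : HasPair S (remove K e)
        · exact (e2 h h0 hPe).le
        · rw [e3 hPe]; simp
      obtain ⟨pc, pc'⟩ := hc'2 h
      by_cases h1 : off L K = 1
      swap
      · have := pc' h1
        positivity
      -- With one knot off the line the term of `c` is zero, so another term must be strictly
      -- positive. There is a third knot `g` on the line, counted with multiplicity, and it forms a
      -- pair with `e` or with `a`.
      have hor : HasPair S (remove K a) ∨ HasPair S (remove K e) := by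
        obtain ⟨g, hgL, hg⟩ : ∃ g ∈ L, remove (remove K a) e g ≠ 0 := by
          by_contra! hall
          have h1' : remove K a e ≠ 0 := by rwa [remove_apply_of_ne hne.symm]
          have s1 := sum_remove ha
          have s2 := sum_remove h1'
          have s3 : ∑ j, remove (remove K a) e j = off L (remove (remove K a) e) := by
            rw [off, ← Finset.sum_add_sum_compl L, Finset.sum_eq_zero hall, zero_add]
          rw [off_remove_of_mem heL, off_remove_of_mem haL] at s3
          omega
        have g1 : remove K a g ≠ 0 := fun h => hg (Nat.le_zero.mp (h ▸ remove_le _ e g))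
        have g2 : remove K e g ≠ 0 := fun h => hg (by
          rw [remove_comm]; exact Nat.le_zero.mp (h ▸ remove_le _ a g))
        rcases hpS h a e g hae hgL with h' | h'
        · exact .inl ⟨g, e, g1, by rwa [remove_apply_of_ne hne.symm], h'⟩
        · exact .inr ⟨a, g, by rwa [remove_apply_of_ne hne], g2, h'⟩
      rcases hor with h' | h'
      · have := a2 h h0 h'
        positivity
      · have := e2 h h0 h'
        positivity

/-! ### Polynomial pieces and their gluing -/

theorem exists_co_eq (hT : AffineIndependent ℝ T) (k : Fin 3) :
    ∃ a b c : ℝ, ∀ x : Plane, co hT x k = a + b * x 0 + c * x 1 := by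
  let B : AffineBasis (Fin 3) ℝ Plane :=
    ⟨T, hT, hT.affineSpan_eq_top_iff_card_eq_finrank_add_one.mpr (by simp)⟩
  let e := EuclideanSpace.basisFun (Fin 2) ℝ
  refine ⟨B.coord k 0, (B.coord k).linear (e 0), (B.coord k).linear (e 1), fun x => ?_⟩
  have hx : x = x 0 • e 0 + x 1 • e 1 := by
    ext l; fin_cases l <;> simp [e]
  have h1 : B.coord k x = (B.coord k).linear x + B.coord k 0 := by
    conv_lhs => rw [AffineMap.decomp (B.coord k)]
    simp
  have h2 : (B.coord k).linear x
      = x 0 * (B.coord k).linear (e 0) + x 1 * (B.coord k).linear (e 1) := by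
    conv_lhs => rw [hx]
    simp only [map_add, map_smul, smul_eq_mul]
  change B.coord k x = _
  rw [h1, h2]; ring

/-- The recursion gives polynomials of the expected degree. -/
theorem exists_poly (hT : AffineIndependent ℝ T) {b : Knots → ℝ} (hb : IsBase b) (n : ℕ) :
    ∀ K : Knots, ∑ j, K j = n + 3 → ∃ p : MvPolynomial (Fin 2) ℝ, p.totalDegree ≤ n ∧
      ∀ x : Plane, spl b n K (co hT x) = MvPolynomial.eval (fun i => x i) p := by
  have hdet : ∀ Y Z : Vec, ∃ p : MvPolynomial (Fin 2) ℝ, p.totalDegree ≤ 1 ∧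
      ∀ x : Plane, det (co hT x) Y Z = MvPolynomial.eval (fun i => x i) p := by
    intro Y Z
    choose a b c h using exists_co_eq hT
    let A : Fin 3 → ℝ := ![Y 1 * Z 2 - Y 2 * Z 1, - (Y 0 * Z 2 - Y 2 * Z 0),
      Y 0 * Z 1 - Y 1 * Z 0]
    refine ⟨MvPolynomial.C (∑ k, A k * a k) + MvPolynomial.C (∑ k, A k * b k) * MvPolynomial.X 0
      + MvPolynomial.C (∑ k, A k * c k) * MvPolynomial.X 1, ?_, fun x => ?_⟩
    · refine (MvPolynomial.totalDegree_add _ _).trans (max_le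
        ((MvPolynomial.totalDegree_add _ _).trans (max_le
          (by rw [MvPolynomial.totalDegree_C]; exact Nat.zero_le _) ?_)) ?_) <;>
      · refine (MvPolynomial.totalDegree_mul _ _).trans ?_
        rw [MvPolynomial.totalDegree_C, MvPolynomial.totalDegree_X]
    · simp [det, h, A, Fin.sum_univ_three]
      ring
  induction n with
  | zero => intro K _; exact ⟨MvPolynomial.C (b K), by simp, fun x => by simp [spl]⟩
  | succ n ih =>
    intro K hK
    by_cases hS : Spans K
    swap
    · exact ⟨0, by simp, fun x => by rw [spl_of_not_spans hb hS]; simp⟩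
    obtain ⟨i, j, k, hi, hj, hk, hd⟩ := hS
    obtain ⟨pi, pi1, pi2⟩ := ih (remove K i) (by have := sum_remove hi; omega)
    obtain ⟨pj, pj1, pj2⟩ := ih (remove K j) (by have := sum_remove hj; omega)
    obtain ⟨pk, pk1, pk2⟩ := ih (remove K k) (by have := sum_remove hk; omega)
    obtain ⟨qi, qi1, qi2⟩ := hdet (V j) (V k)
    obtain ⟨qj, qj1, qj2⟩ := hdet (V k) (V i)
    obtain ⟨qk, qk1, qk2⟩ := hdet (V i) (V j)
    refine ⟨MvPolynomial.C (det (V i) (V j) (V k))⁻¹ * (qi * pi + qj * pj + qk * pk), ?_,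
      fun x => ?_⟩
    · refine (MvPolynomial.totalDegree_mul _ _).trans ?_
      rw [MvPolynomial.totalDegree_C, zero_add]
      refine (MvPolynomial.totalDegree_add _ _).trans (max_le
        ((MvPolynomial.totalDegree_add _ _).trans (max_le ?_ ?_)) ?_) <;>
      · refine (MvPolynomial.totalDegree_mul _ _).trans ?_
        omega
    · rw [spl_cramer hb hK hi hj hk hd, pi2, pj2, pk2]
      have e2 : det (V i) (co hT x) (V k) = det (co hT x) (V k) (V i) := det_rot _ _ _
      have e3 : det (V i) (V j) (co hT x) = det (co hT x) (V i) (V j) := (det_rot _ _ _).symm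
      rw [e2, e3, qi2, qj2, qk2]
      simp only [map_add, map_mul, MvPolynomial.eval_C]
      ring

theorem contDiff_eval {m : ℕ} {E : Type*} [NormedAddCommGroup E] [NormedSpace ℝ E]
    {c : E → Fin m → ℝ} {r : WithTop ℕ∞} (hc : ∀ k, ContDiff ℝ r fun x => c x k)
    (p : MvPolynomial (Fin m) ℝ) : ContDiff ℝ r fun x => MvPolynomial.eval (c x) p := by
  induction p using MvPolynomial.induction_on with
  | C a => simpa using contDiff_const
  | add p q hp hq => simpa using hp.add hq
  | mul_X p i hp => simpa using hp.mul (hc i)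

theorem contDiff_co (hT : AffineIndependent ℝ T) {r : WithTop ℕ∞} (k : Fin 3) :
    ContDiff ℝ r fun x => co hT x k := by
  obtain ⟨a, b, c, h⟩ := exists_co_eq hT k
  simp_rw [h]
  fun_prop

theorem contDiff_det_co (hT : AffineIndependent ℝ T) {r : WithTop ℕ∞} (Y Z : Vec) :
    ContDiff ℝ r fun x => det (co hT x) Y Z := by
  have := contDiff_co hT (r := r)
  unfold det
  fun_prop

theorem contDiff_spl (hT : AffineIndependent ℝ T) {b : Knots → ℝ} (hb : IsBase b) {n : ℕ}
    {K : Knots} (hK : ∑ j, K j = n + 3) {r : WithTop ℕ∞} :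
    ContDiff ℝ r fun x => spl b n K (co hT x) := by
  obtain ⟨p, -, hp⟩ := exists_poly hT hb n K hK
  simp_rw [hp]
  exact contDiff_eval (fun k => by fun_prop) p

/-- The derivatives of a multiple of a power vanish where the base vanishes. -/
theorem iteratedFDeriv_pow_smul_eq_zero {E : Type} [NormedAddCommGroup E] [NormedSpace ℝ E]
    {u : E → ℝ} (hu : ContDiff ℝ ⊤ u) {x : E} (hx : u x = 0) (m : ℕ) :
    ∀ {F : Type} [NormedAddCommGroup F] [NormedSpace ℝ F] {R : E → F}, ContDiff ℝ ⊤ R →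
      ∀ k ≤ m, iteratedFDeriv ℝ k (fun y => u y ^ (m + 1) • R y) x = 0 := by
  have h0 : ∀ (m : ℕ) {F : Type} [NormedAddCommGroup F] [NormedSpace ℝ F] {R : E → F},
      iteratedFDeriv ℝ 0 (fun y => u y ^ (m + 1) • R y) x = 0 := by
    intro m F _ _ R
    ext v
    simp [hx]
  induction m with
  | zero =>
    intro F _ _ R _ k hk
    obtain rfl : k = 0 := by omega
    exact h0 0
  | succ m ih =>
    intro F _ _ R hR k hk
    cases k with
    | zero => exact h0 (m + 1)
    | succ k =>
      -- The derivative is again a multiple of a power of `u`, but with values in linear maps; this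
      -- is why the induction quantifies over all target spaces.
      have hd : fderiv ℝ (fun y => u y ^ (m + 1 + 1) • R y) = fun y => u y ^ (m + 1) •
          (u y • fderiv ℝ R y + ((m : ℝ) + 2) • (fderiv ℝ u y).smulRight (R y)) := by
        funext y
        have hu' : HasFDerivAt u (fderiv ℝ u y) y :=
          (hu.differentiable (by simp) y).hasFDerivAt
        have hR' : HasFDerivAt R (fderiv ℝ R y) y :=
          (hR.differentiable (by simp) y).hasFDerivAt
        have hd : HasFDerivAt (fun y => u y ^ (m + 1 + 1) • R y) _ y :=
          (hu'.pow (m + 1 + 1)).smul hR'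
        rw [hd.fderiv]
        ext v
        simp only [_root_.add_apply, _root_.smul_apply,
          ContinuousLinearMap.smulRight_apply]
        push_cast
        simp only [smul_eq_mul, nsmul_eq_mul]
        push_cast
        module
      rw [iteratedFDeriv_succ_eq_comp_right, Function.comp_apply, hd, ih _ k (by omega)]
      · exact LinearIsometryEquiv.map_zero _
      · have h1 : ContDiff ℝ ⊤ (fderiv ℝ u) := hu.fderiv_right (by simp)
        have h2 : ContDiff ℝ ⊤ (fderiv ℝ R) := hR.fderiv_right (by simp)
        exact (hu.smul h2).add ((h1.smulRight hR).const_smul _)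

/-- Gluing of smooth functions on finitely many closed sets. -/
theorem contDiffOn_of_closed_cover {E ι : Type} [NormedAddCommGroup E] [NormedSpace ℝ E]
    [Finite ι] {A : ι → Set E} (hA : ∀ i, IsClosed (A i)) {F : ι → E → ℝ} {r : ℕ}
    (hF : ∀ i, ContDiff ℝ r (F i)) {s : E → ℝ} (hs : ∀ i, ∀ x ∈ A i, s x = F i x)
    (h : ∀ i j, ∀ x ∈ A i, x ∈ A j → ∀ k ≤ r,
      iteratedFDeriv ℝ k (F i) x = iteratedFDeriv ℝ k (F j) x) :
    ContDiffOn ℝ r s (⋃ i, A i) := by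
  classical
  rcases isEmpty_or_nonempty ι with hι | hι
  · simp
  let φ : E → ι := fun x => Classical.epsilon fun i => x ∈ A i
  have hφ : ∀ i, ∀ x ∈ A i, x ∈ A (φ x) := fun i x hx =>
    Classical.epsilon_spec (p := fun i => x ∈ A i) ⟨i, hx⟩
  let p : E → FormalMultilinearSeries ℝ E ℝ := fun x => ftaylorSeries ℝ (F (φ x)) x
  have hp : ∀ i, ∀ x ∈ A i, ∀ k ≤ r, p x k = iteratedFDeriv ℝ k (F i) x := fun i x hx k hk =>
    h _ _ x (hφ i x hx) hx k hk
  have hT : HasFTaylorSeriesUpToOn r s p (⋃ i, A i) := by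
    constructor
    · intro x hx
      obtain ⟨i, hi⟩ := Set.mem_iUnion.mp hx
      rw [hp i x hi 0 (Nat.zero_le _), hs i x hi]
      simp [ContinuousMultilinearMap.curry0]
    · intro m hm x hx
      have hm' : m < r := by exact_mod_cast hm
      have key : ∀ i, HasFDerivWithinAt (p · m) (p x m.succ).curryLeft (A i) x := by
        intro i
        by_cases hi : x ∈ A i
        · have := (((hF i).ftaylorSeries).hasFTaylorSeriesUpToOn (A i)).fderivWithin m hm x hi
          rw [hp i x hi _ hm']
          exact this.congr (fun y hy => hp i y hy m hm'.le) (hp i x hi m hm'.le)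
        -- A closed piece that misses the point imposes no condition, so only the pieces through the
        -- point matter.
        · exact HasFDerivWithinAt.of_notMem_closure (by rwa [(hA i).closure_eq])
      have : ∀ S : Set ι, S.Finite →
          HasFDerivWithinAt (p · m) (p x m.succ).curryLeft (⋃ i ∈ S, A i) x := by
        intro S hS
        induction S, hS using Set.Finite.induction_on with
        | empty => simp
        | insert _ _ ih => rw [Set.biUnion_insert]; exact (key _).union ih
      simpa using this Set.univ Set.finite_univ
    · intro m hm
      have hm' : m ≤ r := by exact_mod_cast hm
      refine (locallyFinite_of_finite A).continuousOn_iUnion hA fun i => ?_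
      have : Continuous (iteratedFDeriv ℝ m (F i)) :=
        (hF i).continuous_iteratedFDeriv (by exact_mod_cast hm')
      exact this.continuousOn.congr fun x hx => hp i x hx m hm'
  exact hT.contDiffOn

/-! ### Sufficient conditions for C³ smoothness -/

/-- The vertices on the line through two vertices. -/
def lineSet (a b : Fin 10) : Finset (Fin 10) :=
  Finset.univ.filter fun j => detQ (bary j) (bary a) (bary b) = 0

theorem mem_lineSet {a b j : Fin 10} : j ∈ lineSet a b ↔ det (V j) (V a) (V b) = 0 := by
  rw [lineSet, Finset.mem_filter, det_V]
  simp

theorem isLine_lineSet {a b : Fin 10} : IsLine (V a) (V b) (lineSet a b) where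
  mem_iff j := mem_lineSet
  det_ne x y c hx hy hxy hc h := by
    obtain ⟨k, hk⟩ := exists_det_ne_zero hxy
    have := det_mul_det_of_mem (mem_lineSet.mp hx) (mem_lineSet.mp hy) (V c) (V k)
    rw [h, zero_mul, ← det_rot, mul_eq_zero] at this
    exact this.elim hk fun h => hc (mem_lineSet.mpr h)

/-- Pairs of vertices on the interior lines of the 12-split. -/
def mesh : Fin 6 → Fin 10 × Fin 10 := ![(0, 4), (1, 5), (2, 3), (3, 5), (3, 4), (4, 5)]

/-- The knots are among the corners and the midpoints of the edges. -/
def LowSupp (K : Knots) : Prop := ∀ j : Fin 10, 6 ≤ (j : ℕ) → K j = 0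

theorem LowSupp.mono {K K' : Knots} (h : LowSupp K) (hK : K' ≤ K) : LowSupp K' := fun j hj =>
  Nat.le_zero.mp (h j hj ▸ hK j)

theorem LowSupp.lt {K : Knots} (h : LowSupp K) {j : Fin 10} (hj : K j ≠ 0) : (j : ℕ) < 6 := by
  by_contra h'
  exact hj (h j (by omega))

theorem det_facePoint (hT : AffineIndependent ℝ T) (f : Fin 12) (i j : Fin 10) :
    det (co hT (facePoint T f)) (V i) (V j) = (detQ (faceCo f) (bary i) (bary j) : ℝ) := by
  rw [co_facePoint]; exact det_cast _ _ _

/-- No line through two corners or midpoints cuts the interior of a face. -/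
theorem face_sign : ∀ (f : Fin 12) (l : Fin 3) (i j : Fin 10), (i : ℕ) < 6 → (j : ℕ) < 6 →
    0 ≤ detQ (bary (faceVertex f l)) (bary i) (bary j) * detQ (faceCo f) (bary i) (bary j) := by
  decide +kernel

theorem mul_det_facePoint_nonneg (hT : AffineIndependent ℝ T) {f : Fin 12} {x : Plane}
    (hx : x ∈ closedFace T f) {i j : Fin 10} (hi : (i : ℕ) < 6) (hj : (j : ℕ) < 6) :
    0 ≤ det (co hT x) (V i) (V j) * det (co hT (facePoint T f)) (V i) (V j) := by
  rw [closedFace_eq_hull, mem_hull_iff hT] at hx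
  obtain ⟨β, h0, hβ⟩ := hx
  rw [det_sum_rot hβ, Finset.sum_mul]
  refine Finset.sum_nonneg fun l _ => ?_
  by_cases hl : β l = 0
  · simp [hl]
  have hl' : ∃ m : Fin 3, l = faceVertex f m := by
    have := knots3_ne_zero.mp fun h => hl (hβ.2 l h)
    rcases this with h | h | h
    exacts [⟨0, h⟩, ⟨1, h⟩, ⟨2, h⟩]
  obtain ⟨m, rfl⟩ := hl'
  rw [mul_assoc, det_facePoint, det_V]
  refine mul_nonneg (h0 _) ?_
  exact_mod_cast face_sign f m i j hi hj

/-- On a half-open face, the spline is given by the values on three knots at the face point. -/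
theorem simplexSplineRec_eq_face (hT : AffineIndependent ℝ T) {x : Plane} {f : Fin 12}
    (hf : x ∈ halfOpenFace T f) {n : ℕ} {K : Knots} (hK : ∑ j, K j = n + 3) (hlow : LowSupp K) :
    simplexSplineRec T n K x = spl (baseAt T (facePoint T f)) n K (co hT x) := by
  obtain ⟨ε, h1, hε⟩ := ((eventually_mem_halfOpenHull_iff hf).and
    (Ioo_mem_nhdsGT (show (0 : ℝ) < 1 by norm_num))).exists
  rw [simplexSplineRec_eq_spl hT h1]
  refine spl_congr n hK (fun K' hK' h3 => baseAt_congr hT h3 fun i j hi hj hij => ?_) _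
  have h2 := mul_det_facePoint_nonneg hT hf.1 ((hlow.mono hK').lt hi) ((hlow.mono hK').lt hj)
  have h4 := generic_facePoint hT f i j hij
  rw [det_lineMap, add_mul, mul_assoc, mul_assoc]
  have h5 := mul_self_pos.mpr h4
  have := hε.1
  have : 0 < 1 - ε := by linarith [hε.2]
  positivity

/-- The polynomial that represents the simplex spline on a face. -/
def facePoly (hT : AffineIndependent ℝ T) (K : Knots) (f : Fin 12) (x : Plane) : ℝ :=
  spl (baseAt T (facePoint T f)) 5 K (co hT x)

theorem isBase_facePoint (hT : AffineIndependent ℝ T) (f : Fin 12) :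
    IsBase (baseAt T (facePoint T f)) := isBase_baseAt hT (generic_facePoint hT f)

/-- The interior lines that carry two distinct knots carry at most three knots. -/
def LineCond (K : Knots) : Prop :=
  ∀ m, HasPair (fun a b => a ∈ lineSet (mesh m).1 (mesh m).2 ∧ b ∈ lineSet (mesh m).1 (mesh m).2
    ∧ a ≠ b) K → 5 ≤ off (lineSet (mesh m).1 (mesh m).2) K

/-- The side of an interior line on which a face lies. -/
def side (m : Fin 6) (f : Fin 12) : Bool :=
  decide (0 < detQ (faceCo f) (bary (mesh m).1) (bary (mesh m).2))

/-- Lines through two corners or midpoints are boundary edges, which separate no faces, or the six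
lines of `mesh`. Between such faces only triples with two knots on the line `m` can change their
value. -/
theorem adjacent_sign : ∀ (f g : Fin 12) (m : Fin 6), (∀ m', m' ≠ m → side m' f = side m' g) →
    ∀ i j : Fin 10, (i : ℕ) < 6 → (j : ℕ) < 6 → i ≠ j →
      0 < detQ (faceCo f) (bary i) (bary j) * detQ (faceCo g) (bary i) (bary j) ∨
      i ∈ lineSet (mesh m).1 (mesh m).2 ∧ j ∈ lineSet (mesh m).1 (mesh m).2 := by
  decide +kernel

/-- This permits walking from `f` to `g` across one line at a time, each of them separating `f` from
`g`. -/
theorem exists_adjacent : ∀ f g : Fin 12, f ≠ g → ∃ (h : Fin 12) (m : Fin 6),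
    (∀ m', m' ≠ m → side m' f = side m' h) ∧ side m f ≠ side m g ∧ side m h = side m g := by
  decide +kernel

/-- Five knots off the line give a jump divisible by the fourth power of its form, so derivatives
through order three agree there. With no two distinct knots on the line there is no jump. -/
theorem facePoly_adjacent (hT : AffineIndependent ℝ T) {K : Knots} (hK : ∑ j, K j = 8)
    (hlow : LowSupp K) (hc : LineCond K) {f g : Fin 12} {m : Fin 6}
    (hfg : ∀ m', m' ≠ m → side m' f = side m' g) : ∃ H : MvPolynomial (Fin 3) ℝ,
      ∀ x, facePoly hT K f x - facePoly hT K g x =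
        det (co hT x) (V (mesh m).1) (V (mesh m).2) ^ 4 * MvPolynomial.eval (co hT x) H := by
  have hne : ∀ m, (mesh m).1 ≠ (mesh m).2 := by decide
  have hb := (isBase_facePoint hT f).sub (isBase_facePoint hT g)
  obtain ⟨k, hk⟩ := exists_det_ne_zero (hne m)
  obtain ⟨H, h1, -, h2⟩ := exists_spl_eq_pow_mul (isLine_lineSet (a := (mesh m).1)
    (b := (mesh m).2)) ⟨_, hk⟩ (S := fun a b => a ∈ lineSet (mesh m).1 (mesh m).2 ∧
      b ∈ lineSet (mesh m).1 (mesh m).2 ∧ a ≠ b) (fun a b h => h) hb (K₀ := K) (p := 0)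
    (pos := False) (by
      intro K' hK' h3 hne'
      have hS : Spans K' := by
        by_contra hS
        exact hne' (hb.degenerate K' hS)
      obtain ⟨i, j, hi, hj, hij, hsgn⟩ : ∃ i j, K' i ≠ 0 ∧ K' j ≠ 0 ∧ i ≠ j ∧
          ¬ 0 < det (co hT (facePoint T f)) (V i) (V j)
            * det (co hT (facePoint T g)) (V i) (V j) := by
        by_contra! hall
        exact hne' (sub_eq_zero.mpr (baseAt_congr hT h3 hall))
      have hlow' := hlow.mono hK'
      obtain ⟨hiL, hjL⟩ := (adjacent_sign f g m hfg i j (hlow'.lt hi) (hlow'.lt hj)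
        hij).resolve_left fun h => hsgn (by rw [det_facePoint, det_facePoint]; exact_mod_cast h)
      refine ⟨?_, i, j, hi, hj, hiL, hjL, hij⟩
      have h0 : off (lineSet (mesh m).1 (mesh m).2) K' ≠ 0 := fun h =>
        isLine_lineSet.not_spans ⟨_, hk⟩ h hS
      have hj' : remove K' i j ≠ 0 := by rwa [remove_apply_of_ne hij.symm]
      have e1 := off_remove_of_mem (K := K') hiL
      have e2 := off_remove_of_mem (K := remove K' i) hjL
      have e3 := sum_remove hi
      have e4 := sum_remove hj'
      have e5 : off (lineSet (mesh m).1 (mesh m).2) (remove (remove K' i) j)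
        ≤ ∑ l, remove (remove K' i) j l := Finset.sum_le_sum_of_subset (Finset.subset_univ _)
      omega) False.elim False.elim False.elim 5 K le_rfl hK
  by_cases hP : HasPair (fun a b => a ∈ lineSet (mesh m).1 (mesh m).2 ∧
      b ∈ lineSet (mesh m).1 (mesh m).2 ∧ a ≠ b) K
  · have h5 := hc m hP
    refine ⟨detPoly (V (mesh m).1) (V (mesh m).2) ^
      (off (lineSet (mesh m).1 (mesh m).2) K - 1 - 4) * H, fun x => ?_⟩
    rw [facePoly, facePoly, ← spl_sub, h1, map_mul, map_pow, eval_detPoly, ← mul_assoc, ← pow_add]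
    congr 2
    omega
  · refine ⟨0, fun x => ?_⟩
    rw [facePoly, facePoly, ← spl_sub, h1, h2 hP]
    simp

theorem contDiff_facePoly (hT : AffineIndependent ℝ T) {K : Knots} (hK : ∑ j, K j = 8)
    (f : Fin 12) {r : WithTop ℕ∞} : ContDiff ℝ r (facePoly hT K f) :=
  contDiff_spl hT (isBase_facePoint hT f) hK

/-- The derivatives of the polynomials on two faces agree on the common part of the faces. -/
theorem iteratedFDeriv_facePoly_eq (hT : AffineIndependent ℝ T) {K : Knots} (hK : ∑ j, K j = 8)
    (hlow : LowSupp K) (hc : LineCond K) {x : Plane} {f g : Fin 12}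
    (h : ∀ m, side m f ≠ side m g → det (co hT x) (V (mesh m).1) (V (mesh m).2) = 0)
    {k : ℕ} (hk : k ≤ 3) :
    iteratedFDeriv ℝ k (facePoly hT K f) x = iteratedFDeriv ℝ k (facePoly hT K g) x := by
  induction hd : (Finset.univ.filter fun m => side m f ≠ side m g).card using
    Nat.strong_induction_on generalizing f with
  | _ d ih =>
    by_cases hfg : f = g
    · rw [hfg]
    -- Every line crossed on the walk separates `f` from `g` and hence contains `x`; the number of
    -- separating lines drops at each step.
    obtain ⟨e, m, h1, h2, h3⟩ := exists_adjacent f g hfg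
    have h4 : ∀ m', side m' e ≠ side m' g → side m' f ≠ side m' g := by
      intro m' hm'
      by_cases hmm : m' = m
      · exact absurd (hmm ▸ h3) hm'
      · rwa [h1 m' hmm]
    have hlt : (Finset.univ.filter fun m => side m e ≠ side m g).card < d := by
      rw [← hd]
      refine Finset.card_lt_card ⟨fun m' hm' => ?_, fun hsub => ?_⟩
      · simp only [Finset.mem_filter, Finset.mem_univ, true_and] at hm' ⊢
        exact h4 m' hm'
      · have : m ∈ Finset.univ.filter fun m => side m e ≠ side m g :=
          hsub (by simpa using h2)
        simp [h3] at this
    rw [← ih _ hlt (fun m' hm' => h m' (h4 m' hm')) rfl]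
    obtain ⟨H, hH⟩ := facePoly_adjacent hT hK hlow hc h1
    have heq : facePoly hT K f = facePoly hT K e + fun y =>
        det (co hT y) (V (mesh m).1) (V (mesh m).2) ^ (3 + 1) •
          MvPolynomial.eval (co hT y) H := by
      ext y
      rw [Pi.add_apply, smul_eq_mul, ← hH y, add_sub_cancel]
    have hR : ContDiff ℝ ⊤ fun y => MvPolynomial.eval (co hT y) H :=
      contDiff_eval (fun k => contDiff_co hT k) H
    have hu : ContDiff ℝ ⊤ fun y => det (co hT y) (V (mesh m).1) (V (mesh m).2) :=
      contDiff_det_co hT _ _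
    have hs : ContDiff ℝ ⊤ fun y => det (co hT y) (V (mesh m).1) (V (mesh m).2) ^ (3 + 1) •
        MvPolynomial.eval (co hT y) H := (hu.pow (3 + 1)).smul hR
    rw [heq, iteratedFDeriv_add_apply (contDiff_facePoly hT hK e).contDiffAt
      (hs.of_le le_top).contDiffAt,
      iteratedFDeriv_pow_smul_eq_zero hu (h m h2) 3 hR k hk, add_zero]

theorem det_mesh_eq_zero (hT : AffineIndependent ℝ T) {x : Plane} {f g : Fin 12}
    (hf : x ∈ closedFace T f) (hg : x ∈ closedFace T g) {m : Fin 6}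
    (h : side m f ≠ side m g) : det (co hT x) (V (mesh m).1) (V (mesh m).2) = 0 := by
  have hlt : ∀ m, ((mesh m).1 : ℕ) < 6 ∧ ((mesh m).2 : ℕ) < 6 := by decide
  have hne : ∀ m, (mesh m).1 ≠ (mesh m).2 := by decide
  have h1 := mul_det_facePoint_nonneg hT hf (hlt m).1 (hlt m).2
  have h2 := mul_det_facePoint_nonneg hT hg (hlt m).1 (hlt m).2
  have n1 := generic_facePoint hT f _ _ (hne m)
  have n2 := generic_facePoint hT g _ _ (hne m)
  have h3 : ¬ (0 < det (co hT (facePoint T f)) (V (mesh m).1) (V (mesh m).2) ↔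
      0 < det (co hT (facePoint T g)) (V (mesh m).1) (V (mesh m).2)) := by
    intro h'
    rw [det_facePoint, det_facePoint, Rat.cast_pos, Rat.cast_pos] at h'
    exact h (decide_eq_decide.mpr h')
  rcases n1.lt_or_gt with n1 | n1 <;> rcases n2.lt_or_gt with n2 | n2
  · exact absurd (iff_of_false n1.not_gt n2.not_gt) h3
  · exact le_antisymm (by nlinarith) (by nlinarith)
  · exact le_antisymm (by nlinarith) (by nlinarith)
  · exact absurd (iff_of_true n1 n2) h3

/-- The case of order zero of the gluing: the pieces agree on common points, so the assignment of
points to half-open faces has no influence. -/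
theorem simplexSpline_eq_facePoly (hT : AffineIndependent ℝ T) {K : Knots} (hK : ∑ j, K j = 8)
    (hlow : LowSupp K) (hc : LineCond K) {x : Plane} {f : Fin 12} (hf : x ∈ closedFace T f) :
    simplexSpline T K x = facePoly hT K f x := by
  obtain ⟨g, hg⟩ := exists_halfOpenFace ⟨f, hf⟩
  rw [simplexSpline, hK, simplexSplineRec_eq_face hT hg hK hlow, ← facePoly]
  have := iteratedFDeriv_facePoly_eq hT hK hlow hc
    (fun m hm => det_mesh_eq_zero hT hg.1 hf hm) (Nat.zero_le 3)
  simpa using congrArg (fun φ => φ 0) this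

theorem simplexSpline_mem_splineSpace (hT : AffineIndependent ℝ T) {K : Knots}
    (hK : ∑ j, K j = 8) (hlow : LowSupp K) (hc : LineCond K) :
    simplexSpline T K ∈ splineSpace T 3 5 := by
  constructor
  · have hcov : triangle T = ⋃ f, closedFace T f := by
      ext x
      rw [Set.mem_iUnion]
      exact ⟨exists_closedFace hT, fun ⟨f, hf⟩ => closedFace_subset_triangle hT f hf⟩
    rw [hcov]
    refine contDiffOn_of_closed_cover (F := facePoly hT K) (fun f => ?_)
      (fun f => contDiff_facePoly hT hK f)
      (fun f x hx => simplexSpline_eq_facePoly hT hK hlow hc hx)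
      fun f g x hf hg k hk => iteratedFDeriv_facePoly_eq hT hK hlow hc
        (fun m hm => det_mesh_eq_zero hT hf hg hm) hk
    rw [closedFace_eq_hull]
    exact (isCompact_hull T _).isClosed
  · intro f
    obtain ⟨p, h1, h2⟩ := exists_poly hT (isBase_facePoint hT f) 5 K hK
    exact ⟨p, h1, fun x hx => by
      rw [simplexSpline_eq_facePoly hT hK hlow hc hx, facePoly, h2]⟩

/-! ### Exact jumps along probes -/

/-- At a generic point, the values on three knots can be taken at the point itself. -/
theorem simplexSplineRec_eq_of_generic (hT : AffineIndependent ℝ T) {x : Plane}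
    (hx : Generic (co hT x)) {n : ℕ} {K : Knots} (hK : ∑ j, K j = n + 3) :
    simplexSplineRec T n K x = spl (baseAt T x) n K (co hT x) := by
  by_cases hx' : x ∈ triangle T
  swap
  · exact simplexSplineRec_eq_spl hT (fun K => iff_of_false
      (fun h => hx' (halfOpenHull_subset_triangle hT K h))
      (fun h => hx' (hull_subset_triangle hT K h))) n K
  obtain ⟨f, hf⟩ := exists_halfOpenFace (exists_closedFace hT hx')
  have hs : ∀ i j, i ≠ j → ∀ᶠ t : ℝ in 𝓝[>] 0,
      0 < det (co hT (AffineMap.lineMap x (facePoint T f) t)) (V i) (V j)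
        * det (co hT x) (V i) (V j) := by
    intro i j hij
    simp only [det_lineMap hT]
    generalize det (co hT (facePoint T f)) (V i) (V j) = c
    have h0 := hx i j hij
    have : ContinuousAt (fun t : ℝ => ((1 - t) * det (co hT x) (V i) (V j) + t * c)
      * det (co hT x) (V i) (V j)) 0 := by fun_prop
    exact (this.eventually (lt_mem_nhds (by simpa using mul_self_pos.mpr h0))).filter_mono
      nhdsWithin_le_nhds
  obtain ⟨ε, h1, h2⟩ := ((eventually_mem_halfOpenHull_iff hf).and
    (eventually_all.mpr fun i => eventually_all.mpr fun j => eventually_all.mpr (hs i j))).exists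
  rw [simplexSplineRec_eq_spl hT h1]
  exact spl_congr n hK (fun K' _ h3 => baseAt_congr hT h3 fun i j _ _ hij => h2 i j hij) _

theorem hull_mem_nhds (hT : AffineIndependent ℝ T) {i j k : Fin 10} {x : Plane}
    (h1 : 0 < det (co hT x) (V j) (V k) / det (V i) (V j) (V k))
    (h2 : 0 < det (co hT x) (V k) (V i) / det (V i) (V j) (V k))
    (h3 : 0 < det (co hT x) (V i) (V j) / det (V i) (V j) (V k)) :
    hull T (knots3 i j k) ∈ 𝓝 x := by
  have hd : det (V i) (V j) (V k) ≠ 0 := by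
    intro h; simp [h] at h1
  have hc : ∀ Y Z : Vec, ContinuousAt (fun x => det (co hT x) Y Z / det (V i) (V j) (V k)) x :=
    fun Y Z => ((contDiff_det_co hT (r := 0) Y Z).continuous.div_const _).continuousAt
  filter_upwards [(hc _ _).eventually (lt_mem_nhds h1), (hc _ _).eventually (lt_mem_nhds h2),
    (hc _ _).eventually (lt_mem_nhds h3)] with y k1 k2 k3
  exact (mem_hull_knots3 hT hd).mpr ⟨k1.le, k2.le, k3.le⟩

/-- A point between two vertices. -/
def probePt (a b : Fin 10) : Fin 3 → ℚ := fun k => (5 * bary a k + bary b k) / 6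

/-- Pairs of vertices on the line through `a, b`, on different sides of `probePt a b`. -/
@[reducible] def Opposite (a b c x y : Fin 10) : Prop :=
  x ∈ lineSet a b ∧ y ∈ lineSet a b ∧
    detQ (bary x) (probePt a b) (bary c) * detQ (bary y) (probePt a b) (bary c) < 0

/-- The only line through vertices that contains `probePt a b` is the one through `a` and `b`;
the vertex `c` is on the positive side of it. -/
@[reducible] def IsProbe (a b c : Fin 10) : Prop :=
  0 < detQ (bary c) (bary a) (bary b) ∧
  (∀ j ∈ lineSet a b, detQ (bary j) (probePt a b) (bary c) ≠ 0) ∧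
  ∀ i j, i ≠ j → (i ∈ lineSet a b ∧ j ∈ lineSet a b) ∨
    detQ (probePt a b) (bary i) (bary j) ≠ 0

/-- The line through `probePt a b` and the vertex `c`. -/
def probe (T : Fin 3 → Plane) (a b c : Fin 10) (t : ℝ) : Plane :=
  AffineMap.lineMap (∑ k, (probePt a b k : ℝ) • T k) (vertex T c) t

theorem probePt_sum (a b : Fin 10) :
    (probePt a b 0 : ℝ) + (probePt a b 1 : ℝ) + (probePt a b 2 : ℝ) = 1 := by
  have h1 := V_sum a
  have h2 := V_sum b
  simp only [V] at h1 h2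
  simp only [probePt]
  push_cast
  linarith

theorem co_probe (hT : AffineIndependent ℝ T) (a b c : Fin 10) (t : ℝ) :
    co hT (probe T a b c t) = (1 - t) • (fun k => (probePt a b k : ℝ)) + t • V c := by
  rw [probe, co_lineMap, co_vertex, co_sum_smul hT (X := fun k => (probePt a b k : ℝ))
    (probePt_sum a b)]

theorem det_co_probe (hT : AffineIndependent ℝ T) (a b c : Fin 10) (t : ℝ) (i j : Fin 10) :
    det (co hT (probe T a b c t)) (V i) (V j) =
      (1 - t) * (detQ (probePt a b) (bary i) (bary j) : ℝ) + t * det (V c) (V i) (V j) := by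
  rw [co_probe, det_add_left, det_smul_left, det_smul_left, ← det_cast]
  rfl

theorem det_probePt (a b i j : Fin 10) : det (fun k => (probePt a b k : ℝ)) (V i) (V j)
    = (detQ (probePt a b) (bary i) (bary j) : ℝ) := det_cast _ _ _

theorem probePt_eq (a b : Fin 10) :
    (fun k => (probePt a b k : ℝ)) = (5 / 6 : ℝ) • V a + (1 / 6 : ℝ) • V b := by
  ext k
  simp only [probePt, V, Pi.add_apply, Pi.smul_apply, smul_eq_mul]
  push_cast
  ring

theorem IsProbe.pos {a b c : Fin 10} (h : IsProbe a b c) : 0 < det (V c) (V a) (V b) := by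
  rw [det_V]; exact_mod_cast h.1

theorem det_eq_zero_of_mem {a b c i j k : Fin 10} (h : IsProbe a b c) (hi : i ∈ lineSet a b)
    (hj : j ∈ lineSet a b) (hk : k ∈ lineSet a b) : det (V i) (V j) (V k) = 0 := by
  have := det_mul_det_of_mem (mem_lineSet.mp hi) (mem_lineSet.mp hj) (V c) (V k)
  rw [mem_lineSet.mp hk, mul_zero, mul_eq_zero] at this
  exact this.resolve_right h.pos.ne'

theorem left_mem_lineSet (a b : Fin 10) : a ∈ lineSet a b := mem_lineSet.mpr (det_self_left _ _)
theorem right_mem_lineSet (a b : Fin 10) : b ∈ lineSet a b := mem_lineSet.mpr (det_self_outer _ _)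

theorem det_probePt_eq_zero {a b c i j : Fin 10} (h : IsProbe a b c) (hi : i ∈ lineSet a b)
    (hj : j ∈ lineSet a b) : det (fun k => (probePt a b k : ℝ)) (V i) (V j) = 0 := by
  rw [probePt_eq, det_add_left, det_smul_left, det_smul_left,
    det_eq_zero_of_mem h (left_mem_lineSet a b) hi hj,
    det_eq_zero_of_mem h (right_mem_lineSet a b) hi hj]
  ring

theorem IsProbe.notMem {a b c : Fin 10} (h : IsProbe a b c) : c ∉ lineSet a b := fun hc =>
  h.pos.ne' (mem_lineSet.mp hc)

/-- The coefficients are nonzero because the probe point is no vertex of the line. As they sum to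
one they are not both negative, so lying between `i` and `j` means that both are positive. -/
theorem probePt_eq_combination {a b c i j : Fin 10} (h : IsProbe a b c) (hi : i ∈ lineSet a b)
    (hj : j ∈ lineSet a b) (hij : i ≠ j) : ∃ α β : ℝ,
      (fun k => (probePt a b k : ℝ)) = α • V i + β • V j ∧ α * β ≠ 0 ∧
      (Opposite a b c i j ↔ 0 < α ∧ 0 < β) := by
  have hd := isLine_lineSet.det_ne i j c hi hj hij h.notMem
  set P : Vec := fun k => (probePt a b k : ℝ) with hP
  have h1 := det_cramer (V i) (V j) (V c) P
  have h0 : det (V i) (V j) P = 0 := by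
    rw [← det_rot P]; exact det_probePt_eq_zero h hi hj
  rw [h0, zero_smul, add_zero] at h1
  obtain ⟨α, hα⟩ : ∃ α, α = det P (V j) (V c) / det (V i) (V j) (V c) := ⟨_, rfl⟩
  obtain ⟨β, hβ⟩ : ∃ β, β = det (V i) P (V c) / det (V i) (V j) (V c) := ⟨_, rfl⟩
  have h2 : P = α • V i + β • V j := by
    rw [← smul_right_inj hd, h1, smul_add, smul_smul, smul_smul, hα, hβ, mul_div_cancel₀ _ hd,
      mul_div_cancel₀ _ hd]
  have hsum : α + β = 1 := by
    have e := probePt_sum a b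
    have e0 := congrFun h2 0
    have e1 := congrFun h2 1
    have e2 := congrFun h2 2
    simp only [hP, Pi.add_apply, Pi.smul_apply, smul_eq_mul] at e0 e1 e2
    have s1 := V_sum i
    have s2 := V_sum j
    linear_combination -e0 - e1 - e2 + e - α * s1 - β * s2
  have mi : (detQ (bary i) (probePt a b) (bary c) : ℝ) = β * det (V i) (V j) (V c) := by
    rw [← det_cast, hβ, div_mul_cancel₀ _ hd]; rfl
  have mj : (detQ (bary j) (probePt a b) (bary c) : ℝ) = - (α * det (V i) (V j) (V c)) := by
    rw [← det_cast, hα, div_mul_cancel₀ _ hd]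
    change det (V j) P (V c) = _
    simp only [det]; ring
  have ni : (detQ (bary i) (probePt a b) (bary c) : ℝ) ≠ 0 := by
    exact_mod_cast h.2.1 i hi
  have nj : (detQ (bary j) (probePt a b) (bary c) : ℝ) ≠ 0 := by
    exact_mod_cast h.2.1 j hj
  have hne : α * β ≠ 0 := by
    rw [mi] at ni
    rw [mj] at nj
    exact mul_ne_zero (fun h => nj (by rw [h]; ring)) (fun h => ni (by rw [h]; ring))
  refine ⟨α, β, h2, hne, ?_⟩
  have hopp : Opposite a b c i j ↔ 0 < α * β := by
    rw [Opposite, and_iff_right hi, and_iff_right hj, ← Rat.cast_lt (K := ℝ), Rat.cast_mul, mi, mj,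
      Rat.cast_zero]
    have hsq := mul_self_pos.mpr hd
    constructor
    · intro h
      by_contra h'
      nlinarith
    · intro h
      nlinarith
  rw [hopp]
  constructor
  · intro h
    rcases pos_and_pos_or_neg_and_neg_of_mul_pos h with h | h
    · exact h
    · linarith
  · rintro ⟨h1, h2⟩
    positivity

theorem eq_knots3_of_ne {K : Knots} (h : ∑ j, K j = 3) {i j : Fin 10} (hi : K i ≠ 0)
    (hj : K j ≠ 0) (hij : i ≠ j) : ∃ k, K = knots3 i j k := by
  have h1 : remove K j i ≠ 0 := by rwa [remove_apply_of_ne hij]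
  obtain ⟨k, hk⟩ := eq_single_of_sum (K := remove (remove K j) i)
    (by have := sum_remove hj; have := sum_remove h1; omega)
  refine ⟨k, ?_⟩
  rw [← remove_add_single hj, ← remove_add_single h1, hk, knots3]
  abel

theorem off_knots3 (L : Finset (Fin 10)) (i j k : Fin 10) : off L (knots3 i j k) =
    (if i ∈ L then 0 else 1) + (if j ∈ L then 0 else 1) + (if k ∈ L then 0 else 1) := by
  simp [off, knots3, Finset.sum_add_distrib]

theorem offProd_knots3 {Y Z : Vec} {L : Finset (Fin 10)} {i j k : Fin 10} (hi : i ∈ L)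
    (hj : j ∈ L) (hk : k ∉ L) : offProd Y Z L (knots3 i j k) = det (V k) Y Z := by
  have hki : k ≠ i := by rintro rfl; exact hk hi
  have hkj : k ≠ j := by rintro rfl; exact hk hj
  rw [offProd, Finset.prod_eq_single k]
  · simp [knots3, hki, hkj]
  · intro l hl hlk
    have hl' := Finset.mem_compl.mp hl
    rw [knots3_eq_zero (by rintro rfl; exact hl' hi) (by rintro rfl; exact hl' hj) hlk, pow_zero]
  · intro h
    exact absurd (Finset.mem_compl.mpr hk) h

theorem exists_lineEval {m : ℕ} (q : MvPolynomial (Fin m) ℝ) (u v : Fin m → ℝ) :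
    ∃ P : Polynomial ℝ, ∀ t, P.eval t = MvPolynomial.eval (fun k => (1 - t) * u k + t * v k) q := by
  induction q using MvPolynomial.induction_on with
  | C a => exact ⟨Polynomial.C a, fun t => by simp⟩
  | add p q hp hq =>
    obtain ⟨P, hP⟩ := hp
    obtain ⟨Q, hQ⟩ := hq
    exact ⟨P + Q, fun t => by simp [hP, hQ]⟩
  | mul_X p i hp =>
    obtain ⟨P, hP⟩ := hp
    refine ⟨P * (Polynomial.C (u i) + Polynomial.X * Polynomial.C (v i - u i)), fun t => ?_⟩
    simp [hP]
    left; ring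

/-- The signs at the points of a probe near to the line. -/
theorem exists_probe_sign (hT : AffineIndependent ℝ T) {a b c : Fin 10} (h : IsProbe a b c) :
    ∃ δ > 0, ∀ i j, i ≠ j → ∀ t, |t| < δ →
      (i ∈ lineSet a b ∧ j ∈ lineSet a b ∧ det (V c) (V i) (V j) ≠ 0 ∧
        det (co hT (probe T a b c t)) (V i) (V j) = t * det (V c) (V i) (V j)) ∨
      (¬ (i ∈ lineSet a b ∧ j ∈ lineSet a b) ∧ 0 < det (co hT (probe T a b c t)) (V i) (V j)
        * det (fun k => (probePt a b k : ℝ)) (V i) (V j)) := by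
  have hev : ∀ i j, i ≠ j → ¬ (i ∈ lineSet a b ∧ j ∈ lineSet a b) → ∀ᶠ t : ℝ in 𝓝 0,
      0 < det (co hT (probe T a b c t)) (V i) (V j)
        * det (fun k => (probePt a b k : ℝ)) (V i) (V j) := by
    intro i j hij hL
    simp only [det_co_probe hT, det_probePt]
    have h0 : (detQ (probePt a b) (bary i) (bary j) : ℝ) ≠ 0 := by
      exact_mod_cast (h.2.2 i j hij).resolve_left hL
    generalize det (V c) (V i) (V j) = d
    have : ContinuousAt (fun t : ℝ => ((1 - t) * (detQ (probePt a b) (bary i) (bary j) : ℝ)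
      + t * d) * (detQ (probePt a b) (bary i) (bary j) : ℝ)) 0 := by fun_prop
    exact this.eventually (lt_mem_nhds (by simpa using mul_self_pos.mpr h0))
  have hall := eventually_all.mpr fun i => eventually_all.mpr fun j => eventually_all.mpr fun hij =>
    eventually_all.mpr (hev i j hij)
  obtain ⟨δ, hδ, hball⟩ := Metric.eventually_nhds_iff.mp hall
  refine ⟨δ, hδ, fun i j hij t ht => ?_⟩
  by_cases hL : i ∈ lineSet a b ∧ j ∈ lineSet a b
  · refine .inl ⟨hL.1, hL.2, ?_, ?_⟩
    · rw [det_rot]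
      exact isLine_lineSet.det_ne i j c hL.1 hL.2 hij h.notMem
    · rw [det_co_probe, ← det_probePt, det_probePt_eq_zero h hL.1 hL.2]
      ring
  · exact .inr ⟨hL, hball (by simpa using ht) i j hij hL⟩

/-- Only the side `e` of the triangle is crossed, so the point is inside on exactly one of the two
sides, and the difference of the two values is the sign of `e`. -/
theorem wind_sub_wind {e x y x' y' z s : ℝ} (he : e ≠ 0) (hs : 0 < s) (hx : 0 < x * z)
    (hy : 0 < y * z) (hx' : 0 < x' * z) (hy' : 0 < y' * z) :
    0 < (wind (s * e) x y - wind (-s * e) x' y') * e := by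
  have hz : z ≠ 0 := by rintro rfl; simp at hx
  rcases hz.lt_or_gt with hz | hz <;> rcases he.lt_or_gt with he | he
  · have h1 : x < 0 := by nlinarith
    have h2 : y < 0 := by nlinarith
    have h3 : x' < 0 := by nlinarith
    have h4 : y' < 0 := by nlinarith
    have h5 : s * e < 0 := by nlinarith
    have h6 : 0 < -s * e := by nlinarith
    simp only [wind, h1, h2, h3.not_gt, h5, h5.not_gt, h6.not_gt]
    simpa using he
  · have h1 : x < 0 := by nlinarith
    have h2 : y < 0 := by nlinarith
    have h3 : x' < 0 := by nlinarith
    have h4 : y' < 0 := by nlinarith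
    have h5 : 0 < s * e := by nlinarith
    have h6 : -s * e < 0 := by nlinarith
    simp only [wind, h3, h4, h5.not_gt, h6, h6.not_gt, h1.not_gt]
    simpa using he
  · have h1 : 0 < x := by nlinarith
    have h2 : 0 < y := by nlinarith
    have h3 : 0 < x' := by nlinarith
    have h4 : 0 < y' := by nlinarith
    have h5 : s * e < 0 := by nlinarith
    have h6 : 0 < -s * e := by nlinarith
    simp only [wind, h3, h4, h5.not_gt, h6, h6.not_gt, h1.not_gt]
    simpa using he
  · have h1 : 0 < x := by nlinarith
    have h2 : 0 < y := by nlinarith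
    have h3 : 0 < x' := by nlinarith
    have h4 : 0 < y' := by nlinarith
    have h5 : 0 < s * e := by nlinarith
    have h6 : -s * e < 0 := by nlinarith
    simp only [wind, h1, h2, h5, h6.not_gt, h3.not_gt]
    simpa using he

theorem wind_eq_zero_of_mul_neg {e x y : ℝ} (h : x * y < 0) : wind e x y = 0 := by
  unfold wind
  rw [if_neg (by rintro ⟨-, h1, h2⟩; nlinarith), if_neg (by rintro ⟨-, h1, h2⟩; nlinarith)]

/-- The jump, across the line of a probe, of the values on three knots. -/
theorem baseAt_jump (hT : AffineIndependent ℝ T) {a b c : Fin 10} (h : IsProbe a b c) {s : ℝ}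
    (hs : 0 < s) (hgen : ∀ t, |t| = s → ∀ i j, i ≠ j →
      (i ∈ lineSet a b ∧ j ∈ lineSet a b ∧ det (V c) (V i) (V j) ≠ 0 ∧
        det (co hT (probe T a b c t)) (V i) (V j) = t * det (V c) (V i) (V j)) ∨
      (¬ (i ∈ lineSet a b ∧ j ∈ lineSet a b) ∧ 0 < det (co hT (probe T a b c t)) (V i) (V j)
        * det (fun k => (probePt a b k : ℝ)) (V i) (V j)))
    {i j k : Fin 10} (hi : i ∈ lineSet a b) (hj : j ∈ lineSet a b) (hij : i ≠ j)
    (hk : k ∉ lineSet a b) :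
    (Opposite a b c i j → 0 < (baseAt T (probe T a b c s) (knots3 i j k)
      - baseAt T (probe T a b c (-s)) (knots3 i j k)) * det (V k) (V a) (V b)) ∧
    (¬ Opposite a b c i j → baseAt T (probe T a b c s) (knots3 i j k)
      - baseAt T (probe T a b c (-s)) (knots3 i j k) = 0) := by
  have hd := isLine_lineSet.det_ne i j k hi hj hij hk
  have hjk : j ≠ k := by rintro rfl; exact hk hj
  have hki : k ≠ i := by rintro rfl; exact hk hi
  have a1 : |s| = s := abs_of_pos hs
  have a2 : |-s| = s := by rw [abs_neg, a1]
  obtain ⟨-, -, he, p1⟩ := (hgen s a1 i j hij).resolve_right fun h => h.1 ⟨hi, hj⟩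
  obtain ⟨-, -, -, m1⟩ := (hgen (-s) a2 i j hij).resolve_right fun h => h.1 ⟨hi, hj⟩
  obtain ⟨-, p2⟩ := (hgen s a1 j k hjk).resolve_left fun h => hk h.2.1
  obtain ⟨-, m2⟩ := (hgen (-s) a2 j k hjk).resolve_left fun h => hk h.2.1
  obtain ⟨-, p3⟩ := (hgen s a1 k i hki).resolve_left fun h => hk h.1
  obtain ⟨-, m3⟩ := (hgen (-s) a2 k i hki).resolve_left fun h => hk h.1
  have n1 := det_mul_baseAt hT (y := probe T a b c s) hd
    (by rw [p1]; exact mul_ne_zero hs.ne' he) (left_ne_zero_of_mul p2.ne')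
    (left_ne_zero_of_mul p3.ne')
  have n2 := det_mul_baseAt hT (y := probe T a b c (-s)) hd
    (by rw [m1]; exact mul_ne_zero (neg_ne_zero.mpr hs.ne') he) (left_ne_zero_of_mul m2.ne')
    (left_ne_zero_of_mul m3.ne')
  rw [p1] at n1
  rw [m1] at n2
  obtain ⟨α, β, hP, hαβ, hopp⟩ := probePt_eq_combination h hi hj hij
  have q2 : det (fun k => (probePt a b k : ℝ)) (V j) (V k) = α * det (V i) (V j) (V k) := by
    rw [hP, det_add_left, det_smul_left, det_smul_left, det_self_left]; ring
  have q3 : det (fun k => (probePt a b k : ℝ)) (V k) (V i) = β * det (V i) (V j) (V k) := by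
    rw [hP, det_add_left, det_smul_left, det_smul_left, det_self_outer,
      ← det_rot (V i) (V j) (V k)]; ring
  rw [q2] at p2 m2
  rw [q3] at p3 m3
  set D := det (V i) (V j) (V k) with hD
  constructor
  · intro ho
    obtain ⟨h1, h2⟩ := hopp.mp ho
    have aux : ∀ {u γ : ℝ}, 0 < γ → 0 < u * (γ * D) → 0 < u * D := fun {u γ} hγ h => by
      rw [show u * (γ * D) = γ * (u * D) by ring] at h
      exact (mul_pos_iff_of_pos_left hγ).mp h
    have hw := wind_sub_wind he hs (aux h1 p2) (aux h2 p3) (aux h1 m2) (aux h2 m3)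
    rw [← n1, ← n2, ← mul_sub] at hw
    -- This replaces the orientation of the pair `i, j` by that of `a, b`, so the sign of the jump
    -- depends only on the side of `k`.
    have hℓ : D * det (V c) (V a) (V b) = det (V c) (V i) (V j) * det (V k) (V a) (V b) := by
      rw [hD, det_mul_det_of_mem (mem_lineSet.mp hi) (mem_lineSet.mp hj), det_rot (V c)]
    have hc := h.pos
    have hsq := mul_self_pos.mpr he
    have e1 : (baseAt T (probe T a b c s) (knots3 i j k)
        - baseAt T (probe T a b c (-s)) (knots3 i j k)) * det (V k) (V a) (V b)
        * (det (V c) (V i) (V j) * det (V c) (V i) (V j)) =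
        D * (baseAt T (probe T a b c s) (knots3 i j k)
        - baseAt T (probe T a b c (-s)) (knots3 i j k)) * det (V c) (V i) (V j)
        * det (V c) (V a) (V b) := by
      linear_combination (- (baseAt T (probe T a b c s) (knots3 i j k)
        - baseAt T (probe T a b c (-s)) (knots3 i j k)) * det (V c) (V i) (V j)) * hℓ
    refine (mul_pos_iff_of_pos_right hsq).mp ?_
    rw [e1]
    exact mul_pos hw hc
  · intro ho
    -- The probe point is on the line but outside the segment from `i` to `j`, hence outside the
    -- triangle on both sides.
    have hneg : α * β < 0 := by
      refine lt_of_le_of_ne (not_lt.mp fun h' => ?_) hαβ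
      have hsum : α + β = 1 := by
        have e := probePt_sum a b
        have e0 := congrFun hP 0
        have e1 := congrFun hP 1
        have e2 := congrFun hP 2
        simp only [Pi.add_apply, Pi.smul_apply, smul_eq_mul] at e0 e1 e2
        have s1 := V_sum i
        have s2 := V_sum j
        linear_combination -e0 - e1 - e2 + e - α * s1 - β * s2
      rcases pos_and_pos_or_neg_and_neg_of_mul_pos h' with h' | h'
      · exact ho (hopp.mpr h')
      · linarith
    have hsq := mul_self_pos.mpr hd
    have aux : ∀ {u v : ℝ}, 0 < u * (α * D) → 0 < v * (β * D) → u * v < 0 := fun {u v} hu hv => by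
      by_contra h'
      have := mul_pos hu hv
      rw [show u * (α * D) * (v * (β * D)) = (α * β) * ((u * v) * (D * D)) by ring] at this
      nlinarith [mul_nonneg (not_lt.mp h') hsq.le]
    rw [wind_eq_zero_of_mul_neg (aux p2 p3), mul_eq_zero] at n1
    rw [wind_eq_zero_of_mul_neg (aux m2 m3), mul_eq_zero] at n2
    rw [n1.resolve_left hd, n2.resolve_left hd, sub_zero]

/-- The restriction of a simplex spline to a probe is a polynomial on each side of the line; the
number of knots off the line determines the smoothness of the transition. -/
theorem exists_probe_jump (hT : AffineIndependent ℝ T) {a b c : Fin 10} (h : IsProbe a b c)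
    {K : Knots} (hK : ∑ j, K j = 8) (hS : Spans K) :
    ∃ δ > 0, ∃ P M R : Polynomial ℝ,
      (∀ t ∈ Set.Ioo 0 δ, simplexSpline T K (probe T a b c t) = P.eval t) ∧
      (∀ t ∈ Set.Ioo (-δ) 0, simplexSpline T K (probe T a b c t) = M.eval t) ∧
      P - M = Polynomial.X ^ (off (lineSet a b) K - 1) * R ∧
      (HasPair (Opposite a b c) K → R.eval 0 ≠ 0) ∧
      (¬ HasPair (Opposite a b c) K → R = 0) := by
  obtain ⟨δ, hδ, hsgn⟩ := exists_probe_sign hT h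
  have hgen : ∀ t, |t| < δ → t ≠ 0 → Generic (co hT (probe T a b c t)) := by
    intro t ht h0 i j hij
    rcases hsgn i j hij t ht with ⟨-, -, h1, h2⟩ | ⟨-, h2⟩
    · rw [h2]; exact mul_ne_zero h0 h1
    · exact left_ne_zero_of_mul h2.ne'
  have hcongr : ∀ t t', |t| < δ → |t'| < δ → 0 < t * t' → ∀ K', ∑ j, K' j = 3 →
      baseAt T (probe T a b c t) K' = baseAt T (probe T a b c t') K' := by
    intro t t' ht ht' htt K' hK'
    refine baseAt_congr hT hK' fun i j _ _ hij => ?_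
    rcases hsgn i j hij t ht with ⟨h1, h2, h3, h4⟩ | ⟨h1, h2⟩
    · rcases hsgn i j hij t' ht' with ⟨-, -, -, k4⟩ | ⟨k1, -⟩
      · rw [h4, k4]
        have := mul_self_pos.mpr h3
        nlinarith [mul_pos htt this]
      · exact absurd ⟨h1, h2⟩ k1
    · rcases hsgn i j hij t' ht' with ⟨k1, k2, -, -⟩ | ⟨-, k2⟩
      · exact absurd ⟨k1, k2⟩ h1
      · have := mul_pos h2 k2
        generalize det (co hT (probe T a b c t)) (V i) (V j) = u at *
        generalize det (co hT (probe T a b c t')) (V i) (V j) = v at *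
        generalize det (fun k => (probePt a b k : ℝ)) (V i) (V j) = w at *
        rw [show u * w * (v * w) = (u * v) * (w * w) by ring] at this
        exact lt_of_mul_lt_mul_right (by rwa [zero_mul]) (mul_self_nonneg w)
  have hs : 0 < δ / 2 := by positivity
  have a1 : |δ / 2| < δ := by rw [abs_of_pos hs]; linarith
  have a2 : |-(δ / 2)| < δ := by rwa [abs_neg]
  set yp := probe T a b c (δ / 2) with hyp
  set ym := probe T a b c (-(δ / 2)) with hym
  have hbp : IsBase (baseAt T yp) := isBase_baseAt hT (hgen _ a1 hs.ne')
  have hbm : IsBase (baseAt T ym) := isBase_baseAt hT (hgen _ a2 (neg_ne_zero.mpr hs.ne'))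
  have hpoly : ∀ {β : Knots → ℝ}, IsBase β → ∃ P : Polynomial ℝ, ∀ t,
      P.eval t = spl β 5 K (co hT (probe T a b c t)) := by
    intro β hβ
    obtain ⟨q, -, hq⟩ := exists_poly hT hβ 5 K hK
    obtain ⟨P, hP⟩ := exists_lineEval q (fun i => (∑ k, (probePt a b k : ℝ) • T k : Plane) i)
      (fun i => vertex T c i)
    refine ⟨P, fun t => ?_⟩
    rw [hP, hq]
    congr 1
    congr 1
    ext i
    simp [probe, AffineMap.lineMap_apply_module]
  obtain ⟨P, hP⟩ := hpoly hbp
  obtain ⟨M, hM⟩ := hpoly hbm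
  have hjump := fun {i j k : Fin 10} (hi : i ∈ lineSet a b) (hj : j ∈ lineSet a b) (hij : i ≠ j)
      (hk : k ∉ lineSet a b) => baseAt_jump hT h hs (fun t ht i j hij => hsgn i j hij t
        (by rw [ht]; linarith)) hi hj hij hk
  obtain ⟨H, H1, H2, H3⟩ := exists_spl_eq_pow_mul (isLine_lineSet (a := a) (b := b))
    ⟨_, h.pos.ne'⟩ (S := Opposite a b c) (fun x y hxy => ⟨hxy.1, hxy.2.1, by
      rintro rfl
      exact absurd hxy.2.2 (not_lt.mpr (mul_self_nonneg _))⟩) (hbp.sub hbm) (K₀ := K)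
    (p := fun k => (probePt a b k : ℝ)) (pos := True) (by
      intro K' hK' h3 hne
      have hS' : Spans K' := by
        by_contra hS'
        exact hne ((hbp.sub hbm).degenerate K' hS')
      obtain ⟨i, j, hi, hj, hij, hsg⟩ : ∃ i j, K' i ≠ 0 ∧ K' j ≠ 0 ∧ i ≠ j ∧
          ¬ 0 < det (co hT yp) (V i) (V j) * det (co hT ym) (V i) (V j) := by
        by_contra! hall
        exact hne (sub_eq_zero.mpr (baseAt_congr hT h3 hall))
      have hL : i ∈ lineSet a b ∧ j ∈ lineSet a b := by
        by_contra hL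
        obtain ⟨-, k1⟩ := (hsgn i j hij _ a1).resolve_left fun h => hL ⟨h.1, h.2.1⟩
        obtain ⟨-, k2⟩ := (hsgn i j hij _ a2).resolve_left fun h => hL ⟨h.1, h.2.1⟩
        have := mul_pos k1 k2
        rw [← hyp, ← hym] at this
        generalize det (co hT yp) (V i) (V j) = u at *
        generalize det (co hT ym) (V i) (V j) = v at *
        generalize det (fun k => (probePt a b k : ℝ)) (V i) (V j) = w at *
        rw [show u * w * (v * w) = (u * v) * (w * w) by ring] at this
        exact hsg (lt_of_mul_lt_mul_right (by rwa [zero_mul]) (mul_self_nonneg w))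
      obtain ⟨k, rfl⟩ := eq_knots3_of_ne h3 hi hj hij
      have hk : k ∉ lineSet a b := fun hk =>
        isLine_lineSet.not_spans ⟨_, h.pos.ne'⟩ (by simp [off_knots3, hL, hk]) hS'
      refine ⟨by simp [off_knots3, hL, hk], i, j, hi, hj, ?_⟩
      by_contra ho
      exact hne ((hjump hL.1 hL.2 hij hk).2 ho)) (by
      intro _ x y hxy
      have hne : x ≠ y := by
        rintro rfl
        exact absurd hxy.2.2 (not_lt.mpr (mul_self_nonneg _))
      obtain ⟨α, β, h1, -, h2⟩ := probePt_eq_combination h hxy.1 hxy.2.1 hne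
      exact ⟨α, β, (h2.mp hxy).1, (h2.mp hxy).2, h1⟩) (by
      intro _ x y e hxy he
      have h1 := h.2.1 e he
      by_contra! hcon
      have h2 : ¬ _ < (0 : ℚ) := fun h' => hcon.1 ⟨he, hxy.2.1, h'⟩
      have h3 : ¬ _ < (0 : ℚ) := fun h' => hcon.2 ⟨hxy.1, he, h'⟩
      have h4 := hxy.2.2
      rw [not_lt] at h2 h3
      have h5 := mul_nonneg h2 h3
      have h6 := mul_self_pos.mpr h1
      nlinarith [mul_neg_of_neg_of_pos h4 h6]) (by
      rintro _ K' h3 hoff ⟨i, j, hi, hj, hij⟩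
      have hne : i ≠ j := by
        rintro rfl
        exact absurd hij.2.2 (not_lt.mpr (mul_self_nonneg _))
      obtain ⟨k, rfl⟩ := eq_knots3_of_ne h3 hi hj hne
      have hk : k ∉ lineSet a b := fun hk => by
        simp [off_knots3, hij.1, hij.2.1, hk] at hoff
      rw [offProd_knots3 hij.1 hij.2.1 hk]
      exact (hjump hij.1 hij.2.1 hne hk).1 hij) 5 K le_rfl hK
  obtain ⟨R, hR⟩ := exists_lineEval H (fun k => (probePt a b k : ℝ)) (V c)
  have hco : ∀ t, (fun k => (1 - t) * (probePt a b k : ℝ) + t * V c k)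
      = co hT (probe T a b c t) := fun t => by
    rw [co_probe]; rfl
  have hℓ : ∀ t, det (co hT (probe T a b c t)) (V a) (V b) = t * det (V c) (V a) (V b) := by
    intro t
    rw [co_probe, det_add_left, det_smul_left, det_smul_left,
      det_probePt_eq_zero h (left_mem_lineSet a b) (right_mem_lineSet a b)]
    ring
  -- Along the probe the form of the line is `t` times its value at `c`, which accounts for the
  -- constant factor.
  refine ⟨δ, hδ, P, M, Polynomial.C (det (V c) (V a) (V b) ^ (off (lineSet a b) K - 1)) * R,
    fun t ht => ?_, fun t ht => ?_, ?_, fun hp => ?_, fun hp => ?_⟩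
  · have ht' : |t| < δ := by rw [abs_of_pos ht.1]; exact ht.2
    rw [simplexSpline, hK, simplexSplineRec_eq_of_generic hT (hgen t ht' ht.1.ne') hK, hP]
    exact spl_congr 5 hK (fun K' _ h3 => hcongr t _ ht' a1 (mul_pos ht.1 hs) K' h3) _
  · have ht' : |t| < δ := by rw [abs_of_neg ht.2]; linarith [ht.1]
    rw [simplexSpline, hK, simplexSplineRec_eq_of_generic hT (hgen t ht' ht.2.ne) hK, hM]
    exact spl_congr 5 hK (fun K' _ h3 => hcongr t _ ht' a2
      (mul_pos_of_neg_of_neg ht.2 (by linarith)) K' h3) _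
  · apply Polynomial.funext
    intro t
    rw [Polynomial.eval_sub, hP, hM, ← spl_sub, H1, hℓ, mul_pow, ← hco, ← hR]
    simp
    ring
  · have hoff : off (lineSet a b) K ≠ 0 := fun h0 =>
      isLine_lineSet.not_spans ⟨_, h.pos.ne'⟩ h0 hS
    have h2 := left_ne_zero_of_mul (H2 trivial hoff hp).ne'
    rw [Polynomial.eval_mul, Polynomial.eval_C, hR]
    refine mul_ne_zero (pow_ne_zero _ h.pos.ne') ?_
    simpa using h2
  · have hR0 : R = 0 := by
      apply Polynomial.funext
      intro t
      rw [hR, H3 hp]; simp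
    rw [hR0, mul_zero]

/-! ### Necessary conditions from smoothness -/

theorem eval_iterate_derivative_eq {N : ℕ} : ∀ {g : ℝ → ℝ}, ContDiffAt ℝ N g 0 →
    ∀ {δ : ℝ}, 0 < δ → ∀ {P M : Polynomial ℝ}, (∀ t ∈ Set.Ioo 0 δ, g t = P.eval t) →
    (∀ t ∈ Set.Ioo (-δ) 0, g t = M.eval t) → ∀ k ≤ N,
    (Polynomial.derivative^[k] P).eval 0 = (Polynomial.derivative^[k] M).eval 0 := by
  have base : ∀ {g : ℝ → ℝ}, ContinuousAt g 0 → ∀ {δ : ℝ}, 0 < δ → ∀ {P M : Polynomial ℝ},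
      (∀ t ∈ Set.Ioo 0 δ, g t = P.eval t) → (∀ t ∈ Set.Ioo (-δ) 0, g t = M.eval t) →
      P.eval 0 = M.eval 0 := by
    intro g hg δ hδ P M hP hM
    have h1 : g 0 = P.eval 0 := by
      refine tendsto_nhds_unique (hg.mono_left (nhdsWithin_le_nhds (s := Set.Ioi 0)))
        ((P.continuous.continuousAt.mono_left nhdsWithin_le_nhds).congr' ?_)
      filter_upwards [Ioo_mem_nhdsGT hδ] with t ht using (hP t ht).symm
    have h2 : g 0 = M.eval 0 := by
      refine tendsto_nhds_unique (hg.mono_left (nhdsWithin_le_nhds (s := Set.Iio 0)))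
        ((M.continuous.continuousAt.mono_left nhdsWithin_le_nhds).congr' ?_)
      filter_upwards [Ioo_mem_nhdsLT (show -δ < 0 by linarith)] with t ht using (hM t ht).symm
    rw [← h1, h2]
  induction N with
  | zero =>
    intro g hg δ hδ P M hP hM k hk
    obtain rfl : k = 0 := by omega
    exact base hg.continuousAt hδ hP hM
  | succ N ih =>
    intro g hg δ hδ P M hP hM k hk
    cases k with
    | zero => exact base hg.continuousAt hδ hP hM
    | succ k =>
      rw [Function.iterate_succ_apply, Function.iterate_succ_apply]
      have hd : ContDiffAt ℝ N (deriv g) 0 := by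
        have := hg.fderiv_right (m := N) (by norm_cast)
        exact (this.clm_apply (contDiffAt_const (c := (1 : ℝ))))
      refine ih hd hδ (fun t ht => ?_) (fun t ht => ?_) k (by omega)
      · rw [Filter.EventuallyEq.deriv_eq (f := fun t => P.eval t), P.deriv]
        filter_upwards [Ioo_mem_nhds ht.1 ht.2] with s hs using hP s hs
      · rw [Filter.EventuallyEq.deriv_eq (f := fun t => M.eval t), M.deriv]
        filter_upwards [Ioo_mem_nhds ht.1 ht.2] with s hs using hM s hs

/-- A lower bound for the order of the jump of a smooth function. -/
theorem lt_of_contDiffAt {N : ℕ} {g : ℝ → ℝ} (hg : ContDiffAt ℝ N g 0) {δ : ℝ} (hδ : 0 < δ)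
    {P M R : Polynomial ℝ} (hP : ∀ t ∈ Set.Ioo 0 δ, g t = P.eval t)
    (hM : ∀ t ∈ Set.Ioo (-δ) 0, g t = M.eval t) {k : ℕ} (hR : P - M = Polynomial.X ^ k * R)
    (h0 : R.eval 0 ≠ 0) : N < k := by
  by_contra! hk
  have h1 := eval_iterate_derivative_eq hg hδ hP hM k hk
  rw [← sub_eq_zero, ← Polynomial.eval_sub, ← Polynomial.iterate_derivative_sub, hR,
    ← Polynomial.coeff_zero_eq_eval_zero, Polynomial.coeff_iterate_derivative, zero_add,
    Nat.descFactorial_self, nsmul_eq_mul, mul_eq_zero, Nat.cast_eq_zero] at h1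
  have h2 := h1.resolve_left (Nat.factorial_ne_zero k)
  rw [Polynomial.coeff_X_pow_mul', if_pos le_rfl, Nat.sub_self,
    Polynomial.coeff_zero_eq_eval_zero] at h2
  exact h0 h2

theorem co_probe_zero (hT : AffineIndependent ℝ T) (a b c : Fin 10) :
    co hT (probe T a b c 0) = fun k => (probePt a b k : ℝ) := by
  rw [co_probe]; simp

theorem contDiff_probe (T : Fin 3 → Plane) (a b c : Fin 10) {r : WithTop ℕ∞} :
    ContDiff ℝ r (probe T a b c) := by
  unfold probe
  simp only [AffineMap.lineMap_apply_module]
  fun_prop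

theorem hull_mem_nhds_probe (hT : AffineIndependent ℝ T) {a b c i j k : Fin 10}
    (h : 0 < detQ (probePt a b) (bary j) (bary k) / detQ (bary i) (bary j) (bary k) ∧
      0 < detQ (probePt a b) (bary k) (bary i) / detQ (bary i) (bary j) (bary k) ∧
      0 < detQ (probePt a b) (bary i) (bary j) / detQ (bary i) (bary j) (bary k)) :
    hull T (knots3 i j k) ∈ 𝓝 (probe T a b c 0) := by
  have h' : ∀ u v : Fin 10,
      0 < detQ (probePt a b) (bary u) (bary v) / detQ (bary i) (bary j) (bary k) →
      0 < det (co hT (probe T a b c 0)) (V u) (V v) / det (V i) (V j) (V k) := by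
    intro u v h
    rw [co_probe_zero, det_probePt, det_V]
    exact_mod_cast h
  exact hull_mem_nhds hT (h' _ _ h.1) (h' _ _ h.2.1) (h' _ _ h.2.2)

/-- The probes on the interior edges. -/
def meshProbe : Fin 15 → Fin 10 × Fin 10 × Fin 10 :=
  ![(0, 6, 2), (6, 9, 2), (9, 4, 2), (1, 7, 0), (7, 9, 0), (9, 5, 0), (2, 8, 1), (8, 9, 1),
    (9, 3, 1), (3, 6, 0), (6, 5, 0), (3, 7, 0), (7, 4, 0), (4, 8, 0), (8, 5, 0)]

/-- The probes on the segments that are not part of the 12-split, with the faces in which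
they lie. -/
def faceProbe : Fin 9 → (Fin 10 × Fin 10 × Fin 10) × Fin 12 :=
  ![((6, 1, 2), 6), ((6, 2, 0), 10), ((7, 0, 1), 5), ((7, 2, 0), 1), ((8, 0, 1), 9),
    ((8, 1, 2), 3), ((6, 7, 2), 6), ((6, 8, 0), 10), ((7, 8, 0), 1)]

theorem isProbe_meshProbe : ∀ i, IsProbe (meshProbe i).1 (meshProbe i).2.1 (meshProbe i).2.2 := by
  decide +kernel

theorem isProbe_faceProbe :
    ∀ i, IsProbe (faceProbe i).1.1 (faceProbe i).1.2.1 (faceProbe i).1.2.2 := by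
  decide +kernel

theorem meshProbe_interior (i : Fin 15) :
    0 < detQ (probePt (meshProbe i).1 (meshProbe i).2.1) (bary 1) (bary 2)
      / detQ (bary 0) (bary 1) (bary 2) ∧
    0 < detQ (probePt (meshProbe i).1 (meshProbe i).2.1) (bary 2) (bary 0)
      / detQ (bary 0) (bary 1) (bary 2) ∧
    0 < detQ (probePt (meshProbe i).1 (meshProbe i).2.1) (bary 0) (bary 1)
      / detQ (bary 0) (bary 1) (bary 2) := by
  revert i; decide +kernel

theorem faceProbe_interior (i : Fin 9) :
    0 < detQ (probePt (faceProbe i).1.1 (faceProbe i).1.2.1)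
      (bary (faceVertex (faceProbe i).2 1)) (bary (faceVertex (faceProbe i).2 2))
      / detQ (bary (faceVertex (faceProbe i).2 0)) (bary (faceVertex (faceProbe i).2 1))
        (bary (faceVertex (faceProbe i).2 2)) ∧
    0 < detQ (probePt (faceProbe i).1.1 (faceProbe i).1.2.1)
      (bary (faceVertex (faceProbe i).2 2)) (bary (faceVertex (faceProbe i).2 0))
      / detQ (bary (faceVertex (faceProbe i).2 0)) (bary (faceVertex (faceProbe i).2 1))
        (bary (faceVertex (faceProbe i).2 2)) ∧
    0 < detQ (probePt (faceProbe i).1.1 (faceProbe i).1.2.1)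
      (bary (faceVertex (faceProbe i).2 0)) (bary (faceVertex (faceProbe i).2 1))
      / detQ (bary (faceVertex (faceProbe i).2 0)) (bary (faceVertex (faceProbe i).2 1))
        (bary (faceVertex (faceProbe i).2 2)) := by
  revert i; decide +kernel

theorem off_le {K : Knots} {a b c : Fin 10} (hK : ∑ j, K j = 8)
    (h : HasPair (Opposite a b c) K) : off (lineSet a b) K ≤ 6 := by
  obtain ⟨x, y, hx, hy, hxy⟩ := h
  have hne : x ≠ y := by
    rintro rfl
    exact absurd hxy.2.2 (not_lt.mpr (mul_self_nonneg _))
  have h1 : remove K x y ≠ 0 := by rwa [remove_apply_of_ne hne.symm]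
  have e1 := off_remove_of_mem (K := K) hxy.1
  have e2 := off_remove_of_mem (K := remove K x) hxy.2.1
  have e3 := sum_remove hx
  have e4 := sum_remove h1
  have e5 : off (lineSet a b) (remove (remove K x) y) ≤ ∑ l, remove (remove K x) y l :=
    Finset.sum_le_sum_of_subset (Finset.subset_univ _)
  omega

/-- The jump has exact order one less than the number of knots off the line, and for a C³ function
that order exceeds three. -/
theorem four_lt_off (hT : AffineIndependent ℝ T) {K : Knots} (hK : ∑ j, K j = 8) (hS : Spans K)
    (hC : simplexSpline T K ∈ splineSpace T 3 5) (i : Fin 15)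
    (h : HasPair (Opposite (meshProbe i).1 (meshProbe i).2.1 (meshProbe i).2.2) K) :
    4 < off (lineSet (meshProbe i).1 (meshProbe i).2.1) K := by
  obtain ⟨δ, hδ, P, M, R, h1, h2, h3, h4, -⟩ := exists_probe_jump hT (isProbe_meshProbe i) hK hS
  have hmem := hull_mem_nhds_probe hT (c := (meshProbe i).2.2) (meshProbe_interior i)
  rw [← triangle_eq_hull] at hmem
  have hg : ContDiffAt ℝ (3 : ℕ) (fun t => simplexSpline T K
      (probe T (meshProbe i).1 (meshProbe i).2.1 (meshProbe i).2.2 t)) 0 :=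
    (hC.1.contDiffAt hmem).comp 0 (contDiff_probe T _ _ _).contDiffAt
  have := lt_of_contDiffAt hg hδ h1 h2 h3 (h4 h)
  omega

/-- Inside a face the spline is a polynomial, so a jump would have order at least six and require
seven knots off the line; the two knots of the pair leave at most six. -/
theorem not_hasPair_faceProbe (hT : AffineIndependent ℝ T) {K : Knots} (hK : ∑ j, K j = 8)
    (hS : Spans K) (hC : simplexSpline T K ∈ splineSpace T 3 5) (i : Fin 9) :
    ¬ HasPair (Opposite (faceProbe i).1.1 (faceProbe i).1.2.1 (faceProbe i).1.2.2) K := by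
  intro h
  obtain ⟨δ, hδ, P, M, R, h1, h2, h3, h4, -⟩ := exists_probe_jump hT (isProbe_faceProbe i) hK hS
  have hmem := hull_mem_nhds_probe hT (c := (faceProbe i).1.2.2) (faceProbe_interior i)
  rw [← closedFace_eq_hull] at hmem
  obtain ⟨p, -, hp⟩ := hC.2 (faceProbe i).2
  have hg : ContDiffAt ℝ (5 : ℕ) (fun t => simplexSpline T K
      (probe T (faceProbe i).1.1 (faceProbe i).1.2.1 (faceProbe i).1.2.2 t)) 0 := by
    have hp' : ContDiff ℝ (5 : ℕ) fun x : Plane => MvPolynomial.eval (fun i => x i) p :=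
      contDiff_eval (fun k => by fun_prop) p
    refine ContDiffAt.comp 0 (hp'.contDiffAt.congr_of_eventuallyEq ?_)
      (contDiff_probe T _ _ _).contDiffAt
    filter_upwards [hmem] with x hx using hp x hx
  have := lt_of_contDiffAt hg hδ h1 h2 h3 (h4 h)
  have := off_le hK h
  omega

/-! ### Univariate simplex splines and B-splines -/

/-- Univariate simplex splines with `a` knots at `0`, `q` knots at `1/2` and `b` knots at `1`, on
the left (`s = false`) or the right half of the unit interval. -/
def uniSpl {F : Type} [Field F] (s : Bool) (t : F) : ℕ → ℕ → ℕ → ℕ → F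
  | 0, a, q, b =>
      if a = 1 ∧ q = 1 ∧ b = 0 then (if s then 0 else 2)
      else if a = 0 ∧ q = 1 ∧ b = 1 then (if s then 2 else 0)
      else if a = 1 ∧ q = 0 ∧ b = 1 then 1 else 0
  | n + 1, a, q, b =>
      if 0 < a ∧ 0 < b then (1 - t) * uniSpl s t n (a - 1) q b + t * uniSpl s t n a q (b - 1)
      else if 0 < a ∧ 0 < q then
        (1 - 2 * t) * uniSpl s t n (a - 1) q b + 2 * t * uniSpl s t n a (q - 1) b
      else if 0 < q ∧ 0 < b then
        (2 - 2 * t) * uniSpl s t n a (q - 1) b + (2 * t - 1) * uniSpl s t n a q (b - 1)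
      else 0

theorem uniSpl_cast (s : Bool) (t : ℚ) (n a q b : ℕ) :
    uniSpl s (t : ℝ) n a q b = ((uniSpl s t n a q b : ℚ) : ℝ) := by
  induction n generalizing a q b with
  | zero => simp only [uniSpl]; split_ifs <;> simp
  | succ n ih => simp only [uniSpl, ih]; split_ifs <;> push_cast <;> rfl

theorem uniSpl_degenerate {F : Type} [Field F] (s : Bool) (t : F) (n a q b : ℕ)
    (h : (a = 0 ∧ q = 0) ∨ (a = 0 ∧ b = 0) ∨ (q = 0 ∧ b = 0)) : uniSpl s t n a q b = 0 := by
  cases n with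
  | zero =>
    simp only [uniSpl]
    rw [if_neg (by omega), if_neg (by omega), if_neg (by omega)]
  | succ n =>
    simp only [uniSpl]
    rw [if_neg (by omega), if_neg (by omega), if_neg (by omega)]

/-- The number of knots `0` among the `n` consecutive ones from the `i`-th one on. -/
def cnt₀ (i n : ℕ) : ℕ := min (i + n) 6 - min i 6

/-- The number of knots `1/2` among the `n` consecutive ones from the `i`-th one on. -/
def cnt₁ (i n : ℕ) : ℕ := max (min (i + n) 8) 6 - max (min i 8) 6

/-- The number of knots `1` among the `n` consecutive ones from the `i`-th one on. -/
def cnt₂ (i n : ℕ) : ℕ := max (i + n) 8 - max i 8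

theorem knot_of_lt {i : ℕ} (h : i < 6) : knot i = 0 := by simp [knot, h]

theorem knot_of_mid {i : ℕ} (h : 6 ≤ i) (h' : i < 8) : knot i = 1 / 2 := by
  rw [knot, if_neg (by omega), if_pos h']

theorem knot_of_le {i : ℕ} (h : 8 ≤ i) : knot i = 1 := by
  rw [knot, if_neg (by omega), if_neg (by omega)]

/-- The length of the knot interval cancels the denominators of the Cox-de Boor recursion, leaving
the affine recursion of `uniSpl` for the extreme knots. -/
theorem bSpline_eq {t : ℝ} (h0 : 0 ≤ t) (h1 : t ≤ 1) {s : Bool} (hs : s = true ↔ 1 / 2 ≤ t)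
    (d : ℕ) : ∀ i, bSpline d i t = (knot (i + d + 1) - knot i) *
      uniSpl s t d (cnt₀ i (d + 2)) (cnt₁ i (d + 2)) (cnt₂ i (d + 2)) := by
  induction d with
  | zero =>
    intro i
    rw [bSpline, uniSpl]
    rcases lt_trichotomy i 5 with hi | hi | hi
    · rw [knot_of_lt (by omega : i < 6), knot_of_lt (by omega), if_neg]
      · simp
      · rintro (h | h) <;> linarith [h.1, h.2]
    · subst hi
      rw [knot_of_lt (by omega : 5 < 6), knot_of_mid (by omega) (by omega)]
      simp only [cnt₀, cnt₁, cnt₂]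
      by_cases h : 1 / 2 ≤ t
      · rw [if_neg, hs.mpr h]
        · simp
        · rintro (⟨h, h'⟩ | ⟨h, h', h''⟩)
          · linarith
          · norm_num at h''
      · have hf : s = false := by
          rw [← Bool.not_eq_true, hs]; exact h
        rw [if_pos (.inl ⟨h0, not_le.mp h⟩), hf]
        norm_num
    · rcases lt_trichotomy i 7 with hi' | hi' | hi'
      · rw [knot_of_mid (by omega) (by omega), knot_of_mid (by omega) (by omega), if_neg]
        · simp
        · rintro (h | h)
          · linarith [h.1, h.2]
          · have := h.2.2; norm_num at this
      · subst hi'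
        rw [knot_of_mid (by omega) (by omega), knot_of_le (by omega)]
        simp only [cnt₀, cnt₁, cnt₂]
        by_cases h : 1 / 2 ≤ t
        · rw [hs.mpr h, if_pos]
          · norm_num
          · rcases h1.lt_or_eq with h' | h'
            · exact .inl ⟨h, h'⟩
            · exact .inr ⟨h', by norm_num, trivial⟩
        · have hf : s = false := by
            rw [← Bool.not_eq_true, hs]; exact h
          rw [if_neg, hf]
          · simp
          · rintro (h' | h')
            · exact h h'.1
            · exact h (by rw [h'.1]; norm_num)
      · rw [knot_of_le (by omega : 8 ≤ i), knot_of_le (by omega), if_neg]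
        · simp
        · rintro (h | h)
          · linarith [h.1, h.2]
          · linarith [h.2.1]
  | succ d ih =>
    intro i
    -- When the denominator is zero all the knots coincide; the convention 0 for the quotient then
    -- matches the vanishing of the degenerate `uniSpl`.
    have hquot : ∀ (j : ℕ) (x : ℝ), x / (knot (j + d + 1) - knot j) * bSpline d j t =
        x * uniSpl s t d (cnt₀ j (d + 2)) (cnt₁ j (d + 2)) (cnt₂ j (d + 2)) := by
      intro j x
      by_cases h : knot (j + d + 1) - knot j = 0
      · rw [h, div_zero, zero_mul, uniSpl_degenerate, mul_zero]
        simp only [cnt₀, cnt₁, cnt₂]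
        rcases lt_or_ge j 6 with h6 | h6
        · rw [knot_of_lt h6] at h
          have : j + d + 1 < 6 := by
            by_contra h'
            rcases lt_or_ge (j + d + 1) 8 with h8 | h8
            · rw [knot_of_mid (by omega) h8] at h; norm_num at h
            · rw [knot_of_le h8] at h; norm_num at h
          omega
        · rcases lt_or_ge j 8 with h8 | h8
          · rw [knot_of_mid h6 h8] at h
            have : j + d + 1 < 8 := by
              by_contra h'
              rw [knot_of_le (by omega)] at h; norm_num at h
            omega
          · omega
      · rw [ih j]; field_simp
    rw [bSpline, hquot i]
    have e2 : i + d + 2 = (i + 1) + d + 1 := by ring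
    rw [e2, hquot (i + 1)]
    have e3 : i + (d + 1) + 1 = i + 1 + d + 1 := by ring
    rw [e3, uniSpl]
    have k0 : ∀ {a b c a' b' c' : ℕ}, a = a' → b = b' → c = c' →
        uniSpl s t d a b c = uniSpl s t d a' b' c' := by
      rintro a b c _ _ _ rfl rfl rfl; rfl
    by_cases c1 : 0 < cnt₀ i (d + 1 + 2) ∧ 0 < cnt₂ i (d + 1 + 2)
    · rw [if_pos c1]
      simp only [cnt₀, cnt₂] at c1
      rw [knot_of_lt (by omega : i < 6), knot_of_le (by omega),
        k0 (a := cnt₀ i (d + 2)) (a' := cnt₀ i (d + 1 + 2)) (b' := cnt₁ i (d + 1 + 2))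
          (c' := cnt₂ i (d + 1 + 2) - 1), k0 (a := cnt₀ (i + 1) (d + 2))
          (a' := cnt₀ i (d + 1 + 2) - 1) (b' := cnt₁ i (d + 1 + 2)) (c' := cnt₂ i (d + 1 + 2))]
      · ring
      all_goals simp only [cnt₀, cnt₁, cnt₂]; omega
    rw [if_neg c1]
    by_cases c2 : 0 < cnt₀ i (d + 1 + 2) ∧ 0 < cnt₁ i (d + 1 + 2)
    · rw [if_pos c2]
      simp only [cnt₀, cnt₁, cnt₂] at c1 c2
      rw [knot_of_lt (by omega : i < 6), knot_of_mid (by omega) (by omega),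
        k0 (a := cnt₀ i (d + 2)) (a' := cnt₀ i (d + 1 + 2)) (b' := cnt₁ i (d + 1 + 2) - 1)
          (c' := cnt₂ i (d + 1 + 2)), k0 (a := cnt₀ (i + 1) (d + 2))
          (a' := cnt₀ i (d + 1 + 2) - 1) (b' := cnt₁ i (d + 1 + 2)) (c' := cnt₂ i (d + 1 + 2))]
      · ring
      all_goals simp only [cnt₀, cnt₁, cnt₂]; omega
    rw [if_neg c2]
    by_cases c3 : 0 < cnt₁ i (d + 1 + 2) ∧ 0 < cnt₂ i (d + 1 + 2)
    · rw [if_pos c3]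
      simp only [cnt₀, cnt₁, cnt₂] at c1 c2 c3
      rw [knot_of_mid (by omega : 6 ≤ i) (by omega), knot_of_le (by omega),
        k0 (a := cnt₀ i (d + 2)) (a' := cnt₀ i (d + 1 + 2)) (b' := cnt₁ i (d + 1 + 2))
          (c' := cnt₂ i (d + 1 + 2) - 1), k0 (a := cnt₀ (i + 1) (d + 2))
          (a' := cnt₀ i (d + 1 + 2)) (b' := cnt₁ i (d + 1 + 2) - 1) (c' := cnt₂ i (d + 1 + 2))]
      · ring
      all_goals simp only [cnt₀, cnt₁, cnt₂]; omega
    rw [if_neg c3, uniSpl_degenerate _ _ _ _ _ _ (by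
      simp only [cnt₀, cnt₁, cnt₂] at c1 c2 c3 ⊢; omega), uniSpl_degenerate _ _ _ _ _ _ (by
      simp only [cnt₀, cnt₁, cnt₂] at c1 c2 c3 ⊢; omega)]
    ring

/-- The knot multiplicities of the consecutive quintic B-splines. -/
def edgeCnt : Fin 8 → ℕ × ℕ × ℕ :=
  ![(6, 1, 0), (5, 2, 0), (4, 2, 1), (3, 2, 2), (2, 2, 3), (1, 2, 4), (0, 2, 5), (0, 1, 6)]

/-- The length of the convex hull of the knots. -/
def uniLen (a b : ℕ) : ℚ := if 0 < a ∧ 0 < b then 1 else 1 / 2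

theorem bSpline_five {t : ℝ} (h0 : 0 ≤ t) (h1 : t ≤ 1) {s : Bool} (hs : s = true ↔ 1 / 2 ≤ t)
    (r : Fin 8) : bSpline 5 r t = (uniLen (edgeCnt r).1 (edgeCnt r).2.2 : ℝ) *
      uniSpl s t 5 (edgeCnt r).1 (edgeCnt r).2.1 (edgeCnt r).2.2 := by
  rw [bSpline_eq h0 h1 hs]
  have hc : ∀ r : Fin 8, cnt₀ r 7 = (edgeCnt r).1 ∧ cnt₁ r 7 = (edgeCnt r).2.1 ∧
      cnt₂ r 7 = (edgeCnt r).2.2 := by decide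
  rw [(hc r).1, (hc r).2.1, (hc r).2.2]
  congr 1
  fin_cases r <;> norm_num [knot, uniLen, edgeCnt]

/-- The values, at two points, of the quintic splines with the given knot multiplicities, normalized
to the length of the knot interval. -/
def uniVal (a q b : ℕ) : ℚ × ℚ :=
  (uniLen a b * uniSpl false (1 / 4 : ℚ) 5 a q b, uniLen a b * uniSpl true (3 / 4 : ℚ) 5 a q b)

-- The rational values at 1/4 and 3/4 already exclude every other choice of multiplicities, so
-- functions need not be compared on the whole interval.
set_option synthInstance.maxHeartbeats 200000 in
set_option synthInstance.maxSize 1000 in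
theorem exists_edgeCnt_eq_aux : ∀ a : Fin 7, ∀ q : Fin 3, (a : ℕ) + q ≠ 0 → (a : ℕ) + q ≤ 7 →
    (uniVal a q (7 - a - q) = (0, 0) ∨ ∃ r : Fin 8, uniVal a q (7 - a - q) =
      uniVal (edgeCnt r).1 (edgeCnt r).2.1 (edgeCnt r).2.2) →
    ∃ r : Fin 8, edgeCnt r = ((a : ℕ), (q : ℕ), 7 - (a : ℕ) - q) := by
  decide +kernel

/-- Other knot multiplicities do not give consecutive B-splines. -/
theorem exists_edgeCnt_eq {a q b : ℕ} (hsum : a + q + b = 7) (ha : a ≠ 7) (hq : q ≤ 2) (hb : b ≠ 7)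
    (h : uniVal a q b = (0, 0) ∨
      ∃ r : Fin 8, uniVal a q b = uniVal (edgeCnt r).1 (edgeCnt r).2.1 (edgeCnt r).2.2) :
    ∃ r, edgeCnt r = (a, q, b) := by
  obtain rfl : b = 7 - a - q := by omega
  exact exists_edgeCnt_eq_aux ⟨a, by omega⟩ ⟨q, by omega⟩ (by simp only; omega)
    (by simp only; omega) h

/-! ### Restriction to the boundary edges -/

/-- The endpoints and the midpoint of the edges of the triangle. -/
def edge : Fin 3 → Fin 3 → Fin 10 := ![![0, 3, 1], ![0, 5, 2], ![1, 4, 2]]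

/-- The faces at the two halves of an edge. -/
def edgeFace : Fin 3 → Bool → Fin 12 :=
  ![fun s => if s then 4 else 7, fun s => if s then 8 else 11, fun s => if s then 2 else 0]

/-- The endpoints of the edges as corners. -/
def edgeCorner : Fin 3 → Fin 3 × Fin 3 := ![(0, 1), (0, 2), (1, 2)]

/-- The vertices on the line of an edge. -/
def edgeSet (e : Fin 3) : Finset (Fin 10) := lineSet (edge e 0) (edge e 2)

theorem mem_edgeSet {e : Fin 3} {j : Fin 10} :
    j ∈ edgeSet e ↔ j = edge e 0 ∨ j = edge e 1 ∨ j = edge e 2 := by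
  have h : ∀ e j, j ∈ edgeSet e ↔ j = edge e 0 ∨ j = edge e 1 ∨ j = edge e 2 := by decide +kernel
  exact h e j

theorem edge_mem (e k : Fin 3) : edge e k ∈ edgeSet e := by
  rw [mem_edgeSet]; fin_cases k <;> simp

theorem edge_injective (e : Fin 3) : Function.Injective (edge e) := by
  revert e; decide

theorem isLine_edge (e : Fin 3) : IsLine (V (edge e 0)) (V (edge e 2)) (edgeSet e) :=
  isLine_lineSet

theorem exists_det_edge (e : Fin 3) : ∃ X, det X (V (edge e 0)) (V (edge e 2)) ≠ 0 := by
  obtain ⟨k, hk⟩ := exists_det_ne_zero (i := edge e 0) (j := edge e 2)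
    ((edge_injective e).ne (by decide))
  exact ⟨_, hk⟩

theorem V_edge (e : Fin 3) :
    V (edge e 1) = (1 / 2 : ℝ) • V (edge e 0) + (1 / 2 : ℝ) • V (edge e 2) := by
  have h : ∀ e k, bary (edge e 1) k = 1 / 2 * bary (edge e 0) k + 1 / 2 * bary (edge e 2) k := by
    decide +kernel
  ext k
  simp only [V, h, Pi.add_apply, Pi.smul_apply, smul_eq_mul]
  push_cast
  ring

theorem isRep_pair {K : Knots} {i j : Fin 10} (hi : K i ≠ 0) (hj : K j ≠ 0) (α β : ℝ) :
    IsRep K (α • V i + β • V j) (Pi.single i α + Pi.single j β) := by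
  constructor
  · simp only [Pi.add_apply, add_smul, Finset.sum_add_distrib, sum_single_smul]
  · intro l hl
    have h1 : l ≠ i := by rintro rfl; exact hi hl
    have h2 : l ≠ j := by rintro rfl; exact hj hl
    simp [h1, h2]

theorem spl_pair {b : Knots → ℝ} (hb : IsBase b) {n : ℕ} {K : Knots} (hK : ∑ j, K j = n + 4)
    {i j : Fin 10} (hi : K i ≠ 0) (hj : K j ≠ 0) (α β : ℝ) {X : Vec}
    (hX : X = α • V i + β • V j) :
    spl b (n + 1) K X = α * spl b n (remove K i) X + β * spl b n (remove K j) X := by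
  rw [spl_eq hb hK (hX ▸ isRep_pair hi hj α β)]
  simp only [Pi.add_apply, add_mul, Finset.sum_add_distrib]
  rw [sum_single_mul i α fun l => spl b n (remove K l) X,
    sum_single_mul j β fun l => spl b n (remove K l) X]

/-- The values on three knots at the face points. -/
def baseQ (f : Fin 12) (i j k : Fin 10) : ℚ :=
  if detQ (bary i) (bary j) (bary k) ≠ 0 ∧
    0 ≤ detQ (faceCo f) (bary j) (bary k) / detQ (bary i) (bary j) (bary k) ∧
    0 ≤ detQ (faceCo f) (bary k) (bary i) / detQ (bary i) (bary j) (bary k) ∧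
    0 ≤ detQ (faceCo f) (bary i) (bary j) / detQ (bary i) (bary j) (bary k)
  then 1 / |detQ (bary i) (bary j) (bary k)| else 0

theorem baseAt_facePoint (hT : AffineIndependent ℝ T) (f : Fin 12) (i j k : Fin 10) :
    baseAt T (facePoint T f) (knots3 i j k) = (baseQ f i j k : ℝ) := by
  have hA := (area_triangle_pos hT).ne'
  by_cases hd : det (V i) (V j) (V k) = 0
  · rw [baseAt, area_hull_knots3, hd, baseQ, if_neg]
    · simp
    · rw [det_V] at hd
      exact fun h => h.1 (by exact_mod_cast hd)
  · classical
    rw [baseAt, area_hull_knots3, Set.indicator_apply, mem_hull_knots3 hT hd, det_facePoint,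
      det_facePoint, det_facePoint, det_V, baseQ]
    rw [det_V] at hd
    norm_cast at hd ⊢
    by_cases h : 0 ≤ detQ (faceCo f) (bary j) (bary k) / detQ (bary i) (bary j) (bary k) ∧
      0 ≤ detQ (faceCo f) (bary k) (bary i) / detQ (bary i) (bary j) (bary k) ∧
      0 ≤ detQ (faceCo f) (bary i) (bary j) / detQ (bary i) (bary j) (bary k)
    · rw [if_pos h, if_pos ⟨hd, h⟩]
      push_cast
      rw [Pi.one_apply, one_mul, div_mul_cancel_right₀ hA, one_div]
    · rw [if_neg h, if_neg fun h' => h h'.2]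
      simp

/-- A triangle with corners among these vertices that contains a face along an edge must have a side
on that edge. The base values thus behave like a jump across the edge, to which
`exists_spl_eq_pow_mul` applies. -/
theorem baseQ_edge_support : ∀ (e : Fin 3) (s : Bool) (i j k : Fin 10), (i : ℕ) < 6 → (j : ℕ) < 6 →
    (k : ℕ) < 6 → baseQ (edgeFace e s) i j k ≠ 0 →
      (i ∈ edgeSet e ∧ j ∈ edgeSet e ∧ k ∉ edgeSet e) ∨
      (i ∈ edgeSet e ∧ j ∉ edgeSet e ∧ k ∈ edgeSet e) ∨
      (i ∉ edgeSet e ∧ j ∈ edgeSet e ∧ k ∈ edgeSet e) := by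
  decide +kernel

/-- Normalized area is length on the edge times the height of the apex; removing the height leaves
the univariate normalization by length. -/
theorem baseQ_edge : ∀ (e : Fin 3) (s : Bool) (c : Fin 10), (c : ℕ) < 6 → c ∉ edgeSet e →
    ∀ i k : Fin 3, baseQ (edgeFace e s) (edge e i) c (edge e k) *
      |detQ (bary (edge e 0)) (bary (edge e 2)) (bary c)| = uniSpl s (0 : ℚ) 0
        (knots3 (edge e i) c (edge e k) (edge e 0)) (knots3 (edge e i) c (edge e k) (edge e 1))
        (knots3 (edge e i) c (edge e k) (edge e 2)) := by
  decide +kernel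

theorem off_add_le {L : Finset (Fin 10)} {K : Knots} {i j : Fin 10} (hi : i ∈ L) (hj : j ∈ L)
    (hij : i ≠ j) : off L K + (K i + K j) ≤ ∑ l, K l := by
  rw [off, ← Finset.sum_compl_add_sum L, ← Finset.sum_pair hij]
  gcongr
  intro l hl
  simp only [Finset.mem_insert, Finset.mem_singleton] at hl
  rcases hl with rfl | rfl <;> assumption

theorem off_edgeSet_add (e : Fin 3) (K : Knots) :
    off (edgeSet e) K + (K (edge e 0) + K (edge e 1) + K (edge e 2)) = ∑ l, K l := by
  have h : edgeSet e = {edge e 0, edge e 1, edge e 2} := by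
    ext j; simp [mem_edgeSet]
  have i := edge_injective e
  rw [off, ← Finset.sum_compl_add_sum (edgeSet e), h, Finset.sum_insert, Finset.sum_insert,
    Finset.sum_singleton, add_assoc]
  · simp [i.eq_iff]
  · simp [i.eq_iff]

/-- On an edge, a spline with two knots off the edge is zero. -/
theorem spl_edge_eq_zero (hT : AffineIndependent ℝ T) {K : Knots} (hK : ∑ j, K j = 8)
    (hlow : LowSupp K) (e : Fin 3) (s : Bool) (hoff : 2 ≤ off (edgeSet e) K) {X : Vec}
    (hX : det X (V (edge e 0)) (V (edge e 2)) = 0) :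
    spl (baseAt T (facePoint T (edgeFace e s))) 5 K X = 0 := by
  obtain ⟨H, h1, -, -⟩ := exists_spl_eq_pow_mul (isLine_edge e) (exists_det_edge e)
    (S := fun a b => a ∈ edgeSet e ∧ b ∈ edgeSet e ∧ a ≠ b) (fun a b h => h)
    (isBase_facePoint hT (edgeFace e s)) (K₀ := K) (p := 0) (pos := False) (by
      intro K' hK' h3 hne
      obtain ⟨i, j, k, hd, rfl⟩ := exists_knots3_of_spans (K := K') (by
        by_contra hS
        exact hne (baseAt_of_not_spans hT _ hS)) h3
      obtain ⟨hij, hik, hjk⟩ := ne_of_det_ne_zero hd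
      rw [baseAt_facePoint hT] at hne
      have hi : knots3 i j k i ≠ 0 := knots3_ne_zero.mpr (.inl rfl)
      have hj : knots3 i j k j ≠ 0 := knots3_ne_zero.mpr (.inr (.inl rfl))
      have hk : knots3 i j k k ≠ 0 := knots3_ne_zero.mpr (.inr (.inr rfl))
      have hlow' := hlow.mono hK'
      rw [off_knots3]
      rcases baseQ_edge_support e s i j k (hlow'.lt hi) (hlow'.lt hj) (hlow'.lt hk)
        (by exact_mod_cast hne) with h | h | h
      · exact ⟨by simp [h], i, j, hi, hj, h.1, h.2.1, hij⟩
      · exact ⟨by simp [h], i, k, hi, hk, h.1, h.2.2, hik⟩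
      · exact ⟨by simp [h], j, k, hj, hk, h.2.1, h.2.2, hjk⟩)
    False.elim False.elim False.elim 5 K le_rfl hK
  rw [h1, hX, zero_pow (by omega), zero_mul]

/-- The only knot off an edge. -/
structure IsApex (e : Fin 3) (K : Knots) (c : Fin 10) : Prop where
  low : LowSupp K
  off_eq : off (edgeSet e) K = 1
  notMem : c ∉ edgeSet e
  ne_zero : K c ≠ 0

theorem exists_isApex {e : Fin 3} {K : Knots} (hlow : LowSupp K) (h : off (edgeSet e) K = 1) :
    ∃ c, IsApex e K c := by
  obtain ⟨c, hc, hKc⟩ := Finset.exists_ne_zero_of_sum_ne_zero (h.symm ▸ one_ne_zero)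
  exact ⟨c, hlow, h, Finset.mem_compl.mp hc, hKc⟩

section

variable {e : Fin 3} {K : Knots} {c : Fin 10}

theorem IsApex.remove (h : IsApex e K c) (k : Fin 3) : IsApex e (remove K (edge e k)) c where
  low := h.low.mono (remove_le _ _)
  off_eq := by rw [off_remove_of_mem (edge_mem e k), h.off_eq]
  notMem := h.notMem
  ne_zero := by
    rw [remove_apply_of_ne]
    · exact h.ne_zero
    · rintro rfl; exact h.notMem (edge_mem e k)

theorem IsApex.support (h : IsApex e K c) {l : Fin 10} (hl : K l ≠ 0) :
    l = c ∨ l = edge e 0 ∨ l = edge e 1 ∨ l = edge e 2 := by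
  by_cases hlc : l = c
  · exact .inl hlc
  · refine .inr (mem_edgeSet.mp ?_)
    by_contra hL
    have h1 := off_remove_of_notMem h.notMem h.ne_zero
    rw [h.off_eq] at h1
    have h2 := (Finset.sum_eq_zero_iff.mp (show off (edgeSet e) (PS12.remove K c) = 0 by omega)) l
      (Finset.mem_compl.mpr hL)
    rw [remove_apply_of_ne hlc] at h2
    exact hl h2

theorem IsApex.not_spans (h : IsApex e K c) {w : Fin 10}
    (hw : ∀ k, K (edge e k) ≠ 0 → edge e k = w) : ¬ Spans K := by
  rintro ⟨i, j, k, hi, hj, hk, hd⟩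
  have hs : ∀ {l}, K l ≠ 0 → l = c ∨ l = w := by
    intro l hl
    rcases h.support hl with rfl | rfl | rfl | rfl
    exacts [.inl rfl, .inr (hw 0 hl), .inr (hw 1 hl), .inr (hw 2 hl)]
  obtain ⟨hij, hik, hjk⟩ := ne_of_det_ne_zero hd
  rcases hs hi with rfl | rfl <;> rcases hs hj with rfl | rfl <;> rcases hs hk with rfl | rfl <;>
    contradiction

/-- The height of the apex above the edge. -/
def height (e : Fin 3) (c : Fin 10) : ℝ := |det (V (edge e 0)) (V (edge e 2)) (V c)|

theorem height_ne_zero (hc : c ∉ edgeSet e) : height e c ≠ 0 :=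
  abs_ne_zero.mpr ((isLine_edge e).det_ne _ _ _ (edge_mem e 0) (edge_mem e 2)
    ((edge_injective e).ne (by decide)) hc)

theorem IsApex.base_mul_height (hT : AffineIndependent ℝ T) (h : IsApex e K c) (hK : ∑ j, K j = 3)
    (s : Bool) (t : ℝ) : baseAt T (facePoint T (edgeFace e s)) K * height e c =
      uniSpl s t 0 (K (edge e 0)) (K (edge e 1)) (K (edge e 2)) := by
  have hs := off_edgeSet_add e K
  rw [h.off_eq] at hs
  obtain ⟨i, hi⟩ : ∃ i, K (edge e i) ≠ 0 := by
    by_contra! h0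
    rw [h0, h0, h0] at hs
    omega
  have hic : edge e i ≠ c := fun h' => h.notMem (h' ▸ edge_mem e i)
  obtain ⟨k, rfl⟩ := eq_knots3_of_ne hK hi h.ne_zero hic
  have hk : k ∈ edgeSet e := by
    by_contra hk
    have := h.off_eq
    rw [off_knots3] at this
    simp [hk, h.notMem, edge_mem] at this
  obtain ⟨k, rfl⟩ : ∃ k', k = edge e k' := by
    rcases mem_edgeSet.mp hk with rfl | rfl | rfl
    exacts [⟨0, rfl⟩, ⟨1, rfl⟩, ⟨2, rfl⟩]
  have hu : ∀ a q b, uniSpl s t 0 a q b = uniSpl s ((0 : ℚ) : ℝ) 0 a q b := fun a q b => rfl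
  rw [hu, uniSpl_cast, ← baseQ_edge e s c (h.low.lt h.ne_zero) h.notMem,
    baseAt_facePoint hT, height, det_V]
  push_cast
  rfl

/-- On an edge, a spline with one knot off the edge is a univariate simplex spline. -/
theorem IsApex.spl_mul_height (hT : AffineIndependent ℝ T) (s : Bool) {t : ℝ} {X : Vec}
    (hX : X = (1 - t) • V (edge e 0) + t • V (edge e 2)) (n : ℕ) :
    ∀ {K : Knots}, IsApex e K c → ∑ j, K j = n + 3 →
      spl (baseAt T (facePoint T (edgeFace e s))) n K X * height e c =
        uniSpl s t n (K (edge e 0)) (K (edge e 1)) (K (edge e 2)) := by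
  have hb := isBase_facePoint hT (edgeFace e s)
  have i := edge_injective e
  have n01 : edge e 0 ≠ edge e 1 := i.ne (by decide)
  have n02 : edge e 0 ≠ edge e 2 := i.ne (by decide)
  have n12 : edge e 1 ≠ edge e 2 := i.ne (by decide)
  induction n with
  | zero => intro K h hK; exact h.base_mul_height hT hK s t
  | succ n ih =>
    intro K h hK
    have hr : ∀ k, K (edge e k) ≠ 0 → ∑ j, PS12.remove K (edge e k) j = n + 3 := fun k hk => by
      have := sum_remove hk; omega
    rw [uniSpl]
    split_ifs with c1 c2 c3
    · rw [spl_pair hb hK c1.1.ne' c1.2.ne' (1 - t) t hX, add_mul, mul_assoc, mul_assoc,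
        ih (h.remove 0) (hr 0 c1.1.ne'), ih (h.remove 2) (hr 2 c1.2.ne')]
      simp only [remove_apply_self, remove_apply_of_ne n01.symm, remove_apply_of_ne n02,
        remove_apply_of_ne n02.symm, remove_apply_of_ne n12]
    · rw [spl_pair hb hK c2.1.ne' c2.2.ne' (1 - 2 * t) (2 * t)
        (by rw [hX, V_edge]; module), add_mul, mul_assoc, mul_assoc,
        ih (h.remove 0) (hr 0 c2.1.ne'), ih (h.remove 1) (hr 1 c2.2.ne')]
      simp only [remove_apply_self, remove_apply_of_ne n01, remove_apply_of_ne n01.symm,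
        remove_apply_of_ne n02.symm, remove_apply_of_ne n12.symm]
    · rw [spl_pair hb hK c3.1.ne' c3.2.ne' (2 - 2 * t) (2 * t - 1)
        (by rw [hX, V_edge]; module), add_mul, mul_assoc, mul_assoc,
        ih (h.remove 1) (hr 1 c3.1.ne'), ih (h.remove 2) (hr 2 c3.2.ne')]
      simp only [remove_apply_self, remove_apply_of_ne n01, remove_apply_of_ne n02,
        remove_apply_of_ne n12, remove_apply_of_ne n12.symm]
    · rw [spl_of_not_spans hb, zero_mul]
      by_cases h0 : K (edge e 0) = 0 <;> by_cases h1 : K (edge e 1) = 0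
      · refine h.not_spans (w := edge e 2) fun k hk => ?_
        fin_cases k <;> simp_all
      · refine h.not_spans (w := edge e 1) fun k hk => ?_
        fin_cases k <;> simp_all [Nat.pos_iff_ne_zero]
      · refine h.not_spans (w := edge e 0) fun k hk => ?_
        fin_cases k <;> simp_all [Nat.pos_iff_ne_zero]
      · exact absurd ⟨Nat.pos_of_ne_zero h0, Nat.pos_of_ne_zero h1⟩ c2

theorem IsApex.area_hull (hT : AffineIndependent ℝ T) (h : IsApex e K c) (hS : Spans K) :
    area (hull T K) =
      (uniLen (K (edge e 0)) (K (edge e 2)) : ℝ) * height e c * area (triangle T) := by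
  have hsame : ∀ i j, K (edge e i) ≠ 0 → K (edge e j) ≠ 0 →
      (∀ k, K (edge e k) ≠ 0 → k = i ∨ k = j) →
      area (hull T K) = |det (V (edge e i)) (V (edge e j)) (V c)| * area (triangle T) := by
    intro i j hi hj hall
    rw [← area_hull_knots3]
    congr 1
    refine Set.Subset.antisymm (hull_mono T fun l hl => ?_) (hull_mono T fun l hl => ?_)
    · rw [knots3_ne_zero]
      obtain rfl | ⟨k, rfl⟩ : l = c ∨ ∃ k, l = edge e k := by
        rcases h.support hl with h | h | h | h
        exacts [.inl h, .inr ⟨_, h⟩, .inr ⟨_, h⟩, .inr ⟨_, h⟩]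
      · exact .inr (.inr rfl)
      · rcases hall k hl with rfl | rfl
        exacts [.inl rfl, .inr (.inl rfl)]
    · rcases knots3_ne_zero.mp hl with rfl | rfl | rfl
      exacts [hi, hj, h.ne_zero]
  have d01 : |det (V (edge e 0)) (V (edge e 1)) (V c)| = 1 / 2 * height e c := by
    rw [V_edge, height, ← abs_of_pos (show (0 : ℝ) < 1 / 2 by norm_num), ← abs_mul,
      abs_of_pos (show (0 : ℝ) < 1 / 2 by norm_num)]
    congr 1
    simp only [det, Pi.add_apply, Pi.smul_apply, smul_eq_mul]; ring
  have d12 : |det (V (edge e 1)) (V (edge e 2)) (V c)| = 1 / 2 * height e c := by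
    rw [V_edge, height, ← abs_of_pos (show (0 : ℝ) < 1 / 2 by norm_num), ← abs_mul,
      abs_of_pos (show (0 : ℝ) < 1 / 2 by norm_num)]
    congr 1
    simp only [det, Pi.add_apply, Pi.smul_apply, smul_eq_mul]; ring
  rw [uniLen]
  by_cases h0 : K (edge e 0) = 0
  · rw [if_neg (by omega), hsame 1 2, d12]
    · push_cast; ring
    · intro h1
      refine h.not_spans (w := edge e 2) (fun k hk => ?_) hS
      fin_cases k <;> simp_all
    · intro h2
      refine h.not_spans (w := edge e 1) (fun k hk => ?_) hS
      fin_cases k <;> simp_all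
    · intro k hk
      fin_cases k <;> simp_all
  by_cases h2 : K (edge e 2) = 0
  · rw [if_neg (by omega), hsame 0 1 h0, d01]
    · push_cast; ring
    · intro h1
      refine h.not_spans (w := edge e 0) (fun k hk => ?_) hS
      fin_cases k <;> simp_all
    · intro k hk
      fin_cases k <;> simp_all
  rw [if_pos ⟨Nat.pos_of_ne_zero h0, Nat.pos_of_ne_zero h2⟩, Rat.cast_one, one_mul, height,
    ← area_hull_knots3]
  congr 1
  refine Set.Subset.antisymm ?_ (hull_mono T fun l hl => ?_)
  · refine convexHull_min ?_ (convex_convexHull ℝ _)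
    have hu : knots3 (edge e 0) (edge e 2) c (edge e 0) ≠ 0 := knots3_ne_zero.mpr (.inl rfl)
    have hv : knots3 (edge e 0) (edge e 2) c (edge e 2) ≠ 0 := knots3_ne_zero.mpr (.inr (.inl rfl))
    have hc : knots3 (edge e 0) (edge e 2) c c ≠ 0 := knots3_ne_zero.mpr (.inr (.inr rfl))
    rintro _ ⟨l, hl, rfl⟩
    rcases h.support hl with rfl | rfl | rfl | rfl
    · exact subset_convexHull ℝ _ ⟨_, hc, rfl⟩
    · exact subset_convexHull ℝ _ ⟨_, hu, rfl⟩
    · refine (mem_hull_iff hT).mpr ⟨Pi.single (edge e 0) (1 / 2) + Pi.single (edge e 2) (1 / 2),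
        fun l => ?_, ?_⟩
      rotate_left
      · rw [co_vertex, V_edge]
        exact isRep_pair hu hv _ _
      · simp only [Pi.add_apply, Pi.single_apply]
        split_ifs <;> norm_num
    · exact subset_convexHull ℝ _ ⟨_, hv, rfl⟩
  · rcases knots3_ne_zero.mp hl with rfl | rfl | rfl
    exacts [h0, h2, h.ne_zero]

end

theorem vertex_corner (T : Fin 3 → Plane) (e : Fin 3) :
    vertex T (edge e 0) = T (edgeCorner e).1 ∧ vertex T (edge e 2) = T (edgeCorner e).2 := by
  fin_cases e <;> simp [vertex, edge, edgeCorner, bary, Fin.sum_univ_three]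

/-- The point of an edge with parameter `t`. -/
def edgePoint (T : Fin 3 → Plane) (e : Fin 3) (t : ℝ) : Plane :=
  AffineMap.lineMap (T (edgeCorner e).1) (T (edgeCorner e).2) t

theorem co_edgePoint (hT : AffineIndependent ℝ T) (e : Fin 3) (t : ℝ) :
    co hT (edgePoint T e t) = (1 - t) • V (edge e 0) + t • V (edge e 2) := by
  rw [edgePoint, co_lineMap, ← (vertex_corner T e).1, ← (vertex_corner T e).2, co_vertex,
    co_vertex]

theorem edgePoint_mem (hT : AffineIndependent ℝ T) (e : Fin 3) {t : ℝ} (h0 : 0 ≤ t) (h1 : t ≤ 1)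
    {s : Bool} (hs : s = true ↔ 1 / 2 ≤ t) : edgePoint T e t ∈ closedFace T (edgeFace e s) := by
  have hv : ∀ e s k, k = 1 ∨ k = (if s then 2 else 0) →
      ∃ j, faceVertex (edgeFace e s) j = edge e k := by decide
  have key : ∀ k, k = 1 ∨ k = (if s then 2 else 0) →
      knots3 (faceVertex (edgeFace e s) 0) (faceVertex (edgeFace e s) 1)
        (faceVertex (edgeFace e s) 2) (edge e k) ≠ 0 := by
    intro k hk
    obtain ⟨j, hj⟩ := hv e s k hk
    rw [← hj, knots3_ne_zero]
    fin_cases j <;> simp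
  have aux : ∀ (i : Fin 10) (a : ℝ) (l : Fin 10), 0 ≤ a → 0 ≤ (Pi.single i a : Fin 10 → ℝ) l := by
    intro i a l ha
    rw [Pi.single_apply]; split_ifs
    exacts [ha, le_rfl]
  rw [closedFace_eq_hull, mem_hull_iff hT, co_edgePoint]
  cases s with
  | false =>
    have ht : ¬ 1 / 2 ≤ t := fun h => by simpa using hs.mpr h
    refine ⟨Pi.single (edge e 0) (1 - 2 * t) + Pi.single (edge e 1) (2 * t),
      fun l => add_nonneg (aux _ _ _ (by linarith)) (aux _ _ _ (by linarith)), ?_⟩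
    convert isRep_pair (key 0 (by simp)) (key 1 (by simp)) (1 - 2 * t) (2 * t) using 1
    rw [V_edge]; module
  | true =>
    have ht : 1 / 2 ≤ t := hs.mp rfl
    refine ⟨Pi.single (edge e 1) (2 - 2 * t) + Pi.single (edge e 2) (2 * t - 1),
      fun l => add_nonneg (aux _ _ _ (by linarith)) (aux _ _ _ (by linarith)), ?_⟩
    convert isRep_pair (key 1 (by simp)) (key 2 (by simp)) (2 - 2 * t) (2 * t - 1) using 1
    rw [V_edge]; module

/-- The edges with one knot off the edge carry the knots of one of the B-splines. -/
def EdgeCond (K : Knots) : Prop := ∀ e : Fin 3, off (edgeSet e) K = 1 →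
  ∃ r, edgeCnt r = (K (edge e 0), K (edge e 1), K (edge e 2))

section

variable {K : Knots}

theorem simplexSpline_edgePoint (hT : AffineIndependent ℝ T) (hK : ∑ j, K j = 8)
    (hlow : LowSupp K) (hc : LineCond K) (hS : Spans K) {e : Fin 3} (hoff : off (edgeSet e) K = 1)
    {t : ℝ} (h0 : 0 ≤ t) (h1 : t ≤ 1) {s : Bool} (hs : s = true ↔ 1 / 2 ≤ t) :
    simplexSpline T K (edgePoint T e t) = area (triangle T) / area (hull T K) *
      (uniLen (K (edge e 0)) (K (edge e 2)) *
        uniSpl s t 5 (K (edge e 0)) (K (edge e 1)) (K (edge e 2))) := by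
  obtain ⟨c, h⟩ := exists_isApex hlow hoff
  have hA := (area_triangle_pos hT).ne'
  have hh := height_ne_zero h.notMem
  have hl : (uniLen (K (edge e 0)) (K (edge e 2)) : ℝ) ≠ 0 := by
    rw [uniLen]; split_ifs <;> norm_num
  rw [simplexSpline_eq_facePoly hT hK hlow hc (edgePoint_mem hT e h0 h1 hs), facePoly,
    h.area_hull hT hS, ← h.spl_mul_height hT s (co_edgePoint hT e t) 5 hK]
  field_simp

theorem simplexSpline_edgePoint_eq_zero (hT : AffineIndependent ℝ T) (hK : ∑ j, K j = 8)
    (hlow : LowSupp K) (hc : LineCond K) {e : Fin 3} (hoff : 2 ≤ off (edgeSet e) K)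
    {t : ℝ} (h0 : 0 ≤ t) (h1 : t ≤ 1) : simplexSpline T K (edgePoint T e t) = 0 := by
  have hs : decide (1 / 2 ≤ t) = true ↔ 1 / 2 ≤ t := decide_eq_true_iff
  rw [simplexSpline_eq_facePoly hT hK hlow hc (edgePoint_mem hT e h0 h1 hs), facePoly]
  apply spl_edge_eq_zero hT hK hlow e _ hoff
  rw [co_edgePoint, det_add_left, det_smul_left, det_smul_left, det_self_left, det_self_outer]
  ring

theorem exists_mesh_apex : ∀ (e : Fin 3) (c : Fin 10), (c : ℕ) < 6 → c ∉ edgeSet e →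
    ∃ m, edge e 1 ∈ lineSet (mesh m).1 (mesh m).2 ∧ c ∈ lineSet (mesh m).1 (mesh m).2 := by
  decide +kernel

/-- The line from the midpoint of the edge to the apex is an interior line. It carries at most three
knots if the midpoint is one, and the apex is one of them. -/
theorem IsApex.mid_le (hK : ∑ j, K j = 8) (hc : LineCond K) {e : Fin 3} {c : Fin 10}
    (h : IsApex e K c) : K (edge e 1) ≤ 2 := by
  by_cases h1 : K (edge e 1) = 0
  · omega
  obtain ⟨m, hm1, hm2⟩ := exists_mesh_apex e c (h.low.lt h.ne_zero) h.notMem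
  have hne : edge e 1 ≠ c := by
    rintro rfl; exact h.notMem (edge_mem e 1)
  have h5 := hc m ⟨_, _, h1, h.ne_zero, hm1, hm2, hne⟩
  have h6 := off_add_le (K := K) hm1 hm2 hne
  have := Nat.pos_of_ne_zero h.ne_zero
  omega

/-- With two or more knots off the edge the restriction is zero and both sides hold. With one, the
common area factor cancels, and evaluation at 1/4 and 3/4 reduces the claim to `exists_edgeCnt_eq`.
-/
theorem edge_iff (hT : AffineIndependent ℝ T) (hK : ∑ j, K j = 8)
    (hlow : LowSupp K) (hc : LineCond K) (hS : Spans K) (e : Fin 3) :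
    ((∀ t ∈ Set.Icc (0 : ℝ) 1, simplexSpline T K (edgePoint T e t) = 0) ∨
      ∃ r : Fin 8, ∀ t ∈ Set.Icc (0 : ℝ) 1, simplexSpline T K (edgePoint T e t)
        = area (triangle T) / area (hull T K) * bSpline 5 r t) ↔
    (off (edgeSet e) K = 1 →
      ∃ r, edgeCnt r = (K (edge e 0), K (edge e 1), K (edge e 2))) := by
  have hA := (area_triangle_pos hT).ne'
  have hH : area (hull T K) ≠ 0 := fun h => (area_hull_eq_zero_iff hT K).mp h hS
  have hq : area (triangle T) / area (hull T K) ≠ 0 := div_ne_zero hA hH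
  have hoff : off (edgeSet e) K ≠ 0 := fun h =>
    (isLine_edge e).not_spans (exists_det_edge e) h hS
  by_cases h1 : off (edgeSet e) K = 1
  swap
  · refine iff_of_true (.inl fun t ht => ?_) fun h => absurd h h1
    exact simplexSpline_edgePoint_eq_zero hT hK hlow hc (by omega) ht.1 ht.2
  have hval := fun {t : ℝ} {s : Bool} (h0 : 0 ≤ t) (h1' : t ≤ 1) (hs : s = true ↔ 1 / 2 ≤ t) =>
    simplexSpline_edgePoint hT hK hlow hc hS h1 h0 h1' hs
  have hsum := off_edgeSet_add e K
  rw [h1, hK] at hsum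
  rw [imp_iff_right h1]
  constructor
  · intro h
    obtain ⟨c, hap⟩ := exists_isApex hlow h1
    have hL : (false = true) ↔ (1 : ℝ) / 2 ≤ ((1 / 4 : ℚ) : ℝ) := by norm_num
    have hR : (true = true) ↔ (1 : ℝ) / 2 ≤ ((3 / 4 : ℚ) : ℝ) := by norm_num
    have iL : ((1 / 4 : ℚ) : ℝ) ∈ Set.Icc (0 : ℝ) 1 := by norm_num
    have iR : ((3 / 4 : ℚ) : ℝ) ∈ Set.Icc (0 : ℝ) 1 := by norm_num
    refine exists_edgeCnt_eq (by omega) (fun h7 => ?_) (hap.mid_le hK hc) (fun h7 => ?_) ?_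
    · refine hap.not_spans (w := edge e 0) (fun k hk => ?_) hS
      have e1 : K (edge e 1) = 0 := by omega
      have e2 : K (edge e 2) = 0 := by omega
      fin_cases k <;> simp_all
    · refine hap.not_spans (w := edge e 2) (fun k hk => ?_) hS
      have e1 : K (edge e 1) = 0 := by omega
      have e2 : K (edge e 0) = 0 := by omega
      fin_cases k <;> simp_all
    · simp only [uniVal, Prod.mk.injEq]
      rcases h with h | ⟨r, h⟩
      · left
        have l := h _ iL
        have r := h _ iR
        rw [hval iL.1 iL.2 hL, uniSpl_cast, mul_eq_zero] at l
        rw [hval iR.1 iR.2 hR, uniSpl_cast, mul_eq_zero] at r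
        have l := l.resolve_left hq
        have r := r.resolve_left hq
        exact ⟨by exact_mod_cast l, by exact_mod_cast r⟩
      · refine .inr ⟨r, ?_⟩
        have l := h _ iL
        have r := h _ iR
        rw [hval iL.1 iL.2 hL, uniSpl_cast, bSpline_five iL.1 iL.2 hL, uniSpl_cast] at l
        rw [hval iR.1 iR.2 hR, uniSpl_cast, bSpline_five iR.1 iR.2 hR, uniSpl_cast] at r
        have l := mul_left_cancel₀ hq l
        have r := mul_left_cancel₀ hq r
        exact ⟨by exact_mod_cast l, by exact_mod_cast r⟩
  · rintro ⟨r, hr⟩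
    refine .inr ⟨r, fun t ht => ?_⟩
    have hs : decide (1 / 2 ≤ t) = true ↔ 1 / 2 ≤ t := decide_eq_true_iff
    rw [hval ht.1 ht.2 hs, bSpline_five ht.1 ht.2 hs, hr]

theorem reducesToBSpline_iff (hT : AffineIndependent ℝ T) (hK : ∑ j, K j = 8)
    (hlow : LowSupp K) (hc : LineCond K) (hS : Spans K) : ReducesToBSpline T K ↔ EdgeCond K := by
  have hik : ∀ i k : Fin 3, i < k → ∃ e, edgeCorner e = (i, k) := by decide
  have hlt : ∀ e, (edgeCorner e).1 < (edgeCorner e).2 := by decide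
  simp only [EdgeCond, ← edge_iff hT hK hlow hc hS]
  constructor
  · intro h e
    exact h _ _ (hlt e)
  · intro h i k hlt'
    obtain ⟨e, he⟩ := hik i k hlt'
    have := h e
    simp only [edgePoint, he] at this
    exact this

end

/-! ### Exclusion of the vertices v₇, …, v₁₀ -/

section

variable {K : Knots}

theorem exists_meshProbe : ∀ (m : Fin 6) (x y : Fin 10), x ∈ lineSet (mesh m).1 (mesh m).2 →
    y ∈ lineSet (mesh m).1 (mesh m).2 → x ≠ y → ∃ i : Fin 15,
      lineSet (meshProbe i).1 (meshProbe i).2.1 = lineSet (mesh m).1 (mesh m).2 ∧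
      Opposite (meshProbe i).1 (meshProbe i).2.1 (meshProbe i).2.2 x y := by
  decide +kernel

theorem lineCond_of_mem_splineSpace (hT : AffineIndependent ℝ T) (hK : ∑ j, K j = 8)
    (hS : Spans K) (hC : simplexSpline T K ∈ splineSpace T 3 5) : LineCond K := by
  rintro m ⟨x, y, hx, hy, hxL, hyL, hxy⟩
  obtain ⟨i, hL, ho⟩ := exists_meshProbe m x y hxL hyL hxy
  have := four_lt_off hT hK hS hC i ⟨x, y, hx, hy, ho⟩
  rwa [hL] at this

theorem off_mesh (K : Knots) :
    off (lineSet (mesh 0).1 (mesh 0).2) K = K 1 + K 2 + K 3 + K 5 + K 7 + K 8 ∧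
    off (lineSet (mesh 1).1 (mesh 1).2) K = K 0 + K 2 + K 3 + K 4 + K 6 + K 8 ∧
    off (lineSet (mesh 2).1 (mesh 2).2) K = K 0 + K 1 + K 4 + K 5 + K 6 + K 7 ∧
    off (lineSet (mesh 3).1 (mesh 3).2) K = K 0 + K 1 + K 2 + K 4 + K 7 + K 8 + K 9 ∧
    off (lineSet (mesh 4).1 (mesh 4).2) K = K 0 + K 1 + K 2 + K 5 + K 6 + K 8 + K 9 ∧
    off (lineSet (mesh 5).1 (mesh 5).2) K = K 0 + K 1 + K 2 + K 3 + K 6 + K 7 + K 9 := by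
  have h : (lineSet (mesh 0).1 (mesh 0).2)ᶜ = {1, 2, 3, 5, 7, 8} ∧
      (lineSet (mesh 1).1 (mesh 1).2)ᶜ = {0, 2, 3, 4, 6, 8} ∧
      (lineSet (mesh 2).1 (mesh 2).2)ᶜ = {0, 1, 4, 5, 6, 7} ∧
      (lineSet (mesh 3).1 (mesh 3).2)ᶜ = {0, 1, 2, 4, 7, 8, 9} ∧
      (lineSet (mesh 4).1 (mesh 4).2)ᶜ = {0, 1, 2, 5, 6, 8, 9} ∧
      (lineSet (mesh 5).1 (mesh 5).2)ᶜ = {0, 1, 2, 3, 6, 7, 9} := by decide +kernel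
  obtain ⟨h0, h1, h2, h3, h4, h5⟩ := h
  simp only [off, h0, h1, h2, h3, h4, h5]
  refine ⟨?_, ?_, ?_, ?_, ?_, ?_⟩ <;> simp [add_assoc]

theorem LineCond.le (h : LineCond K) (m : Fin 6) (x y : Fin 10)
    (hxy : x ∈ lineSet (mesh m).1 (mesh m).2 ∧ y ∈ lineSet (mesh m).1 (mesh m).2 ∧ x ≠ y) :
    K x = 0 ∨ K y = 0 ∨ 5 ≤ off (lineSet (mesh m).1 (mesh m).2) K := by
  by_contra! hcon
  exact absurd (h m ⟨x, y, hcon.1, hcon.2.1, hxy⟩) (not_le.mpr hcon.2.2)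

theorem off_mesh_ne_zero (hS : Spans K) (m : Fin 6) :
    off (lineSet (mesh m).1 (mesh m).2) K ≠ 0 := by
  have hne : ∀ m, (mesh m).1 ≠ (mesh m).2 := by decide
  obtain ⟨k, hk⟩ := exists_det_ne_zero (hne m)
  exact fun h => isLine_lineSet.not_spans ⟨_, hk⟩ h hS

/-- Pairs of vertices that are not both knots of a spline on the 12-split. -/
def farPair : Fin 9 → Fin 10 × Fin 10 :=
  ![(6, 1), (6, 2), (7, 0), (7, 2), (8, 0), (8, 1), (6, 7), (6, 8), (7, 8)]

theorem opposite_farPair : ∀ i, Opposite (faceProbe i).1.1 (faceProbe i).1.2.1 (faceProbe i).1.2.2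
    (farPair i).1 (farPair i).2 := by
  decide +kernel

/-- If v₇ is a knot, the excluded pairs leave only knots on the two interior lines through v₇. As
the knots are not collinear, each of these lines carries a second distinct knot, so at least five
knots are off each; these two groups are disjoint, but there are only eight knots. The vertices v₈
and v₉ are symmetric. -/
theorem lowSupp_of_mem_splineSpace (hT : AffineIndependent ℝ T) (hK : ∑ j, K j = 8)
    (hS : Spans K) (hC : simplexSpline T K ∈ splineSpace T 3 5) : LowSupp K := by
  have hL := lineCond_of_mem_splineSpace hT hK hS hC
  have hF : ∀ i, K (farPair i).1 = 0 ∨ K (farPair i).2 = 0 := by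
    intro i
    by_contra! h
    exact not_hasPair_faceProbe hT hK hS hC i ⟨_, _, h.1, h.2, opposite_farPair i⟩
  obtain ⟨o0, o1, o2, o3, o4, o5⟩ := off_mesh K
  have hn := off_mesh_ne_zero hS
  have n0 := hn 0
  have n1 := hn 1
  have n2 := hn 2
  have n3 := hn 3
  have n4 := hn 4
  have n5 := hn 5
  rw [o0] at n0; rw [o1] at n1; rw [o2] at n2; rw [o3] at n3; rw [o4] at n4; rw [o5] at n5
  have l0 := hL.le 0
  have l1 := hL.le 1
  have l2 := hL.le 2
  have l3 := hL.le 3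
  have l4 := hL.le 4
  have l5 := hL.le 5
  rw [o0] at l0; rw [o1] at l1; rw [o2] at l2; rw [o3] at l3; rw [o4] at l4; rw [o5] at l5
  have f0 : K 6 = 0 ∨ K 1 = 0 := hF 0
  have f1 : K 6 = 0 ∨ K 2 = 0 := hF 1
  have f2 : K 7 = 0 ∨ K 0 = 0 := hF 2
  have f3 : K 7 = 0 ∨ K 2 = 0 := hF 3
  have f4 : K 8 = 0 ∨ K 0 = 0 := hF 4
  have f5 : K 8 = 0 ∨ K 1 = 0 := hF 5
  have f6 : K 6 = 0 ∨ K 7 = 0 := hF 6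
  have f7 : K 6 = 0 ∨ K 8 = 0 := hF 7
  have f8 : K 7 = 0 ∨ K 8 = 0 := hF 8
  have hK' : K 0 + K 1 + K 2 + K 3 + K 4 + K 5 + K 6 + K 7 + K 8 + K 9 = 8 := by
    rw [← hK]; simp [Fin.sum_univ_succ]; ring
  have z6 : K 6 = 0 := by
    by_contra h
    have e1 := f0.resolve_left h
    have e2 := f1.resolve_left h
    have e7 := f6.resolve_left h
    have e8 := f7.resolve_left h
    have a0 := (l0 6 0 (by decide +kernel)).resolve_left h
    have a1 := (l0 6 9 (by decide +kernel)).resolve_left h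
    have a2 := (l0 6 4 (by decide +kernel)).resolve_left h
    have a3 := (l3 6 3 (by decide +kernel)).resolve_left h
    have a4 := (l3 6 5 (by decide +kernel)).resolve_left h
    clear hn l0 l1 l2 l3 l4 l5 o0 o1 o2 o3 o4 o5 hF f0 f1 f2 f3 f4 f5 f6 f7 f8
    omega
  have z7 : K 7 = 0 := by
    by_contra h
    have e1 := f2.resolve_left h
    have e2 := f3.resolve_left h
    have e8 := f8.resolve_left h
    have a0 := (l1 7 1 (by decide +kernel)).resolve_left h
    have a1 := (l1 7 9 (by decide +kernel)).resolve_left h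
    have a2 := (l1 7 5 (by decide +kernel)).resolve_left h
    have a3 := (l4 7 3 (by decide +kernel)).resolve_left h
    have a4 := (l4 7 4 (by decide +kernel)).resolve_left h
    clear hn l0 l1 l2 l3 l4 l5 o0 o1 o2 o3 o4 o5 hF f0 f1 f2 f3 f4 f5 f6 f7 f8
    omega
  have z8 : K 8 = 0 := by
    by_contra h
    have e1 := f4.resolve_left h
    have e2 := f5.resolve_left h
    have a0 := (l2 8 2 (by decide +kernel)).resolve_left h
    have a1 := (l2 8 9 (by decide +kernel)).resolve_left h
    have a2 := (l2 8 3 (by decide +kernel)).resolve_left h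
    have a3 := (l5 8 4 (by decide +kernel)).resolve_left h
    have a4 := (l5 8 5 (by decide +kernel)).resolve_left h
    clear hn l0 l1 l2 l3 l4 l5 o0 o1 o2 o3 o4 o5 hF f0 f1 f2 f3 f4 f5 f6 f7 f8
    omega
  -- At least two medians carry a further knot besides the centroid, and each such median carries at
  -- most three knots in all. Counting the shared centroid once leaves at most seven knots.
  have z9 : K 9 = 0 := by
    by_contra h
    have a0 := (l0 9 0 (by decide +kernel)).resolve_left h
    have a1 := (l0 9 4 (by decide +kernel)).resolve_left h
    have a2 := (l1 9 1 (by decide +kernel)).resolve_left h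
    have a3 := (l1 9 5 (by decide +kernel)).resolve_left h
    have a4 := (l2 9 2 (by decide +kernel)).resolve_left h
    have a5 := (l2 9 3 (by decide +kernel)).resolve_left h
    clear hn l0 l1 l2 l3 l4 l5 o0 o1 o2 o3 o4 o5 hF f0 f1 f2 f3 f4 f5 f6 f7 f8
    omega
  intro j hj
  fin_cases j
  all_goals first | (exfalso; revert hj; decide) | assumption

end

/-! ### Symmetries and the finite enumeration -/

section

variable {K : Knots}

/-- The symmetries as maps of the vertices. -/
def symFun : Fin 6 → Fin 10 → Fin 10 :=
  ![![0, 1, 2, 3, 4, 5, 6, 7, 8, 9], ![1, 0, 2, 3, 5, 4, 7, 6, 8, 9],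
    ![2, 1, 0, 4, 3, 5, 8, 7, 6, 9], ![0, 2, 1, 5, 4, 3, 6, 8, 7, 9],
    ![1, 2, 0, 4, 5, 3, 7, 8, 6, 9], ![2, 0, 1, 5, 3, 4, 8, 6, 7, 9]]

/-- The index of the inverse of a symmetry. -/
def symInv : Fin 6 → Fin 6 := ![0, 1, 2, 3, 5, 4]

/-- The symmetries. -/
def sym (g : Fin 6) : Equiv.Perm (Fin 10) where
  toFun := symFun g
  invFun := symFun (symInv g)
  left_inv := by revert g; decide
  right_inv := by revert g; decide

theorem permute_sym (g : Fin 6) (K : Knots) : permute (sym g) K = fun i => K (symFun (symInv g) i) :=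
  rfl

theorem bary_injective : ∀ i j : Fin 10, (∀ k, bary i k = bary j k) → i = j := by decide +kernel

/-- A symmetry is determined by its action on the corners, since the barycentric coordinates
distinguish the vertices; this makes the group enumerable. -/
theorem isSymmetry_iff {π : Equiv.Perm (Fin 10)} : IsSymmetry π ↔ ∃ g, π = sym g := by
  constructor
  · rintro ⟨τ, hτ⟩
    have h : ∀ τ : Equiv.Perm (Fin 3), ∃ g : Fin 6, ∀ i k, bary (symFun g i) (τ k) = bary i k := by
      decide +kernel
    obtain ⟨g, hg⟩ := h τ
    refine ⟨g, Equiv.ext fun i => bary_injective _ _ fun k => ?_⟩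
    obtain ⟨k, rfl⟩ := τ.surjective k
    rw [hτ]
    exact (hg i k).symm
  · rintro ⟨g, rfl⟩
    have h : ∀ g : Fin 6, ∃ τ : Equiv.Perm (Fin 3), ∀ i k, bary (symFun g i) (τ k) = bary i k := by
      decide +kernel
    exact h g

/-- The multiplicities of the knots of a `C³` quintic simplex spline that reduces to a B-spline
on the boundary. -/
def Adm (a b c d e f : ℕ) : Prop :=
  ((a = 0 ∨ e = 0 ∨ a + e ≤ 3) ∧ (b = 0 ∨ f = 0 ∨ b + f ≤ 3) ∧ (c = 0 ∨ d = 0 ∨ c + d ≤ 3) ∧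
    (d = 0 ∨ f = 0 ∨ d + f ≤ 3) ∧ (d = 0 ∨ e = 0 ∨ d + e ≤ 3) ∧ (e = 0 ∨ f = 0 ∨ e + f ≤ 3)) ∧
  ((a + d + b = 7 → ∃ r : Fin 8, edgeCnt r = (a, d, b)) ∧
    (a + f + c = 7 → ∃ r : Fin 8, edgeCnt r = (a, f, c)) ∧
    (b + e + c = 7 → ∃ r : Fin 8, edgeCnt r = (b, e, c)))

/-- The knots lie on none of the lines of the 12-split. -/
def OffLines (a b c d e f : ℕ) : Prop :=
  a + d + b < 8 ∧ a + f + c < 8 ∧ b + e + c < 8 ∧ a + e < 8 ∧ b + f < 8 ∧ c + d < 8 ∧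
    d + f < 8 ∧ d + e < 8 ∧ e + f < 8

instance (a b c d e f : ℕ) : Decidable (Adm a b c d e f) := by unfold Adm; infer_instance

instance (a b c d e f : ℕ) : Decidable (OffLines a b c d e f) := by unfold OffLines; infer_instance

/-- Whether the multiset is, up to a symmetry, in the table. -/
def InTable (a b c d e f : ℕ) : Prop :=
  ∃ (p : Fin 20) (g : Fin 6), ∀ i, (![a, b, c, d, e, f] : Fin 6 → ℕ) i =
    permute (sym g) (table p) (Fin.castLE (by decide) i)

instance (a b c d e f : ℕ) : Decidable (InTable a b c d e f) := by unfold InTable; infer_instance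

-- An exhaustive check of all ways to write eight as an ordered sum of six multiplicities; the last
-- one is eliminated by the total.
set_option synthInstance.maxHeartbeats 200000 in
set_option synthInstance.maxSize 1000 in
theorem exists_eq_of_adm_aux : ∀ a < 9, ∀ b < 9 - a, ∀ c < 9 - a - b, ∀ d < 9 - a - b - c,
    ∀ e < 9 - a - b - c - d, Adm a b c d e (8 - a - b - c - d - e) →
      OffLines a b c d e (8 - a - b - c - d - e) →
      InTable a b c d e (8 - a - b - c - d - e) := by
  decide +kernel

theorem adm_table : ∀ (p : Fin 20) (g : Fin 6), Adm (permute (sym g) (table p) 0)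
    (permute (sym g) (table p) 1) (permute (sym g) (table p) 2) (permute (sym g) (table p) 3)
    (permute (sym g) (table p) 4) (permute (sym g) (table p) 5) := by
  decide +kernel

theorem sum_table : ∀ (p : Fin 20) (g : Fin 6), ∑ j, permute (sym g) (table p) j = 8 := by
  decide +kernel

theorem lowSupp_table (p : Fin 20) (g : Fin 6) : LowSupp (permute (sym g) (table p)) := by
  have h : ∀ (p : Fin 20) (g : Fin 6) (j : Fin 10), 6 ≤ (j : ℕ) →
    permute (sym g) (table p) j = 0 := by decide +kernel
  exact h p g

theorem spans_table (p : Fin 20) (g : Fin 6) : Spans (permute (sym g) (table p)) := by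
  have h : ∀ (p : Fin 20), ∃ i j k, table p i ≠ 0 ∧ table p j ≠ 0 ∧ table p k ≠ 0 ∧
    ∀ g, detQ (bary (symFun g i)) (bary (symFun g j)) (bary (symFun g k)) ≠ 0 := by decide +kernel
  obtain ⟨i, j, k, hi, hj, hk, hd⟩ := h p
  have e : ∀ l, permute (sym g) (table p) (sym g l) = table p l := fun l => by simp [permute]
  refine ⟨sym g i, sym g j, sym g k, by rwa [e], by rwa [e], by rwa [e], ?_⟩
  rw [det_V]
  exact_mod_cast hd g

theorem sum_low (hK : ∑ j, K j = 8) (hlow : LowSupp K) :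
    K 0 + K 1 + K 2 + K 3 + K 4 + K 5 = 8 := by
  rw [← hK]
  simp only [Fin.sum_univ_succ]
  simp [hlow 6 (by decide), hlow 7 (by decide), hlow 8 (by decide), hlow 9 (by decide)]
  ring

theorem edgeCond_iff (hK : ∑ j, K j = 8) : EdgeCond K ↔
    (K 0 + K 3 + K 1 = 7 → ∃ r : Fin 8, edgeCnt r = (K 0, K 3, K 1)) ∧
    (K 0 + K 5 + K 2 = 7 → ∃ r : Fin 8, edgeCnt r = (K 0, K 5, K 2)) ∧
    (K 1 + K 4 + K 2 = 7 → ∃ r : Fin 8, edgeCnt r = (K 1, K 4, K 2)) := by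
  have h : ∀ e, off (edgeSet e) K = 1 ↔ K (edge e 0) + K (edge e 1) + K (edge e 2) = 7 := by
    intro e
    have := off_edgeSet_add e K
    omega
  simp only [EdgeCond, h]
  constructor
  · intro h'
    exact ⟨h' 0, h' 1, h' 2⟩
  · rintro ⟨h0, h1, h2⟩ e
    fin_cases e
    exacts [h0, h1, h2]

theorem off_mesh_add (hK : ∑ j, K j = 8) (hlow : LowSupp K) (m : Fin 6) :
    off (lineSet (mesh m).1 (mesh m).2) K + (K (mesh m).1 + K (mesh m).2) = 8 := by
  have hm : ∀ (m : Fin 6) (x : Fin 10), (x : ℕ) < 6 → x ∈ lineSet (mesh m).1 (mesh m).2 →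
      x = (mesh m).1 ∨ x = (mesh m).2 := by
    decide +kernel
  have hne : ∀ m, (mesh m).1 ≠ (mesh m).2 := by decide
  rw [← hK, off, ← Finset.sum_compl_add_sum (lineSet (mesh m).1 (mesh m).2),
    ← Finset.sum_pair (hne m)]
  congr 1
  refine Finset.sum_subset (fun x hx => ?_) fun x hx hx' => ?_
  · rcases Finset.mem_insert.mp hx with rfl | hx
    · exact left_mem_lineSet _ _
    · rw [Finset.mem_singleton.mp hx]
      exact right_mem_lineSet _ _
  · by_contra h
    apply hx'
    rcases hm m x (hlow.lt h) hx with rfl | rfl <;> simp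

theorem lineCond_iff_forall (hK : ∑ j, K j = 8) (hlow : LowSupp K) : LineCond K ↔
    ∀ m, K (mesh m).1 = 0 ∨ K (mesh m).2 = 0 ∨ K (mesh m).1 + K (mesh m).2 ≤ 3 := by
  have hne : ∀ m, (mesh m).1 ≠ (mesh m).2 := by decide
  constructor
  · intro h m
    have h1 := h.le m _ _ ⟨left_mem_lineSet _ _, right_mem_lineSet _ _, hne m⟩
    have h2 := off_mesh_add hK hlow m
    omega
  · rintro h m ⟨x, y, hx, hy, hxL, hyL, hxy⟩
    have h1 := h m
    have h2 := off_mesh_add hK hlow m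
    have hm : ∀ (m : Fin 6) (x y : Fin 10), (x : ℕ) < 6 → (y : ℕ) < 6 →
        x ∈ lineSet (mesh m).1 (mesh m).2 → y ∈ lineSet (mesh m).1 (mesh m).2 → x ≠ y →
        (x = (mesh m).1 ∧ y = (mesh m).2) ∨ (x = (mesh m).2 ∧ y = (mesh m).1) := by
      decide +kernel
    rcases hm m x y (hlow.lt hx) (hlow.lt hy) hxL hyL hxy with ⟨rfl, rfl⟩ | ⟨rfl, rfl⟩ <;> omega

theorem lineCond_iff (hK : ∑ j, K j = 8) (hlow : LowSupp K) : LineCond K ↔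
    ((K 0 = 0 ∨ K 4 = 0 ∨ K 0 + K 4 ≤ 3) ∧ (K 1 = 0 ∨ K 5 = 0 ∨ K 1 + K 5 ≤ 3) ∧
    (K 2 = 0 ∨ K 3 = 0 ∨ K 2 + K 3 ≤ 3) ∧ (K 3 = 0 ∨ K 5 = 0 ∨ K 3 + K 5 ≤ 3) ∧
    (K 3 = 0 ∨ K 4 = 0 ∨ K 3 + K 4 ≤ 3) ∧ (K 4 = 0 ∨ K 5 = 0 ∨ K 4 + K 5 ≤ 3)) := by
  rw [lineCond_iff_forall hK hlow]
  constructor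
  · intro h
    exact ⟨h 0, h 1, h 2, h 3, h 4, h 5⟩
  · rintro ⟨h0, h1, h2, h3, h4, h5⟩ m
    fin_cases m
    exacts [h0, h1, h2, h3, h4, h5]

theorem offLines_of_spans (hK : ∑ j, K j = 8) (hlow : LowSupp K) (hS : Spans K) :
    OffLines (K 0) (K 1) (K 2) (K 3) (K 4) (K 5) := by
  have hs := sum_low hK hlow
  have he : ∀ e, off (edgeSet e) K ≠ 0 := fun e h =>
    (isLine_edge e).not_spans (exists_det_edge e) h hS
  have e0 := off_edgeSet_add 0 K
  have e1 := off_edgeSet_add 1 K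
  have e2 := off_edgeSet_add 2 K
  rw [hK] at e0 e1 e2
  have n0 := he 0
  have n1 := he 1
  have n2 := he 2
  have s0 : K (edge 0 0) = K 0 ∧ K (edge 0 1) = K 3 ∧ K (edge 0 2) = K 1 := ⟨rfl, rfl, rfl⟩
  have s1 : K (edge 1 0) = K 0 ∧ K (edge 1 1) = K 5 ∧ K (edge 1 2) = K 2 := ⟨rfl, rfl, rfl⟩
  have s2 : K (edge 2 0) = K 1 ∧ K (edge 2 1) = K 4 ∧ K (edge 2 2) = K 2 := ⟨rfl, rfl, rfl⟩
  have hm : ∀ m, K (mesh m).1 + K (mesh m).2 < 8 := by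
    intro m
    have h1 := off_mesh_add hK hlow m
    have h2 := off_mesh_ne_zero hS m
    omega
  have m0 : K 0 + K 4 < 8 := hm 0
  have m1 : K 1 + K 5 < 8 := hm 1
  have m2 : K 2 + K 3 < 8 := hm 2
  have m3 : K 3 + K 5 < 8 := hm 3
  have m4 : K 3 + K 4 < 8 := hm 4
  have m5 : K 4 + K 5 < 8 := hm 5
  refine ⟨?_, ?_, ?_, ?_, ?_, ?_, ?_, ?_, ?_⟩ <;> omega

theorem exists_eq_of_adm (hK : ∑ j, K j = 8) (hlow : LowSupp K) (hS : Spans K) (hc : LineCond K)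
    (he : EdgeCond K) : ∃ (p : Fin 20) (g : Fin 6), K = permute (sym g) (table p) := by
  have hs := sum_low hK hlow
  have h6 : 8 - K 0 - K 1 - K 2 - K 3 - K 4 = K 5 := by omega
  have := exists_eq_of_adm_aux (K 0) (by omega) (K 1) (by omega) (K 2) (by omega) (K 3) (by omega)
    (K 4) (by omega)
  rw [h6] at this
  obtain ⟨p, g, h⟩ := this ⟨(lineCond_iff hK hlow).mp hc, (edgeCond_iff hK).mp he⟩
    (offLines_of_spans hK hlow hS)
  refine ⟨p, g, ?_⟩
  have hl := lowSupp_table p g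
  ext i
  rcases lt_or_ge (i : ℕ) 6 with hi | hi
  · rw [show i = Fin.castLE (by decide) (⟨i, hi⟩ : Fin 6) from rfl, ← h ⟨i, hi⟩]
    generalize (⟨i, hi⟩ : Fin 6) = j
    fin_cases j <;> rfl
  · rw [hl i hi, hlow i hi]

/-- The multisets of knots of the `C³` quintic simplex splines on the 12-split that reduce to a
B-spline on the boundary. -/
theorem isC3QuinticSimplexSpline_and_iff (hT : AffineIndependent ℝ T) (K : Knots) :
    IsC3QuinticSimplexSpline T K ∧ ReducesToBSpline T K ↔
      ∃ (p : Fin 20) (g : Fin 6), K = permute (sym g) (table p) := by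
  constructor
  · rintro ⟨⟨hK, hA, hC⟩, hR⟩
    have hS : Spans K := not_not.mp fun h => hA ((area_hull_eq_zero_iff hT K).mpr h)
    have hlow := lowSupp_of_mem_splineSpace hT hK hS hC
    have hc := lineCond_of_mem_splineSpace hT hK hS hC
    exact exists_eq_of_adm hK hlow hS hc ((reducesToBSpline_iff hT hK hlow hc hS).mp hR)
  · rintro ⟨p, g, rfl⟩
    have hK := sum_table p g
    have hlow := lowSupp_table p g
    have hS := spans_table p g
    have hc := (lineCond_iff hK hlow).mpr (adm_table p g).1
    exact ⟨⟨hK, fun h => (area_hull_eq_zero_iff hT _).mp h hS,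
      simplexSpline_mem_splineSpace hT hK hlow hc⟩,
      (reducesToBSpline_iff hT hK hlow hc hS).mpr ((edgeCond_iff hK).mpr (adm_table p g).2)⟩

end

/-! ### Jumps as invariants and the distinctness of the classes -/

section

variable {K K' : Knots}

/-- Two simplex splines that agree have the same jumps. -/
theorem hasPair_and_off_eq (hT : AffineIndependent ℝ T) {a b c : Fin 10} (h : IsProbe a b c)
    (hK : ∑ j, K j = 8) (hS : Spans K) (hK' : ∑ j, K' j = 8) (hS' : Spans K')
    (heq : simplexSpline T K = simplexSpline T K') (hp : HasPair (Opposite a b c) K) :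
    HasPair (Opposite a b c) K' ∧ off (lineSet a b) K = off (lineSet a b) K' := by
  obtain ⟨δ, hδ, P, M, R, h1, h2, h3, h4, -⟩ := exists_probe_jump hT h hK hS
  obtain ⟨δ', hδ', P', M', R', h1', h2', h3', h4', h5'⟩ := exists_probe_jump hT h hK' hS'
  have hmin : 0 < min δ δ' := lt_min hδ hδ'
  have hP : P = P' := by
    refine Polynomial.eq_of_infinite_eval_eq _ _ ((Set.Ioo_infinite hmin).mono fun t ht => ?_)
    have ha := h1 t ⟨ht.1, ht.2.trans_le (min_le_left _ _)⟩
    have hb := h1' t ⟨ht.1, ht.2.trans_le (min_le_right _ _)⟩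
    rw [heq] at ha
    exact ha.symm.trans hb
  have hM : M = M' := by
    refine Polynomial.eq_of_infinite_eval_eq _ _
      ((Set.Ioo_infinite (neg_lt_zero.mpr hmin)).mono fun t ht => ?_)
    have ha := h2 t ⟨(neg_le_neg (min_le_left _ _)).trans_lt ht.1, ht.2⟩
    have hb := h2' t ⟨(neg_le_neg (min_le_right _ _)).trans_lt ht.1, ht.2⟩
    rw [heq] at ha
    exact ha.symm.trans hb
  have hR := h4 hp
  rw [hP, hM, h3'] at h3
  have hne : ∀ {Q : Polynomial ℝ}, Q.eval 0 ≠ 0 → Q ≠ 0 := by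
    rintro Q hQ rfl; simp at hQ
  have hp' : HasPair (Opposite a b c) K' := by
    by_contra hp'
    rw [h5' hp', mul_zero] at h3
    exact mul_ne_zero (pow_ne_zero _ Polynomial.X_ne_zero) (hne hR) h3.symm
  refine ⟨hp', ?_⟩
  have hR' := h4' hp'
  have ho : ∀ {K}, Spans K → off (lineSet a b) K ≠ 0 := fun hS h0 =>
    isLine_lineSet.not_spans ⟨_, h.pos.ne'⟩ h0 hS
  have hdeg : ∀ (n : ℕ) {Q : Polynomial ℝ}, Q.eval 0 ≠ 0 →
      (Polynomial.X ^ n * Q).natTrailingDegree = n := by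
    intro n Q hQ
    rw [mul_comm, Polynomial.natTrailingDegree_mul_X_pow (hne hQ),
      Polynomial.natTrailingDegree_eq_zero.mpr (.inr (by
        rwa [Polynomial.coeff_zero_eq_eval_zero])), zero_add]
  -- The common order of vanishing is the truncated difference off − 1, so both counts must be known
  -- to be positive before they can be equated.
  have := congrArg Polynomial.natTrailingDegree h3
  rw [hdeg _ hR, hdeg _ hR'] at this
  have := ho hS
  have := ho hS'
  omega

/-- Probes that tell the splines in the table apart. -/
def edgeProbe : Fin 12 → Fin 10 × Fin 10 × Fin 10 :=
  ![(0, 3, 2), (3, 1, 2), (1, 4, 0), (4, 2, 0), (5, 0, 1), (2, 5, 1),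
    (6, 9, 2), (7, 9, 0), (8, 9, 1), (3, 6, 0), (3, 7, 0), (4, 8, 0)]

/-- The corners and midpoints on the two sides of a probe. -/
def probeSide : Fin 12 → Finset (Fin 10) × Finset (Fin 10) :=
  ![({0}, {3, 1}), ({0, 3}, {1}), ({1}, {4, 2}), ({1, 4}, {2}), ({2, 5}, {0}), ({2}, {5, 0}),
    ({0}, {4}), ({1}, {5}), ({2}, {3}), ({3}, {5}), ({3}, {4}), ({4}, {5})]

/-- The number of knots on the line of a probe, or zero if there is no jump. -/
def jump (i : Fin 12) (K : Knots) : ℕ :=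
  if ∑ j ∈ (probeSide i).1, K j = 0 ∨ ∑ j ∈ (probeSide i).2, K j = 0 then 0
  else ∑ j ∈ (probeSide i).1, K j + ∑ j ∈ (probeSide i).2, K j

/-- Half of the probes cross the boundary of the triangle. Since equality of splines is equality on
the whole plane, the jump to zero outside is an invariant as well. -/
theorem isProbe_edgeProbe : ∀ i, IsProbe (edgeProbe i).1 (edgeProbe i).2.1 (edgeProbe i).2.2 := by
  decide +kernel

theorem opposite_edgeProbe : ∀ (i : Fin 12) (x y : Fin 10), (x : ℕ) < 6 → (y : ℕ) < 6 →
    (Opposite (edgeProbe i).1 (edgeProbe i).2.1 (edgeProbe i).2.2 x y ↔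
      x ∈ (probeSide i).1 ∧ y ∈ (probeSide i).2 ∨ y ∈ (probeSide i).1 ∧ x ∈ (probeSide i).2) := by
  decide +kernel

theorem probeSide_low : ∀ (i : Fin 12) (x : Fin 10),
    x ∈ (probeSide i).1 ∨ x ∈ (probeSide i).2 → (x : ℕ) < 6 := by
  decide +kernel

theorem lineSet_edgeProbe : ∀ (i : Fin 12) (x : Fin 10), (x : ℕ) < 6 →
    (x ∈ lineSet (edgeProbe i).1 (edgeProbe i).2.1 ↔
      x ∈ (probeSide i).1 ∨ x ∈ (probeSide i).2) := by
  decide +kernel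

theorem hasPair_edgeProbe_iff (hlow : LowSupp K) (i : Fin 12) :
    HasPair (Opposite (edgeProbe i).1 (edgeProbe i).2.1 (edgeProbe i).2.2) K ↔
      ∑ j ∈ (probeSide i).1, K j ≠ 0 ∧ ∑ j ∈ (probeSide i).2, K j ≠ 0 := by
  simp only [ne_eq, Finset.sum_eq_zero_iff, not_forall]
  constructor
  · rintro ⟨x, y, hx, hy, h⟩
    rcases (opposite_edgeProbe i x y (hlow.lt hx) (hlow.lt hy)).mp h with h | h
    exacts [⟨⟨x, h.1, hx⟩, ⟨y, h.2, hy⟩⟩, ⟨⟨y, h.1, hy⟩, ⟨x, h.2, hx⟩⟩]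
  · rintro ⟨⟨x, hx, hx'⟩, ⟨y, hy, hy'⟩⟩
    exact ⟨x, y, hx', hy', (opposite_edgeProbe i x y (hlow.lt hx') (hlow.lt hy')).mpr
      (.inl ⟨hx, hy⟩)⟩

theorem off_edgeProbe_add (hlow : LowSupp K) (i : Fin 12) :
    off (lineSet (edgeProbe i).1 (edgeProbe i).2.1) K +
      (∑ j ∈ (probeSide i).1, K j + ∑ j ∈ (probeSide i).2, K j) = ∑ j, K j := by
  have hd : ∀ i, Disjoint (probeSide i).1 (probeSide i).2 := by decide
  rw [← Finset.sum_union (hd i), off,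
    ← Finset.sum_compl_add_sum (lineSet (edgeProbe i).1 (edgeProbe i).2.1)]
  congr 1
  refine Finset.sum_subset (fun x hx => ?_) fun x hx hx' => ?_
  · have hx := Finset.mem_union.mp hx
    exact (lineSet_edgeProbe i x (probeSide_low i x hx)).mpr hx
  · by_contra h
    exact hx' (Finset.mem_union.mpr ((lineSet_edgeProbe i x (hlow.lt h)).mp hx))

theorem jump_eq (hT : AffineIndependent ℝ T) (hK : ∑ j, K j = 8) (hS : Spans K) (hlow : LowSupp K)
    (hK' : ∑ j, K' j = 8) (hS' : Spans K') (hlow' : LowSupp K')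
    (heq : simplexSpline T K = simplexSpline T K') (i : Fin 12) : jump i K = jump i K' := by
  have h1 := hasPair_and_off_eq hT (isProbe_edgeProbe i) hK hS hK' hS' heq
  have h2 := hasPair_and_off_eq hT (isProbe_edgeProbe i) hK' hS' hK hS heq.symm
  have o := off_edgeProbe_add hlow i
  have o' := off_edgeProbe_add hlow' i
  rw [hasPair_edgeProbe_iff hlow, hasPair_edgeProbe_iff hlow'] at h1 h2
  unfold jump
  split_ifs with c c' c'
  · rfl
  · exact absurd (h2 (not_or.mp c')).1 (fun h => c.elim h.1 h.2)
  · exact absurd (h1 (not_or.mp c)).1 (fun h => c'.elim h.1 h.2)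
  · have := (h1 (not_or.mp c)).2
    omega

/-- A finite check that the twelve jump counts separate the orbits, with the symmetry applied to
only one of the two multisets. -/
theorem eq_of_jump_eq : ∀ (p q : Fin 20) (g : Fin 6),
    (∀ i, jump i (permute (sym g) (table p)) = jump i (table q)) → p = q := by
  decide +kernel

end

end PS12

end

/-- Up to the `S₃` symmetry, the table lists exactly the `C³` quintic simplex splines on the
Powell-Sabin 12-split of a triangle that reduce to a B-spline on the boundary, with exactly one
representative for each `S₃` equivalence class. -/
theorem mainTheorem4 (T : Fin 3 → PS12.Plane) (hT : AffineIndependent ℝ T) :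
    (∀ K : PS12.Knots,
      (PS12.IsC3QuinticSimplexSpline T K ∧ PS12.ReducesToBSpline T K) ↔
        ∃ (p : Fin 20) (π : Equiv.Perm (Fin 10)),
          PS12.IsSymmetry π ∧ K = PS12.permute π (PS12.table p)) ∧
    (∀ (p q : Fin 20) (π : Equiv.Perm (Fin 10)), PS12.IsSymmetry π →
      PS12.simplexSpline T (PS12.permute π (PS12.table p)) = PS12.simplexSpline T (PS12.table q) →
        p = q) := by
  refine ⟨fun K => ?_, fun p q π hπ heq => ?_⟩
  · rw [PS12.isC3QuinticSimplexSpline_and_iff hT]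
    simp only [PS12.isSymmetry_iff]
    constructor
    · rintro ⟨p, g, h⟩
      exact ⟨p, _, ⟨g, rfl⟩, h⟩
    · rintro ⟨p, _, ⟨g, rfl⟩, h⟩
      exact ⟨p, g, h⟩
  · obtain ⟨g, rfl⟩ := PS12.isSymmetry_iff.mp hπ
    have hq : PS12.permute (PS12.sym 0) (PS12.table q) = PS12.table q := by
      have h : ∀ i, PS12.symFun (PS12.symInv 0) i = i := by decide
      rw [PS12.permute_sym]
      simp only [h]
    exact PS12.eq_of_jump_eq p q g (PS12.jump_eq hT (PS12.sum_table p g) (PS12.spans_table p g)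
      (PS12.lowSupp_table p g) (hq ▸ PS12.sum_table q 0) (hq ▸ PS12.spans_table q 0)
      (hq ▸ PS12.lowSupp_table q 0) heq)
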